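/- Let $d\ge 1$, $m>0$, and let $T^d=\mathbb R^d/\mathbb Z^d$ be the torus with normalised Lebesgue measure. Let $\mathfrak H_+\subset L^2(T^d)$ be the orthogonal complement of the constant functions, $\mathcal F_+=\bigoplus_{n\ge 0}\mathfrak H_+^{\otimes_s n}$ the bosonic Fock space over $\mathfrak H_+$, and $$\mathcal H_+=L^2(T^d)\otimes\mathcal F_+ ,$$ where the first factor describes a tracer particle with position $x$. Let $\mathcal N_+$ be the number operator of $\mathcal F_+$ and $$H_0=-\tfrac1{2m}\Delta_x+d\Gamma(-\Delta),$$ with domain the intersection of the domains of its two self-adjoint summands. Let $(\phi_j)_{j\in\mathbb N_0}$ be an orthonormal basis of $L^2(T^d)$ with $\phi_0\equiv 1$, and let $a_j^*=a^*(\phi_j)$, $a_j=a(\phi_j)$, $j\ge 1$, be the creation and annihilation operators on $\mathcal F_+$. For $V,W\in L^2(T^d)$ (complex valued in general) put $W_x(y)=W(x-y)$, $$V_{jk\ell m}=\int_{T^d}\int_{T^d}\overline{\phi_j(y)}\,\overline{\phi_k(y')}\,V(y-y')\,\phi_\ell(y')\,\phi_m(y)\,dy'\,dy,\qquad (W_x)_{j0}=\int_{T^d}\overline{\phi_j(y)}\,W(x-y)\,dy,$$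 $$a^*(W_x)=\sum_{j\ge1}(W_x)_{j0}\,a_j^*,\qquad a(W_x)=\sum_{j\ge1}\overline{(W_x)_{j0}}\,a_j,$$ and define the Bogoliubov–Fröhlich Hamiltonian $$H^{\mathrm{BF}}=H_0+2\sum_{j,k\ge1}V_{j0k0}\,a_j^*a_k+\sum_{j,k\ge1}V_{jk00}\,a_j^*a_k^*+\sum_{j,k\ge1}V_{00jk}\,a_ja_k+a^*(W_x)+a(W_x).$$ (i) For all $V,W\in L^2(T^d)$, the difference $H^{\mathrm{BF}}-H_0$, i.e. the sum of the last five terms, is bounded relative to $\mathcal N_+$: for every $\Phi\in D(\mathcal N_+)$ the five series, applied to $\Phi$, are well defined and converge unconditionally in norm, and there are $a,b\ge 0$ such that $\|(H^{\mathrm{BF}}-H_0)\Phi\|\le a\|\mathcal N_+\Phi\|+b\|\Phi\|$ for all $\Phi\in D(\mathcal N_+)$. (ii) If moreover $V$ is real valued and even, $V(-y)=V(y)$, then $D(H_0)\subset D(H^{\mathrm{BF}})$ and $H^{\mathrm{BF}}$ is essentially self-adjoint on $D(H_0)$. -/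

import Mathlib

open MeasureTheory
open scoped ComplexConjugate InnerProductSpace ENNReal

/- The circle `ℝ / ℤ` carries the normalised Haar measure, as in Mathlib's treatment of
Fourier series on `UnitAddTorus`. -/
attribute [local instance] instMeasureSpaceUnitAddCircle
attribute [local instance] instIsAddHaarMeasureUnitAddCircleVolume
attribute [local instance] instIsProbabilityMeasureUnitAddCircleVolume

noncomputable section

namespace BogFrohlich

/-! ### Unbounded operators -/

section Operators

variable {E F G : Type*} [NormedAddCommGroup E] [NormedSpace ℂ E]
  [NormedAddCommGroup F] [NormedSpace ℂ F] [NormedAddCommGroup G] [NormedSpace ℂ G]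

/-- The product `A B` of unbounded operators on its natural domain
`{x ∈ D(B) | B x ∈ D(A)}`. -/
def opComp (A : F →ₗ.[ℂ] G) (B : E →ₗ.[ℂ] F) : E →ₗ.[ℂ] G where
  domain := (A.domain.comap B.toFun).map B.domain.subtype
  toFun :=
    { toFun := fun x => A ⟨B ⟨x, by obtain ⟨y, _, hy⟩ := x.2; exact hy ▸ y.2⟩, by
        obtain ⟨x, y, hy, rfl⟩ := x; exact hy⟩
      map_add' := by
        rintro ⟨_, x, hx, rfl⟩ ⟨_, y, hy, rfl⟩
        rw [← LinearPMap.map_add]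
        congr 1
        exact Subtype.ext (LinearPMap.map_add B x y)
      map_smul' := by
        rintro c ⟨_, x, hx, rfl⟩
        rw [RingHom.id_apply, ← LinearPMap.map_smul]
        congr 1
        exact Subtype.ext (LinearPMap.map_smul B c x) }

/-- The sum `∑ i, A i` of a family of unbounded operators, on its natural domain: the vectors
in every `D(A i)` for which the series `∑ i, A i x` converges unconditionally in norm. -/
def opSum {ι : Type*} (A : ι → E →ₗ.[ℂ] F) : E →ₗ.[ℂ] F where
  domain :=
    { carrier := {x | ∃ h : ∀ i, x ∈ (A i).domain, Summable fun i => A i ⟨x, h i⟩}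
      zero_mem' := by
        refine ⟨fun i => (A i).domain.zero_mem, ?_⟩
        have h0 : (fun i => A i ⟨0, (A i).domain.zero_mem⟩) = fun _ => (0 : F) :=
          funext fun i => LinearPMap.map_zero (A i)
        rw [h0]
        exact summable_zero
      add_mem' := by
        rintro x y ⟨hx, sx⟩ ⟨hy, sy⟩
        refine ⟨fun i => (A i).domain.add_mem (hx i) (hy i), ?_⟩
        refine (sx.add sy).congr fun i => ?_
        exact (LinearPMap.map_add (A i) ⟨x, hx i⟩ ⟨y, hy i⟩).symm
      smul_mem' := by
        rintro c x ⟨hx, sx⟩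
        refine ⟨fun i => (A i).domain.smul_mem c (hx i), ?_⟩
        refine (sx.const_smul c).congr fun i => ?_
        exact (LinearPMap.map_smul (A i) c ⟨x, hx i⟩).symm }
  toFun :=
    { toFun := fun x => ∑' i, A i ⟨x, x.2.1 i⟩
      map_add' := by
        rintro ⟨x, hx, sx⟩ ⟨y, hy, sy⟩
        rw [← sx.tsum_add sy]
        exact tsum_congr fun i => LinearPMap.map_add (A i) ⟨x, hx i⟩ ⟨y, hy i⟩
      map_smul' := by
        rintro c ⟨x, hx, sx⟩
        rw [RingHom.id_apply, ← sx.tsum_const_smul c]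
        exact tsum_congr fun i => LinearPMap.map_smul (A i) c ⟨x, hx i⟩ }

/-- `A` is bounded relative to `B`: `D(B) ⊆ D(A)` and `‖A x‖ ≤ a ‖B x‖ + b ‖x‖` on `D(B)`. -/
def IsRelativelyBounded (A B : E →ₗ.[ℂ] E) : Prop :=
  ∃ h : B.domain ≤ A.domain, ∃ a b : ℝ, 0 ≤ a ∧ 0 ≤ b ∧
    ∀ x : B.domain, ‖A ⟨x, h x.2⟩‖ ≤ a * ‖B x‖ + b * ‖(x : E)‖

end Operators

/-- `A` is essentially self-adjoint on the subspace `D ⊆ D(A)`: the restriction of `A` to `D` is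
densely defined and closable, and its closure is self-adjoint. -/
def IsEssentiallySelfAdjointOn {E : Type*} [NormedAddCommGroup E] [InnerProductSpace ℂ E]
    [CompleteSpace E] (A : E →ₗ.[ℂ] E) (D : Submodule ℂ E) : Prop :=
  D ≤ A.domain ∧ Dense (D : Set E) ∧ (A.domRestrict D).IsClosable ∧
    IsSelfAdjoint (A.domRestrict D).closure

/-! ### The Hilbert space -/

/-- The `d`-dimensional torus of side length one. -/
abbrev Torus (d : ℕ) := UnitAddTorus (Fin d)

/-- Configurations of the tracer, at position `z 0`, and of `n` bosons, at positions `z j` with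
`1 ≤ j ≤ n`. -/
abbrev Config (d n : ℕ) := Fin (n + 1) → Torus d

/-- `L²(α)`, complex valued. -/
abbrev L2 (α : Type*) [MeasureSpace α] := Lp ℂ 2 (volume : Measure α)

lemma measurePreserving_perm (d n : ℕ) (σ : Equiv.Perm (Fin n)) :
    MeasurePreserving (fun (z : Fin n → Torus d) (i : Fin n) => z (σ i)) volume volume := by
  have h := volume_measurePreserving_piCongrLeft (fun _ : Fin n => Torus d) σ.symm
  convert h using 1
  ext z i
  have := MeasurableEquiv.piCongrLeft_apply_apply (β := fun _ : Fin n => Torus d) σ.symm z (σ i)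
  simp at this
  rw [this]

lemma measurePreserving_insert (d n : ℕ) (j : Fin (n + 1)) :
    MeasurePreserving (MeasurableEquiv.piFinSuccAbove (fun _ : Fin (n + 1) => Torus d) j)
      volume (volume.prod volume) :=
  volume_preserving_piFinSuccAbove (fun _ : Fin (n + 1) => Torus d) j

lemma measurePreserving_forget (d n : ℕ) (j : Fin (n + 1)) :
    MeasurePreserving (fun (z : Fin (n + 1) → Torus d) (i : Fin n) => z (j.succAbove i))
      volume volume :=
  measurePreserving_snd.comp (measurePreserving_insert d n j)

/-- Relabelling of the particles: `(U_σ Φ)(z) = Φ(z ∘ σ)`. -/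
def relabel {d n : ℕ} (σ : Equiv.Perm (Fin n)) :
    L2 (Fin n → Torus d) →ₗᵢ[ℂ] L2 (Fin n → Torus d) :=
  Lp.compMeasurePreservingₗᵢ ℂ _ (measurePreserving_perm d n σ)

/-- A function of `n` particles viewed as a function of `n + 1` particles that does not depend on
the position of particle `j`. -/
def constIn {d n : ℕ} (j : Fin (n + 1)) :
    L2 (Fin n → Torus d) →ₗᵢ[ℂ] L2 (Fin (n + 1) → Torus d) :=
  Lp.compMeasurePreservingₗᵢ ℂ _ (measurePreserving_forget d n j)

/-- The `n`-excitation sector `L²(T^d) ⊗ 𝔥₊^{⊗ₛ n}`, where `𝔥₊ ⊂ L²(T^d)` is the orthogonal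
complement of the constants: the square-integrable functions of the tracer and `n` bosons that are
invariant under all permutations of the bosons and orthogonal to every function that is constant
in the position of some boson. -/
def sector (d n : ℕ) : Submodule ℂ (L2 (Config d n)) where
  carrier := {Φ | (∀ σ : Equiv.Perm (Fin (n + 1)), σ 0 = 0 → relabel σ Φ = Φ) ∧
    ∀ j : Fin (n + 1), j ≠ 0 → ∀ g : L2 (Fin n → Torus d), ⟪constIn j g, Φ⟫_ℂ = 0}
  zero_mem' := ⟨fun σ _ => map_zero _, fun j _ g => inner_zero_right _⟩
  add_mem' := by
    rintro Φ Ψ ⟨hΦ, hΦ'⟩ ⟨hΨ, hΨ'⟩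
    refine ⟨fun σ hσ => by rw [map_add, hΦ σ hσ, hΨ σ hσ], fun j hj g => ?_⟩
    rw [inner_add_right, hΦ' j hj g, hΨ' j hj g, add_zero]
  smul_mem' := by
    rintro c Φ ⟨hΦ, hΦ'⟩
    refine ⟨fun σ hσ => by rw [map_smul, hΦ σ hσ], fun j hj g => ?_⟩
    rw [inner_smul_right, hΦ' j hj g, mul_zero]

lemma isClosed_sector (d n : ℕ) : IsClosed (sector d n : Set (L2 (Config d n))) := by
  have h : (sector d n : Set (L2 (Config d n))) =
      {Φ | ∀ σ : Equiv.Perm (Fin (n + 1)), σ 0 = 0 → relabel σ Φ = Φ} ∩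
      {Φ | ∀ j : Fin (n + 1), j ≠ 0 → ∀ g : L2 (Fin n → Torus d), ⟪constIn j g, Φ⟫_ℂ = 0} := rfl
  rw [h]
  simp only [Set.ofPred_forall]
  refine IsClosed.inter ?_ ?_
  · exact isClosed_iInter fun σ => isClosed_iInter fun _ =>
      isClosed_eq (relabel σ).continuous continuous_id
  · exact isClosed_iInter fun j => isClosed_iInter fun _ => isClosed_iInter fun g =>
      isClosed_eq (continuous_const.inner continuous_id) continuous_const

instance (d n : ℕ) : CompleteSpace (sector d n) :=
  (isClosed_sector d n).completeSpace_coe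

/-- The Hilbert space `L²(T^d) ⊗ Γ(𝔥₊) = ⨁ₙ L²(T^d) ⊗ 𝔥₊^{⊗ₛ n}` of the tracer and the
excitations, as a Hilbert sum. -/
abbrev Hplus (d : ℕ) := lp (fun n : ℕ => sector d n) 2

/-! ### Creation and annihilation operators -/

/-- `Φ(z₀, …, zₙ) f(z_{n+1})` is square integrable, with the product of the norms as its norm. -/
lemma eLpNorm_appendParticle {d n : ℕ} (f : L2 (Torus d)) (Φ : L2 (Config d n)) :
    AEStronglyMeasurable (fun z : Config d (n + 1) =>
      f (z (Fin.last (n + 1))) * Φ (fun i => z ((Fin.last (n + 1)).succAbove i))) volume ∧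
    eLpNorm (fun z : Config d (n + 1) =>
      f (z (Fin.last (n + 1))) * Φ (fun i => z ((Fin.last (n + 1)).succAbove i))) 2 volume =
      eLpNorm f 2 volume * eLpNorm Φ 2 volume := by
  have he := measurePreserving_insert d (n + 1) (Fin.last (n + 1))
  have hm : AEStronglyMeasurable (fun p : Torus d × Config d n => f p.1 * Φ p.2)
      (volume.prod volume) :=
    (Lp.aestronglyMeasurable f).comp_fst.mul (Lp.aestronglyMeasurable Φ).comp_snd
  refine ⟨hm.comp_measurePreserving he, ?_⟩
  have h1 := eLpNorm_comp_measurePreserving (p := 2) hm he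
  refine h1.trans ?_
  rw [eLpNorm_eq_lintegral_rpow_enorm_toReal (by norm_num) (by norm_num),
    eLpNorm_eq_lintegral_rpow_enorm_toReal (by norm_num) (by norm_num),
    eLpNorm_eq_lintegral_rpow_enorm_toReal (by norm_num) (by norm_num),
    ← ENNReal.mul_rpow_of_nonneg _ _ (by norm_num)]
  congr 1
  rw [← lintegral_prod_mul]
  · refine lintegral_congr fun p => ?_
    rw [enorm_mul, ENNReal.mul_rpow_of_nonneg _ _ (by norm_num)]
  · exact (Lp.aestronglyMeasurable f).enorm.pow_const _
  · exact (Lp.aestronglyMeasurable Φ).enorm.pow_const _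

lemma memLp_appendParticle {d n : ℕ} (f : L2 (Torus d)) (Φ : L2 (Config d n)) :
    MemLp (fun z : Config d (n + 1) =>
      f (z (Fin.last (n + 1))) * Φ (fun i => z ((Fin.last (n + 1)).succAbove i))) 2 volume := by
  refine ⟨(eLpNorm_appendParticle f Φ).1, ?_⟩
  rw [(eLpNorm_appendParticle f Φ).2]
  exact ENNReal.mul_lt_top (Lp.memLp f).2 (Lp.memLp Φ).2

/-- The (not symmetrised) tensor product with `f` in the variable of a new last particle,
`(f ⊗ Φ)(z₀, …, z_{n+1}) = f(z_{n+1}) Φ(z₀, …, zₙ)`. -/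
def appendParticle {d n : ℕ} (f : L2 (Torus d)) : L2 (Config d n) →L[ℂ] L2 (Config d (n + 1)) :=
  LinearMap.mkContinuous
    { toFun := fun Φ => (memLp_appendParticle f Φ).toLp _
      map_add' := by
        intro Φ Ψ
        rw [← MemLp.toLp_add]
        refine (MemLp.toLp_eq_toLp_iff _ _).2 ?_
        have h := (measurePreserving_forget d (n + 1)
          (Fin.last (n + 1))).quasiMeasurePreserving.ae (Lp.coeFn_add Φ Ψ)
        filter_upwards [h] with z hz
        rw [hz]
        simp only [Pi.add_apply, mul_add]
      map_smul' := by
        intro c Φ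
        rw [RingHom.id_apply, ← MemLp.toLp_const_smul]
        refine (MemLp.toLp_eq_toLp_iff _ _).2 ?_
        have h := (measurePreserving_forget d (n + 1)
          (Fin.last (n + 1))).quasiMeasurePreserving.ae (Lp.coeFn_smul c Φ)
        filter_upwards [h] with z hz
        rw [hz]
        simp only [Pi.smul_apply, smul_eq_mul]
        ring }
    ‖f‖ (by
      intro Φ
      refine le_of_eq ?_
      change ‖(memLp_appendParticle f Φ).toLp _‖ = _
      rw [Lp.norm_toLp, (eLpNorm_appendParticle f Φ).2, ENNReal.toReal_mul, Lp.norm_def,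
        Lp.norm_def])

/-- The creation operator from the `n`- to the `(n + 1)`-excitation sector,
`a*(f) Φ = √(n + 1) P (f ⊗ Φ)` with `P` the orthogonal projection onto the sector, that is, the
projection onto `𝔥₊` in each boson variable followed by symmetrisation. -/
def creSector {d : ℕ} (n : ℕ) (f : L2 (Torus d)) : sector d n →L[ℂ] sector d (n + 1) :=
  ((Real.sqrt (n + 1) : ℝ) : ℂ) •
    ((sector d (n + 1)).orthogonalProjectionOnto ∘L appendParticle f ∘L (sector d n).subtypeL)

/-- The annihilation operator from the `(n + 1)`- to the `n`-excitation sector, the adjoint of the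
creation operator. -/
def annSector {d : ℕ} (n : ℕ) (f : L2 (Torus d)) : sector d (n + 1) →L[ℂ] sector d n :=
  ContinuousLinearMap.adjoint (creSector n f)

/-- The graph of the creation operator `a*(f)`. -/
def creGraph {d : ℕ} (f : L2 (Torus d)) : Submodule ℂ (Hplus d × Hplus d) where
  carrier := {p | p.2 0 = 0 ∧ ∀ n, p.2 (n + 1) = creSector n f (p.1 n)}
  zero_mem' := ⟨rfl, fun n => (map_zero (creSector n f)).symm⟩
  add_mem' := by
    rintro p q ⟨hp, hp'⟩ ⟨hq, hq'⟩
    refine ⟨?_, fun n => ?_⟩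
    · simp [hp, hq]
    · simp [hp', hq']
  smul_mem' := by
    rintro c p ⟨hp, hp'⟩
    refine ⟨?_, fun n => ?_⟩
    · simp [hp]
    · simp [hp']

lemma creGraph_functional {d : ℕ} (f : L2 (Torus d)) :
    ∀ p ∈ creGraph f, p.1 = 0 → p.2 = 0 := by
  rintro ⟨Φ, Ψ⟩ ⟨h0, h⟩ rfl
  ext1
  funext n
  cases n with
  | zero => exact h0
  | succ n => exact (h n).trans (map_zero (creSector n f))

/-- The creation operator `a*(f)` on its maximal domain. -/
def cre {d : ℕ} (f : L2 (Torus d)) : Hplus d →ₗ.[ℂ] Hplus d := (creGraph f).toLinearPMap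

/-- The graph of the annihilation operator `a(f)`. -/
def annGraph {d : ℕ} (f : L2 (Torus d)) : Submodule ℂ (Hplus d × Hplus d) where
  carrier := {p | ∀ n, p.2 n = annSector n f (p.1 (n + 1))}
  zero_mem' := fun n => (map_zero (annSector n f)).symm
  add_mem' := by
    intro p q hp hq n
    simp [hp n, hq n]
  smul_mem' := by
    intro c p hp n
    simp [hp n]

lemma annGraph_functional {d : ℕ} (f : L2 (Torus d)) :
    ∀ p ∈ annGraph f, p.1 = 0 → p.2 = 0 := by
  rintro ⟨Φ, Ψ⟩ h rfl
  ext1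
  funext n
  exact (h n).trans (map_zero (annSector n f))

/-- The annihilation operator `a(f)` on its maximal domain. -/
def ann {d : ℕ} (f : L2 (Torus d)) : Hplus d →ₗ.[ℂ] Hplus d := (annGraph f).toLinearPMap

/-- The graph of the number operator. -/
def numberGraph (d : ℕ) : Submodule ℂ (Hplus d × Hplus d) where
  carrier := {p | ∀ n : ℕ, p.2 n = (n : ℂ) • p.1 n}
  zero_mem' := fun n => (smul_zero _).symm
  add_mem' := by
    intro p q hp hq n
    simp [hp n, hq n]
  smul_mem' := by
    intro c p hp n
    simp [hp n, smul_comm c]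

lemma numberGraph_functional (d : ℕ) : ∀ p ∈ numberGraph d, p.1 = 0 → p.2 = 0 := by
  rintro ⟨Φ, Ψ⟩ h rfl
  ext1
  funext n
  exact (h n).trans (smul_zero _)

/-- The number operator `𝒩₊` of the excitations: multiplication by `n` on the `n`-excitation
sector, with domain `{Φ | ∑ₙ n² ‖Φ⁽ⁿ⁾‖² < ∞}`. -/
def numberOp (d : ℕ) : Hplus d →ₗ.[ℂ] Hplus d := (numberGraph d).toLinearPMap

/-! ### Multiplication operators in the position of the tracer -/

/-- The graph of multiplication by `w(x)`, `x` the position of the tracer. -/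
def tracerMulGraph {d : ℕ} (w : Torus d → ℂ) : Submodule ℂ (Hplus d × Hplus d) where
  carrier := {p | ∀ n, (fun z => (p.2 n : L2 (Config d n)) z) =ᵐ[volume]
    fun z => w (z 0) * (p.1 n : L2 (Config d n)) z}
  zero_mem' := by
    intro n
    filter_upwards [Lp.coeFn_zero ℂ 2 (volume : Measure (Config d n))] with z hz
    have h : ((0 : L2 (Config d n)) : Config d n → ℂ) z = 0 := hz
    change ((0 : L2 (Config d n)) : Config d n → ℂ) z =
      w (z 0) * ((0 : L2 (Config d n)) : Config d n → ℂ) z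
    rw [h, mul_zero]
  add_mem' := by
    intro p q hp hq n
    filter_upwards [hp n, hq n, Lp.coeFn_add (p.1 n : L2 (Config d n)) (q.1 n),
      Lp.coeFn_add (p.2 n : L2 (Config d n)) (q.2 n)] with z h1 h2 h3 h4
    refine Eq.trans h4 (Eq.trans ?_ (congrArg (fun t => w (z 0) * t) h3.symm))
    simp only [Pi.add_apply, h1, h2, mul_add]
  smul_mem' := by
    intro c p hp n
    filter_upwards [hp n, Lp.coeFn_smul c (p.1 n : L2 (Config d n)),
      Lp.coeFn_smul c (p.2 n : L2 (Config d n))] with z h1 h3 h4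
    refine Eq.trans h4 (Eq.trans ?_ (congrArg (fun t => w (z 0) * t) h3.symm))
    simp only [Pi.smul_apply, smul_eq_mul, h1]
    ring

lemma tracerMulGraph_functional {d : ℕ} (w : Torus d → ℂ) :
    ∀ p ∈ tracerMulGraph w, p.1 = 0 → p.2 = 0 := by
  rintro ⟨Φ, Ψ⟩ h rfl
  ext1
  funext n
  refine Subtype.ext (Lp.ext ?_)
  filter_upwards [h n, Lp.coeFn_zero ℂ 2 (volume : Measure (Config d n))] with z h1 h2
  have h3 : ((0 : L2 (Config d n)) : Config d n → ℂ) z = 0 := h2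
  refine h1.trans ?_
  change w (z 0) * ((0 : L2 (Config d n)) : Config d n → ℂ) z =
    ((0 : L2 (Config d n)) : Config d n → ℂ) z
  rw [h3, mul_zero]

/-- Multiplication by the function `w(x)` of the position `x` of the tracer, on its maximal
domain. -/
def tracerMul {d : ℕ} (w : Torus d → ℂ) : Hplus d →ₗ.[ℂ] Hplus d :=
  (tracerMulGraph w).toLinearPMap

/-! ### The kinetic energy -/

/-- The plane wave `z ↦ ∏ᵢ exp(2π i kᵢ · zᵢ)`. -/
def planeWave {d n : ℕ} (k : Fin n → Fin d → ℤ) : L2 (Fin n → Torus d) :=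
  ContinuousMap.toLp (E := ℂ) 2 volume ℂ
    ⟨fun z => ∏ i, UnitAddTorus.mFourier (k i) (z i), by fun_prop⟩

lemma measurePreserving_uncurry (d n : ℕ) :
    MeasurePreserving (fun (z : Fin n → Torus d) (q : Fin n × Fin d) => z q.1 q.2)
      volume (volume : Measure (UnitAddTorus (Fin n × Fin d))) := by
  have hmeas : Measurable (fun (z : Fin n → Torus d) (q : Fin n × Fin d) => z q.1 q.2) := by
    fun_prop
  refine ⟨hmeas, (Measure.pi_eq fun s hs => ?_).symm⟩
  rw [Measure.map_apply hmeas (MeasurableSet.univ_pi hs)]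
  have h : (fun (z : Fin n → Torus d) (q : Fin n × Fin d) => z q.1 q.2) ⁻¹' (Set.univ.pi s) =
      Set.univ.pi fun i => Set.univ.pi fun a => s (i, a) := by
    ext z
    simp [Set.mem_pi]
  rw [h, volume_pi_pi, Fintype.prod_prod_type]
  exact Finset.prod_congr rfl fun i _ => volume_pi_pi _

lemma measurePreserving_curry (d n : ℕ) :
    MeasurePreserving (fun (w : UnitAddTorus (Fin n × Fin d)) (i : Fin n) (a : Fin d) => w (i, a))
      volume (volume : Measure (Fin n → Torus d)) := by
  let e : (Fin n → Torus d) ≃ᵐ UnitAddTorus (Fin n × Fin d) :=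
    { toFun := fun z q => z q.1 q.2
      invFun := fun w i a => w (i, a)
      left_inv := fun _ => rfl
      right_inv := fun _ => rfl
      measurable_toFun := (measurePreserving_uncurry d n).measurable
      measurable_invFun :=
        measurable_pi_lambda _ fun i => measurable_pi_lambda _ fun a =>
          measurable_pi_apply (i, a) }
  exact (show MeasurePreserving e volume volume from measurePreserving_uncurry d n).symm e

/-- A square-integrable function is determined by its Fourier coefficients. -/
lemma eq_zero_of_planeWave {d n : ℕ} (Φ : L2 (Fin n → Torus d))
    (h : ∀ k, ⟪planeWave k, Φ⟫_ℂ = 0) : Φ = 0 := by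
  have hU := measurePreserving_curry d n
  let U := Lp.compMeasurePreservingₗᵢ (E := ℂ) (p := 2) ℂ _ hU
  have hw : ∀ k : Fin n × Fin d → ℤ,
      U (planeWave fun i a => k (i, a)) = UnitAddTorus.mFourierLp 2 k := by
    intro k
    refine Lp.ext ?_
    have h1 := Lp.coeFn_compMeasurePreserving (planeWave fun i a => k (i, a)) hU
    have h2 := hU.quasiMeasurePreserving.ae (ContinuousMap.coeFn_toLp (p := 2) (𝕜 := ℂ)
      (volume : Measure (Fin n → Torus d))
      ⟨fun z => ∏ i, UnitAddTorus.mFourier (fun a => k (i, a)) (z i), by fun_prop⟩)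
    filter_upwards [h1, h2, UnitAddTorus.coeFn_mFourierLp 2 k] with w h1 h2 h3
    refine h1.trans ?_
    refine Eq.trans h2 ?_
    rw [h3]
    simp [UnitAddTorus.mFourier, Fintype.prod_prod_type]
  have hz : U Φ = 0 := by
    refine UnitAddTorus.mFourierBasis.repr.injective ?_
    rw [map_zero]
    ext k
    rw [HilbertBasis.repr_apply_apply, UnitAddTorus.coe_mFourierBasis, ← hw k,
      LinearIsometry.inner_map_map, h]
    rfl
  exact U.injective (hz.trans (map_zero U).symm)

/-- The graph of the Fourier multiplier with symbol `e`. -/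
def multiplierGraph {d : ℕ} (e : ∀ n : ℕ, (Fin (n + 1) → Fin d → ℤ) → ℝ) :
    Submodule ℂ (Hplus d × Hplus d) where
  carrier := {p | ∀ (n : ℕ) (k : Fin (n + 1) → Fin d → ℤ),
    ⟪planeWave k, (p.2 n : L2 (Config d n))⟫_ℂ =
      (e n k : ℂ) * ⟪planeWave k, (p.1 n : L2 (Config d n))⟫_ℂ}
  zero_mem' := by
    intro n k
    simp
  add_mem' := by
    intro p q hp hq n k
    simp [inner_add_right, hp n k, hq n k, mul_add]
  smul_mem' := by
    intro c p hp n k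
    simp [inner_smul_right, hp n k]
    ring

lemma multiplierGraph_functional {d : ℕ} (e : ∀ n : ℕ, (Fin (n + 1) → Fin d → ℤ) → ℝ) :
    ∀ p ∈ multiplierGraph e, p.1 = 0 → p.2 = 0 := by
  rintro ⟨Φ, Ψ⟩ h rfl
  ext1
  funext n
  refine Subtype.ext (eq_zero_of_planeWave _ fun k => ?_)
  refine (h n k).trans ?_
  simp

/-- The Fourier multiplier acting on the `n`-excitation sector by multiplication of the `k`-th
Fourier coefficient by `e n k`, on its maximal domain. -/
def multiplier {d : ℕ} (e : ∀ n : ℕ, (Fin (n + 1) → Fin d → ℤ) → ℝ) :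
    Hplus d →ₗ.[ℂ] Hplus d := (multiplierGraph e).toLinearPMap

/-- The eigenvalue `4π² |k|²` of `-Δ` on the plane wave `exp(2π i k · y)` on the torus. -/
def laplaceSymbol {d : ℕ} (k : Fin d → ℤ) : ℝ := 4 * Real.pi ^ 2 * ∑ a, (k a : ℝ) ^ 2

/-- `-Δₓ`, the Laplacian in the position of the tracer. -/
def tracerLaplacian (d : ℕ) : Hplus d →ₗ.[ℂ] Hplus d :=
  multiplier fun _ k => laplaceSymbol (k 0)

/-- `dΓ(-Δ)`: on the `n`-excitation sector, the sum of the operators `-Δ` in the positions of the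
`n` bosons. -/
def dGammaLaplacian (d : ℕ) : Hplus d →ₗ.[ℂ] Hplus d :=
  multiplier fun n k => ∑ j : Fin n, laplaceSymbol (k j.succ)

/-- `H₀ = -(1/2m) Δₓ + dΓ(-Δ)`. -/
def freeHamiltonian (d : ℕ) (m : ℝ) : Hplus d →ₗ.[ℂ] Hplus d :=
  ((1 / (2 * m) : ℝ) : ℂ) • tracerLaplacian d + dGammaLaplacian d

/-! ### The Bogoliubov-Fröhlich Hamiltonian -/

/-- The matrix elements `V_{jklm} = ∫∫ φ̄ⱼ(y) φ̄ₖ(y') V(y - y') φₗ(y') φₘ(y) dy' dy`. -/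
def matV {d : ℕ} (φ : ℕ → L2 (Torus d)) (V : L2 (Torus d)) (j k l m : ℕ) : ℂ :=
  ∫ y, ∫ y', conj (φ j y) * conj (φ k y') * V (y - y') * φ l y' * φ m y

/-- The matrix elements `(W_x)_{jk} = ∫ φ̄ⱼ(y) φₖ(y) W(x - y) dy`. -/
def matW {d : ℕ} (φ : ℕ → L2 (Torus d)) (W : L2 (Torus d)) (j k : ℕ) (x : Torus d) : ℂ :=
  ∫ y, conj (φ j y) * φ k y * W (x - y)

/-- `a*(W_x) = ∑_{j ≥ 1} (W_x)_{j0} a_j*`. -/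
def creW {d : ℕ} (φ : ℕ → L2 (Torus d)) (W : L2 (Torus d)) : Hplus d →ₗ.[ℂ] Hplus d :=
  opSum fun j : ℕ => opComp (tracerMul (matW φ W (j + 1) 0)) (cre (φ (j + 1)))

/-- `a(W_x) = ∑_{j ≥ 1} conj((W_x)_{j0}) a_j`; for real `W`, `conj((W_x)_{j0}) = (W_x)_{0j}`. -/
def annW {d : ℕ} (φ : ℕ → L2 (Torus d)) (W : L2 (Torus d)) : Hplus d →ₗ.[ℂ] Hplus d :=
  opSum fun j : ℕ => opComp (tracerMul fun x => conj (matW φ W (j + 1) 0 x)) (ann (φ (j + 1)))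

/-- The part of the Bogoliubov Hamiltonian that is quadratic in the interaction,
`2 ∑ V_{j0k0} a_j* a_k + ∑ V_{jk00} a_j* a_k* + ∑ V_{00jk} a_j a_k`, the sums being over
`j, k ≥ 1`. -/
def quadraticV {d : ℕ} (φ : ℕ → L2 (Torus d)) (V : L2 (Torus d)) : Hplus d →ₗ.[ℂ] Hplus d :=
  (2 : ℂ) • (opSum fun q : ℕ × ℕ =>
      matV φ V (q.1 + 1) 0 (q.2 + 1) 0 • opComp (cre (φ (q.1 + 1))) (ann (φ (q.2 + 1)))) +
    (opSum fun q : ℕ × ℕ =>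
      matV φ V (q.1 + 1) (q.2 + 1) 0 0 • opComp (cre (φ (q.1 + 1))) (cre (φ (q.2 + 1)))) +
    opSum fun q : ℕ × ℕ =>
      matV φ V 0 0 (q.1 + 1) (q.2 + 1) • opComp (ann (φ (q.1 + 1))) (ann (φ (q.2 + 1)))

/-- The difference `H^BF - H₀`, on its natural domain. -/
def interaction {d : ℕ} (φ : ℕ → L2 (Torus d)) (V W : L2 (Torus d)) : Hplus d →ₗ.[ℂ] Hplus d :=
  quadraticV φ V + creW φ W + annW φ W

/-- The Bogoliubov-Fröhlich Hamiltonian `H^BF = H₀ + (H^BF - H₀)`, on its natural domain. -/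
def hamiltonianBF {d : ℕ} (m : ℝ) (φ : ℕ → L2 (Torus d)) (V W : L2 (Torus d)) :
    Hplus d →ₗ.[ℂ] Hplus d :=
  freeHamiltonian d m + interaction φ V W

end BogFrohlich

end

noncomputable section

namespace BogFrohlich

/-! ### Abstract criteria for essential self-adjointness -/

section EssentialSelfAdjointness

variable {E : Type*} [NormedAddCommGroup E] [InnerProductSpace ℂ E]

/-! Part (i) is Hilbert–Schmidt bookkeeping. Since `φ 0 = 1`, Bessel's inequality for the translates
of `V` and `W` shows that the three matrices built from `V` are square summable and that `∑ j,
‖(W_x)_{j0}‖²` is at most `‖W‖²` for every `x`. On a fixed sector, orthonormality of the modes gives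
`‖∑ a_j* Φ_j‖² ≤ (n + 1) ∑ ‖Φ_j‖²` (`norm_sum_creSector_sq_le`), and duality gives `∑ ‖a_j Ψ‖² ≤ (n
+ 1) ‖Ψ‖²` (`sum_norm_annSector_sq_le`). Hence each of the five series converges strongly to a block
operator that changes `n` by at most two and whose blocks have norm `O(n)`; `exists_blocks` collects
this. The commutation relations are never needed.

Part (ii) cannot be read off from relative boundedness, because the relative bound need not be
small. It rests on Carleman's criterion for block Jacobi operators. Every excitation has nonzero
momentum, so `dΓ(-Δ)` dominates the number operator and `D(H₀) ⊆ D(𝒩₊)`. For real even `V` the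
blocks are symmetric, so it suffices to exclude deficiency vectors
(`isSelfAdjoint_closure_of_deficiency`).

Let `Ψ` be a deficiency vector for `z = ±i`. Test its equation with the Fourier truncations of the
single component `Ψ n`. The term with `H₀` is real, so it disappears from the imaginary part before
the truncation is removed (`im_deficiency`). What remains expresses `±‖Ψ n‖²` through currents
between sector `n` and the sectors at distance one and two. Summed over the sectors up to `N + 1`,
all currents cancel except the three crossing the boundary, and these are `O(N)` times products of
norms of neighbouring components. If `Ψ ≠ 0`, the sum is bounded below, so `1/N` would be dominated
by a summable sequence (`eq_zero_of_telescoping`). -/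

lemma norm_le_norm_sub_of_symmetric {x y : E} {z : ℂ} (hz : z = Complex.I ∨ z = -Complex.I)
    (h : (⟪x, y⟫_ℂ).im = 0) : ‖x‖ ≤ ‖y - z • x‖ := by
  -- The inner product with `y` is real, so the imaginary part is `∓‖x‖²`; Cauchy–Schwarz then
  -- bounds `‖x‖²`.
  have h1 : (⟪x, y - z • x⟫_ℂ).im = -(z.im * ‖x‖ ^ 2) := by
    rw [inner_sub_right, inner_smul_right, inner_self_eq_norm_sq_to_K, Complex.sub_im, h]
    change 0 - (z * (‖x‖ : ℂ) ^ 2).im = _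
    rw [← Complex.ofReal_pow, Complex.im_mul_ofReal, zero_sub]
  have h2 : ‖x‖ ^ 2 ≤ ‖x‖ * ‖y - z • x‖ := by
    refine le_trans ?_ (norm_inner_le_norm (𝕜 := ℂ) x (y - z • x))
    refine le_trans (le_of_eq ?_) (Complex.abs_im_le_norm _)
    rw [h1]
    rcases hz with rfl | rfl <;> simp
  rcases (norm_nonneg x).eq_or_lt with h0 | h0
  · rw [← h0]; positivity
  · nlinarith

/-- Symmetry is a closed condition on pairs of graph points, so it survives the closure. -/
lemma inner_symm_of_mem_closure {G : Submodule ℂ (E × E)}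
    (hG : ∀ p ∈ G, ∀ q ∈ G, ⟪p.2, q.1⟫_ℂ = ⟪p.1, q.2⟫_ℂ) {p q : E × E}
    (hp : p ∈ G.topologicalClosure) (hq : q ∈ G.topologicalClosure) :
    ⟪p.2, q.1⟫_ℂ = ⟪p.1, q.2⟫_ℂ := by
  have hc : IsClosed {r : (E × E) × (E × E) | ⟪r.1.2, r.2.1⟫_ℂ = ⟪r.1.1, r.2.2⟫_ℂ} :=
    isClosed_eq (by fun_prop) (by fun_prop)
  have hs : (G : Set (E × E)) ×ˢ (G : Set (E × E)) ⊆
      {r : (E × E) × (E × E) | ⟪r.1.2, r.2.1⟫_ℂ = ⟪r.1.1, r.2.2⟫_ℂ} :=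
    fun r hr => hG _ hr.1 _ hr.2
  have := closure_minimal hs hc
  rw [closure_prod_eq] at this
  exact this (show (p, q) ∈ _ from ⟨hp, hq⟩)

variable [CompleteSpace E]

/-- A symmetric operator both of whose deficiency spaces are trivial is essentially
self-adjoint. -/
theorem isSelfAdjoint_closure_of_deficiency (T : E →ₗ.[ℂ] E) (hd : Dense (T.domain : Set E))
    (hs : T.IsFormalAdjoint T)
    (hdef : ∀ z : ℂ, z = Complex.I ∨ z = -Complex.I → ∀ Ψ : E,
      (∀ x : T.domain, ⟪Ψ, T x⟫_ℂ = z * ⟪Ψ, (x : E)⟫_ℂ) → Ψ = 0) :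
    T.IsClosable ∧ IsSelfAdjoint T.closure := by
  have hle : T ≤ T.adjoint := hs.le_adjoint hd
  have hcl : T.IsClosable := (LinearPMap.adjoint_isClosed hd).isClosable.leIsClosable hle
  refine ⟨hcl, ?_⟩
  have hgr := hcl.graph_closure_eq_closure_graph
  have hdS : Dense (T.closure.domain : Set E) := hd.mono T.le_closure.1
  have hsym : ∀ p ∈ T.graph, ∀ q ∈ T.graph, ⟪p.2, q.1⟫_ℂ = ⟪p.1, q.2⟫_ℂ := by
    rintro ⟨a, b⟩ hp ⟨c, e⟩ hq
    obtain ⟨x, rfl, rfl⟩ := (LinearPMap.mem_graph_iff T).1 hp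
    obtain ⟨y, rfl, rfl⟩ := (LinearPMap.mem_graph_iff T).1 hq
    exact hs x y
  have hS : T.closure.IsFormalAdjoint T.closure := fun x y =>
    inner_symm_of_mem_closure hsym (p := (x, T.closure x)) (q := (y, T.closure y))
      (hgr ▸ LinearPMap.mem_graph _ x) (hgr ▸ LinearPMap.mem_graph _ y)
  have h1 : T.closure ≤ T.closure.adjoint := hS.le_adjoint hdS
  have h2 : T.closure.adjoint ≤ T.adjoint := by
    refine LinearPMap.IsFormalAdjoint.le_adjoint hd fun x y => ?_
    have := (LinearPMap.adjoint_isFormalAdjoint hdS).symm ⟨x, T.le_closure.1 x.2⟩ y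
    rw [← this, T.le_closure.2 (x := x) (y := ⟨x, T.le_closure.1 x.2⟩) rfl]
  -- The only inclusion that uses the deficiency hypothesis: for `y = T* x`, solve `(T̄ - i) x' = y
  -- - i x` and show `x' = x`.
  have h3 : T.adjoint ≤ T.closure := by
    refine LinearPMap.le_of_le_graph ?_
    rintro ⟨x, y⟩ hxy
    rw [← hgr]
    have hadj : ∀ u : T.domain, ⟪y, (u : E)⟫_ℂ = ⟪x, T u⟫_ℂ := by
      obtain ⟨w, rfl, rfl⟩ := (LinearPMap.mem_graph_iff _).1 hxy
      exact fun u => LinearPMap.adjoint_isFormalAdjoint hd w u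
    let R : Submodule ℂ E := LinearMap.range (T.toFun - Complex.I • T.domain.subtype)
    -- A vector orthogonal to the range of `T - i` is a deficiency vector for `z = i`.
    have hR : Dense (R : Set E) := by
      rw [Submodule.dense_iff_topologicalClosure_eq_top, Submodule.topologicalClosure_eq_top_iff,
        Submodule.eq_bot_iff]
      intro Ψ hΨ
      refine hdef _ (Or.inl rfl) Ψ fun u => ?_
      have := (Submodule.mem_orthogonal' _ _).1 hΨ _ ⟨u, rfl⟩
      simp only [LinearMap.sub_apply, LinearMap.smul_apply, Submodule.subtype_apply,
        inner_sub_right, inner_smul_right] at this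
      exact sub_eq_zero.1 this
    obtain ⟨v, hvR, hv⟩ := mem_closure_iff_seq_limit.1 (hR (y - Complex.I • x))
    choose u hu using hvR
    have hu' : ∀ k, v k = T (u k) - Complex.I • (u k : E) := fun k => (hu k).symm
    -- `T - i` does not shrink norms, so convergence of `(T - i) u k` forces convergence of `u k`.
    have hcau : CauchySeq fun k => (u k : E) := by
      have hvc := hv.cauchySeq
      rw [Metric.cauchySeq_iff] at hvc ⊢
      intro ε hε
      obtain ⟨N, hN⟩ := hvc ε hε
      refine ⟨N, fun a ha b hb => lt_of_le_of_lt ?_ (hN a ha b hb)⟩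
      rw [dist_eq_norm, dist_eq_norm, hu' a, hu' b]
      have him : (⟪((u a - u b : T.domain) : E), T (u a - u b)⟫_ℂ).im = 0 := by
        rw [← Complex.conj_eq_iff_im, inner_conj_symm]
        exact hs _ _
      have := norm_le_norm_sub_of_symmetric (Or.inl rfl) him
      rw [LinearPMap.map_sub] at this
      refine this.trans (le_of_eq ?_)
      congr 1
      rw [Submodule.coe_sub, smul_sub]
      abel
    obtain ⟨x', hx'⟩ := cauchySeq_tendsto_of_complete hcau
    have hTu : Filter.Tendsto (fun k => T (u k)) Filter.atTop
        (nhds (y - Complex.I • x + Complex.I • x')) := by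
      refine (hv.add (hx'.const_smul Complex.I)).congr fun k => ?_
      rw [hu' k]
      abel
    have hmem : (x', y - Complex.I • x + Complex.I • x') ∈ T.graph.topologicalClosure :=
      mem_closure_of_tendsto (hx'.prodMk_nhds hTu)
        (Filter.Eventually.of_forall fun k => LinearPMap.mem_graph T (u k))
    -- The difference lies in the kernel of `T* - i`, which is the deficiency space for `z = -i`
    -- because the inner product is conjugate-linear on the left.
    have hxx : x - x' = 0 := by
      refine hdef _ (Or.inr rfl) _ fun w => ?_
      have h5 := inner_symm_of_mem_closure hsym hmem
        (Submodule.le_topologicalClosure _ (LinearPMap.mem_graph T w))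
      simp only [inner_add_left, inner_sub_left, inner_smul_left, Complex.conj_I, hadj] at h5
      rw [inner_sub_left, inner_sub_left, ← h5]
      ring
    obtain rfl := sub_eq_zero.1 hxx
    rwa [sub_add_cancel] at hmem
  exact LinearPMap.isSelfAdjoint_def.2 (le_antisymm (h2.trans h3) h1)

end EssentialSelfAdjointness

/-- Carleman's criterion for block Jacobi operators with linearly growing off-diagonal blocks. -/
lemma eq_zero_of_telescoping {x β γ : ℕ → ℝ} {C s : ℝ} (hs : s = 1 ∨ s = -1)
    (hx : Summable fun n => x n ^ 2)
    (hβ : ∀ n : ℕ, |β n| ≤ C * (n + 1) * (x n * x (n + 2)))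
    (hγ : ∀ n : ℕ, |γ n| ≤ C * (n + 1) * (x n * x (n + 1)))
    (hC : 0 ≤ C)
    (h : ∀ N : ℕ, s * ∑ n ∈ Finset.range (N + 2), x n ^ 2 = β N + β (N + 1) + γ (N + 1)) :
    ∀ n, x n = 0 := by
  by_contra! hne
  obtain ⟨n₀, hn₀⟩ := hne
  have hpos : 0 < x n₀ ^ 2 := by positivity
  -- Chosen so that `(N + 2) * y N` dominates the three boundary terms by `a b ≤ a² + b²`; the
  -- squares at `N + 1` and `N + 2` occur twice there, whence the factor 2.
  let y : ℕ → ℝ := fun N => C * (2 * (x N ^ 2 + x (N + 1) ^ 2 + x (N + 2) ^ 2 + x (N + 3) ^ 2))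
  have hy : Summable y := by
    have hsh := fun k => (summable_nat_add_iff (f := fun n => x n ^ 2) k).2 hx
    exact ((((hx.add (hsh 1)).add (hsh 2)).add (hsh 3)).mul_left 2).mul_left C
  have hbig : ∀ N, n₀ ≤ N → x n₀ ^ 2 * (((N : ℝ) + 2)⁻¹) ≤ y N := by
    intro N hN
    have h1 : x n₀ ^ 2 ≤ ∑ n ∈ Finset.range (N + 2), x n ^ 2 :=
      Finset.single_le_sum (f := fun n => x n ^ 2) (fun i _ => sq_nonneg _)
        (Finset.mem_range.2 (by omega))
    have h2 : ∑ n ∈ Finset.range (N + 2), x n ^ 2 ≤ |β N| + |β (N + 1)| + |γ (N + 1)| := by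
      have h3 : |s * ∑ n ∈ Finset.range (N + 2), x n ^ 2| =
          ∑ n ∈ Finset.range (N + 2), x n ^ 2 := by
        rw [abs_mul, abs_of_nonneg (a := ∑ n ∈ _, _) (Finset.sum_nonneg fun i _ => sq_nonneg (x i))]
        rcases hs with rfl | rfl <;> simp
      rw [← h3, h N]
      exact abs_add_three _ _ _
    have h4 := hβ N
    have h5 := hβ (N + 1)
    have h6 := hγ (N + 1)
    push_cast at h5 h6
    have hN0 : (0 : ℝ) ≤ N := N.cast_nonneg
    have e1 : C * (N + 1) * (x N * x (N + 2)) ≤ C * (N + 2) * (x N ^ 2 + x (N + 2) ^ 2) := by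
      have : x N * x (N + 2) ≤ x N ^ 2 + x (N + 2) ^ 2 := by
        nlinarith [sq_nonneg (x N - x (N + 2)), sq_nonneg (x N), sq_nonneg (x (N + 2))]
      calc C * (N + 1) * (x N * x (N + 2)) ≤ C * (N + 1) * (x N ^ 2 + x (N + 2) ^ 2) := by gcongr
        _ ≤ _ := by gcongr; norm_num
    have e2 : C * (N + 1 + 1) * (x (N + 1) * x (N + 1 + 2)) ≤
        C * (N + 2) * (x (N + 1) ^ 2 + x (N + 3) ^ 2) := by
      have : x (N + 1) * x (N + 1 + 2) ≤ x (N + 1) ^ 2 + x (N + 3) ^ 2 := by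
        rw [show N + 1 + 2 = N + 3 from rfl]
        nlinarith [sq_nonneg (x (N + 1) - x (N + 3)), sq_nonneg (x (N + 1)),
          sq_nonneg (x (N + 3))]
      rw [show (N : ℝ) + 1 + 1 = N + 2 by ring]
      gcongr
    have e3 : C * (N + 1 + 1) * (x (N + 1) * x (N + 1 + 1)) ≤
        C * (N + 2) * (x (N + 1) ^ 2 + x (N + 2) ^ 2) := by
      have : x (N + 1) * x (N + 1 + 1) ≤ x (N + 1) ^ 2 + x (N + 2) ^ 2 := by
        rw [show N + 1 + 1 = N + 2 from rfl]
        nlinarith [sq_nonneg (x (N + 1) - x (N + 2)), sq_nonneg (x (N + 1)),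
          sq_nonneg (x (N + 2))]
      rw [show (N : ℝ) + 1 + 1 = N + 2 by ring]
      gcongr
    rw [mul_inv_le_iff₀ (by positivity)]
    have e4 : C * (N + 2) * (x N ^ 2 + x (N + 2) ^ 2) +
        C * (N + 2) * (x (N + 1) ^ 2 + x (N + 3) ^ 2) +
        C * (N + 2) * (x (N + 1) ^ 2 + x (N + 2) ^ 2) ≤ y N * (N + 2) := by
      have : 0 ≤ C * (N + 2) * (x N ^ 2 + x (N + 3) ^ 2) := by positivity
      simp only [y]
      linarith
    linarith
  -- The lower bound by `x n₀ ^ 2` makes a tail of the harmonic series summable, which is absurd.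
  have hsum : Summable fun N : ℕ => ((N : ℝ) + 2)⁻¹ := by
    have h1 : Summable fun N : ℕ => x n₀ ^ 2 * (((N : ℝ) + 2)⁻¹) := by
      rw [← summable_nat_add_iff n₀]
      refine Summable.of_nonneg_of_le (fun N => by positivity)
        (fun N => hbig _ (Nat.le_add_left _ _)) ((summable_nat_add_iff n₀).2 hy)
    exact (summable_mul_left_iff hpos.ne').1 h1
  refine Real.not_summable_natCast_inv ((summable_nat_add_iff 2).1 ?_)
  exact hsum.congr fun N => by push_cast; rfl

/-! ### Summability -/

section Summability

/-- Unconditional convergence from a bound on the squared norms of the finite partial sums. -/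
lemma summable_of_norm_sum_sq_le {ι F : Type*} [NormedAddCommGroup F] [CompleteSpace F]
    {u : ι → F} {b : ι → ℝ} {K : ℝ} (hK : 0 ≤ K) (hb : Summable b)
    (h : ∀ s : Finset ι, ‖∑ i ∈ s, u i‖ ^ 2 ≤ K * ∑ i ∈ s, b i) : Summable u := by
  rw [summable_iff_vanishing_norm]
  intro ε hε
  -- `K + 1` instead of `K` avoids division by zero.
  obtain ⟨s, hs⟩ := summable_iff_vanishing_norm.1 hb (ε ^ 2 / (K + 1)) (by positivity)
  refine ⟨s, fun t ht => ?_⟩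
  have h1 : ∑ i ∈ t, b i < ε ^ 2 / (K + 1) := lt_of_le_of_lt (le_abs_self _) (hs t ht)
  have h3 : K * ∑ i ∈ t, b i < ε ^ 2 := by
    rcases hK.eq_or_lt with h0 | h0
    · rw [← h0, zero_mul]; positivity
    · calc K * ∑ i ∈ t, b i < K * (ε ^ 2 / (K + 1)) := by gcongr
        _ ≤ ε ^ 2 := by
          rw [mul_div_assoc', div_le_iff₀ (by positivity)]
          nlinarith [sq_nonneg ε]
  exact lt_of_pow_lt_pow_left₀ 2 hε.le ((h t).trans_lt h3)

variable {E : ℕ → Type*} [∀ n, NormedAddCommGroup (E n)]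

lemma memℓp_two_iff {f : ∀ n, E n} : Memℓp f 2 ↔ Summable fun n => ‖f n‖ ^ 2 := by
  rw [memℓp_gen_iff (by norm_num)]
  simp

lemma lp_summable_sq (f : lp E 2) : Summable fun n => ‖f n‖ ^ 2 :=
  memℓp_two_iff.1 (lp.memℓp f)

lemma lp_norm_sq (f : lp E 2) : ‖f‖ ^ 2 = ∑' n, ‖f n‖ ^ 2 := by
  have := lp.norm_rpow_eq_tsum (p := 2) (by norm_num) f
  simpa using this

lemma lp_sum_apply {ι : Type*} (s : Finset ι) (u : ι → lp E 2) (n : ℕ) :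
    (∑ q ∈ s, u q) n = ∑ q ∈ s, u q n := by
  rw [lp.coeFn_sum, Finset.sum_apply]

/-- Dominated convergence for series in a Hilbert sum. -/
lemma lp_hasSum_of_dominated {ι : Type*} {u : ι → lp E 2} {S : ∀ n, E n} {g : ℕ → ℝ}
    (hS : ∀ n, HasSum (fun q => u q n) (S n)) (hg : Summable g)
    (hb : ∀ (s : Finset ι) n, ‖∑ q ∈ s, u q n‖ ^ 2 ≤ g n) :
    ∃ Ψ : lp E 2, (∀ n, Ψ n = S n) ∧ HasSum u Ψ ∧ ‖Ψ‖ ^ 2 ≤ ∑' n, g n := by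
  have hSg : ∀ n, ‖S n‖ ^ 2 ≤ g n := fun n =>
    le_of_tendsto ((hS n).norm.pow 2) (Filter.Eventually.of_forall fun s => hb s n)
  have hmem : Memℓp S 2 :=
    memℓp_two_iff.2 (Summable.of_nonneg_of_le (fun n => by positivity) hSg hg)
  refine ⟨⟨S, hmem⟩, fun n => rfl, ?_, ?_⟩
  · rw [HasSum, SummationFilter.unconditional_filter, tendsto_iff_norm_sub_tendsto_zero]
    have h0 : Filter.Tendsto (fun s : Finset ι => ‖∑ q ∈ s, u q - ⟨S, hmem⟩‖ ^ 2) Filter.atTop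
        (nhds 0) := by
      have h1 : ∀ s : Finset ι, ‖∑ q ∈ s, u q - (⟨S, hmem⟩ : lp E 2)‖ ^ 2 =
          ∑' n, ‖∑ q ∈ s, u q n - S n‖ ^ 2 := by
        intro s
        rw [lp_norm_sq]
        refine tsum_congr fun n => ?_
        rw [lp.coeFn_sub, Pi.sub_apply, lp_sum_apply]
      simp_rw [h1]
      have h2 : (0 : ℝ) = ∑' _ : ℕ, (0 : ℝ) := by simp
      rw [h2]
      -- Both the partial sum and its limit have squared norm at most `g n`, so their difference has
      -- squared norm at most `4 * g n`.
      refine tendsto_tsum_of_dominated_convergence (bound := fun n => 4 * g n) (hg.mul_left 4)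
        (fun n => ?_) (Filter.Eventually.of_forall fun s n => ?_)
      · have := ((tendsto_iff_norm_sub_tendsto_zero.1 (hS n))).pow 2
        simpa using this
      · rw [Real.norm_of_nonneg (by positivity)]
        have h3 := norm_sub_le (∑ q ∈ s, u q n) (S n)
        have h4 := hb s n
        have h5 := hSg n
        nlinarith [norm_nonneg (∑ q ∈ s, u q n - S n),
          sq_nonneg (‖∑ q ∈ s, u q n‖ - ‖S n‖), norm_nonneg (∑ q ∈ s, u q n), norm_nonneg (S n)]
    have h6 := h0.sqrt
    simpa [Real.sqrt_sq (norm_nonneg _)] using h6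
  · rw [lp_norm_sq]
    exact Summable.tsum_le_tsum hSg (lp_summable_sq (⟨S, hmem⟩ : lp E 2)) hg

end Summability

/-- The strong sum of a family of bounded operators with uniformly bounded partial sums. -/
lemma exists_strongSum {ι E F : Type*} [NormedAddCommGroup E] [NormedSpace ℂ E]
    [NormedAddCommGroup F] [NormedSpace ℂ F] {T : ι → E →L[ℂ] F} {C : ℝ}
    (hT : ∀ x, Summable fun i => T i x) (hC : ∀ (s : Finset ι) x, ‖∑ i ∈ s, T i x‖ ≤ C * ‖x‖) :
    ∃ A : E →L[ℂ] F, (∀ x, HasSum (fun i => T i x) (A x)) ∧ ∀ x, ‖A x‖ ≤ C * ‖x‖ := by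
  have hle : ∀ x, ‖∑' i, T i x‖ ≤ C * ‖x‖ := fun x =>
    le_of_tendsto (hT x).hasSum.norm (Filter.Eventually.of_forall fun s => hC s x)
  refine ⟨LinearMap.mkContinuous
    { toFun := fun x => ∑' i, T i x
      map_add' := fun x y => by simp only [map_add]; exact (hT x).tsum_add (hT y)
      map_smul' := fun c x => by
        simp only [map_smul, RingHom.id_apply]; exact (hT x).tsum_const_smul c } C hle,
    fun x => (hT x).hasSum, hle⟩

/-! ### Graphs of partially defined operators -/

section Graphs

variable {E F G : Type*} [NormedAddCommGroup E] [NormedSpace ℂ E]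
  [NormedAddCommGroup F] [NormedSpace ℂ F] [NormedAddCommGroup G] [NormedSpace ℂ G]

/-- Graph membership carries domain and value together. With these rules, membership in the natural
domain of the interaction is obtained along with the value. -/
lemma mem_graph_opComp {A : F →ₗ.[ℂ] G} {B : E →ₗ.[ℂ] F} {x : E} {y : F} {z : G}
    (hB : (x, y) ∈ B.graph) (hA : (y, z) ∈ A.graph) : (x, z) ∈ (opComp A B).graph := by
  obtain ⟨x, rfl, rfl⟩ := (LinearPMap.mem_graph_iff B).1 hB
  obtain ⟨y, hy, rfl⟩ := (LinearPMap.mem_graph_iff A).1 hA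
  have hx : B x ∈ A.domain := by rw [← show (y : F) = B x from hy]; exact y.2
  refine (LinearPMap.mem_graph_iff _).2 ⟨⟨x, ⟨x, hx, rfl⟩⟩, rfl, ?_⟩
  change A ⟨B ⟨x, _⟩, _⟩ = A y
  congr 1
  exact Subtype.ext hy.symm

lemma mem_graph_opSum {ι : Type*} {A : ι → E →ₗ.[ℂ] F} {x : E} {u : ι → F} {y : F}
    (h : ∀ i, (x, u i) ∈ (A i).graph) (hu : HasSum u y) : (x, y) ∈ (opSum A).graph := by
  have hx : ∀ i, x ∈ (A i).domain := fun i => LinearPMap.mem_domain_of_mem_graph (h i)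
  have hv : ∀ i, A i ⟨x, hx i⟩ = u i := fun i =>
    LinearPMap.mem_graph_snd_inj (A i) (LinearPMap.mem_graph (A i) ⟨x, hx i⟩) (h i) rfl
  have hs : Summable fun i => A i ⟨x, hx i⟩ := by simp_rw [hv]; exact hu.summable
  refine (LinearPMap.mem_graph_iff _).2 ⟨⟨x, ⟨hx, hs⟩⟩, rfl, ?_⟩
  change ∑' i, A i ⟨x, _⟩ = y
  simp_rw [hv]
  exact hu.tsum_eq

lemma mem_graph_add {A B : E →ₗ.[ℂ] F} {x : E} {y z : F} (hA : (x, y) ∈ A.graph)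
    (hB : (x, z) ∈ B.graph) : (x, y + z) ∈ (A + B).graph := by
  obtain ⟨x, rfl, rfl⟩ := (LinearPMap.mem_graph_iff A).1 hA
  obtain ⟨w, hw, rfl⟩ := (LinearPMap.mem_graph_iff B).1 hB
  have hw' : (w : E) = x := hw
  refine (LinearPMap.mem_graph_iff _).2 ⟨⟨x, ⟨x.2, hw' ▸ w.2⟩⟩, rfl, ?_⟩
  change A ⟨x, _⟩ + B ⟨x, _⟩ = A x + B w
  congr 2
  exact Subtype.ext hw'.symm

lemma mem_graph_smul {A : E →ₗ.[ℂ] F} {x : E} {y : F} (c : ℂ) (hA : (x, y) ∈ A.graph) :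
    (x, c • y) ∈ (c • A).graph := by
  obtain ⟨x, rfl, rfl⟩ := (LinearPMap.mem_graph_iff A).1 hA
  exact (LinearPMap.mem_graph_iff _).2 ⟨x, rfl, rfl⟩

lemma mem_graph_toLinearPMap_iff {g : Submodule ℂ (E × F)} (hg : ∀ p ∈ g, p.1 = 0 → p.2 = 0)
    {p : E × F} : p ∈ g.toLinearPMap.graph ↔ p ∈ g := by
  rw [Submodule.toLinearPMap_graph_eq g hg]

end Graphs

/-! ### Hilbert space structures on the sectors and on their sum. -/

section Instances

variable {d : ℕ}

scoped instance (n : ℕ) : NormedSpace ℂ (sector d n) := inferInstance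
scoped instance (n : ℕ) : InnerProductSpace ℂ (sector d n) := inferInstance
scoped instance (n : ℕ) : Inner ℂ (sector d n) := InnerProductSpace.toInner
scoped instance (n : ℕ) : SMulCommClass ℂ ℂ (sector d n) := inferInstance
scoped instance : NormedAddCommGroup (Hplus d) := inferInstance
scoped instance : InnerProductSpace ℂ (Hplus d) := inferInstance
scoped instance : Inner ℂ (Hplus d) := InnerProductSpace.toInner
scoped instance : NormedSpace ℂ (Hplus d) := inferInstance
scoped instance : Module ℂ (Hplus d) := inferInstance
scoped instance : SMulCommClass ℂ ℂ (Hplus d) := inferInstance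

end Instances

lemma inner_self_eq_ofReal {E : Type*} [NormedAddCommGroup E] [InnerProductSpace ℂ E] (x : E) :
    ⟪x, x⟫_ℂ = ((‖x‖ ^ 2 : ℝ) : ℂ) := by
  rw [inner_self_eq_norm_sq_to_K]; push_cast; rfl

/-! ### Multiplication by bounded functions -/

section Multiplication

variable {α : Type*} [MeasureSpace α]

/-- Bounded measurable functions. -/
def IsBdd (g : α → ℂ) : Prop := StronglyMeasurable g ∧ ∃ C : ℝ, ∀ x, ‖g x‖ ≤ C

lemma IsBdd.conj {g : α → ℂ} (hg : IsBdd g) : IsBdd fun x => conj (g x) :=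
  ⟨Complex.continuous_conj.comp_stronglyMeasurable hg.1, by simpa using hg.2⟩

lemma IsBdd.memLp_mul {g : α → ℂ} (hg : IsBdd g) (Φ : L2 α) :
    MemLp (fun x => g x * Φ x) 2 volume := by
  obtain ⟨C, hC⟩ := hg.2
  refine MemLp.of_le_mul (c := C) (Lp.memLp Φ)
    (hg.1.aestronglyMeasurable.mul (Lp.aestronglyMeasurable Φ))
    (Filter.Eventually.of_forall fun x => ?_)
  rw [norm_mul]
  gcongr
  exact hC x

open scoped Classical in
/-- Multiplication by the bounded measurable function `g` on `L²`. -/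
def mulBdd (g : α → ℂ) : L2 α →L[ℂ] L2 α :=
  -- The operator is 0 for `g` outside `IsBdd`, so facts about its values carry that hypothesis.
  if hg : IsBdd g then
    LinearMap.mkContinuous
      { toFun := fun Φ => (hg.memLp_mul Φ).toLp _
        map_add' := by
          intro Φ Ψ
          rw [← MemLp.toLp_add]
          refine (MemLp.toLp_eq_toLp_iff _ _).2 ?_
          filter_upwards [Lp.coeFn_add Φ Ψ] with z hz
          simp only [hz, Pi.add_apply, mul_add]
        map_smul' := by
          intro c Φ
          rw [RingHom.id_apply, ← MemLp.toLp_const_smul]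
          refine (MemLp.toLp_eq_toLp_iff _ _).2 ?_
          filter_upwards [Lp.coeFn_smul c Φ] with z hz
          simp only [hz, Pi.smul_apply, smul_eq_mul]
          ring }
      hg.2.choose (by
        intro Φ
        refine Lp.norm_le_mul_norm_of_ae_le_mul ?_
        filter_upwards [MemLp.coeFn_toLp (hg.memLp_mul Φ)] with z hz
        refine (congrArg norm hz).le.trans ?_
        rw [norm_mul]
        gcongr
        exact hg.2.choose_spec z)
  else 0

lemma coeFn_mulBdd {g : α → ℂ} (hg : IsBdd g) (Φ : L2 α) :
    mulBdd g Φ =ᵐ[volume] fun x => g x * Φ x := by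
  rw [mulBdd, dif_pos hg]
  exact MemLp.coeFn_toLp (hg.memLp_mul Φ)

lemma norm_mulBdd_sq {g : α → ℂ} (hg : IsBdd g) (Φ : L2 α) :
    ‖mulBdd g Φ‖ ^ 2 = ∫ x, ‖g x‖ ^ 2 * ‖Φ x‖ ^ 2 := by
  rw [← Complex.ofReal_inj, ← inner_self_eq_ofReal, L2.inner_def, ← integral_complex_ofReal]
  refine integral_congr_ae ?_
  filter_upwards [coeFn_mulBdd hg Φ] with x hx
  rw [hx, inner_self_eq_ofReal, norm_mul, mul_pow]

lemma inner_mulBdd_left {g : α → ℂ} (hg : IsBdd g) (Φ Ψ : L2 α) :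
    ⟪mulBdd g Φ, Ψ⟫_ℂ = ⟪Φ, mulBdd (fun x => conj (g x)) Ψ⟫_ℂ := by
  rw [L2.inner_def, L2.inner_def]
  refine integral_congr_ae ?_
  filter_upwards [coeFn_mulBdd hg Φ, coeFn_mulBdd hg.conj Ψ] with x hx hy
  rw [hx, hy]
  simp only [RCLike.inner_apply, map_mul]
  ring

lemma norm_sq_eq_integral (Φ : L2 α) : ‖Φ‖ ^ 2 = ∫ x, ‖Φ x‖ ^ 2 := by
  rw [← Complex.ofReal_inj, ← inner_self_eq_ofReal, L2.inner_def, ← integral_complex_ofReal]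
  exact integral_congr_ae (Filter.Eventually.of_forall fun x => inner_self_eq_ofReal _)

/-- A pointwise square-summable family of multipliers is strongly square summable. -/
lemma sum_norm_mulBdd_sq_le {ι : Type*} {g : ι → α → ℂ} (hg : ∀ j, IsBdd (g j)) {C : ℝ}
    (s : Finset ι) (hC : ∀ x, ∑ j ∈ s, ‖g j x‖ ^ 2 ≤ C) (Φ : L2 α) :
    ∑ j ∈ s, ‖mulBdd (g j) Φ‖ ^ 2 ≤ C * ‖Φ‖ ^ 2 := by
  have hint : ∀ j, Integrable fun x => ‖g j x‖ ^ 2 * ‖Φ x‖ ^ 2 := by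
    intro j
    refine ((hg j).memLp_mul Φ).integrable_norm_pow (p := 2) (by norm_num) |>.congr ?_
    exact Filter.Eventually.of_forall fun x => by simp only [norm_mul, mul_pow]
  have hΦ : Integrable fun x => ‖Φ x‖ ^ 2 := (Lp.memLp Φ).integrable_norm_pow (p := 2) (by norm_num)
  simp_rw [norm_mulBdd_sq (hg _)]
  rw [← integral_finsetSum _ fun j _ => hint j, norm_sq_eq_integral, ← integral_const_mul]
  refine integral_mono (integrable_finsetSum _ fun j _ => hint j) (hΦ.const_mul C) fun x => ?_
  simp only [← Finset.sum_mul]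
  gcongr
  exact hC x

end Multiplication

/-! ### Multiplication in the position of the tracer on the sectors -/

section TracerMultiplication

variable {d : ℕ}

lemma IsBdd.comp_eval {w : Torus d → ℂ} (hw : IsBdd w) {n : ℕ} (i : Fin n) :
    IsBdd fun z : Fin n → Torus d => w (z i) :=
  ⟨hw.1.comp_measurable (measurable_pi_apply i), hw.2.imp fun _ h _ => h _⟩

/-- The factor involves the tracer coordinate alone. Permutations of the bosons do not move it, and
its adjoint preserves functions independent of a given boson. -/
lemma mulBdd_mem_sector {w : Torus d → ℂ} (hw : IsBdd w) {n : ℕ} {Φ : L2 (Config d n)}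
    (hΦ : Φ ∈ sector d n) : mulBdd (fun z : Config d n => w (z 0)) Φ ∈ sector d n := by
  refine ⟨fun σ hσ => ?_, fun j hj g => ?_⟩
  · refine Lp.ext ?_
    have hmp := measurePreserving_perm d (n + 1) σ
    have h1 := Lp.coeFn_compMeasurePreserving (mulBdd (fun z : Config d n => w (z 0)) Φ) hmp
    have h2 := Lp.coeFn_compMeasurePreserving Φ hmp
    have h3 := hmp.quasiMeasurePreserving.ae (coeFn_mulBdd (hw.comp_eval (0 : Fin (n + 1))) Φ)
    have h4 : Lp.compMeasurePreserving _ hmp Φ = Φ := hΦ.1 σ hσ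
    rw [h4] at h2
    filter_upwards [h1, h2, h3, coeFn_mulBdd (hw.comp_eval (0 : Fin (n + 1))) Φ]
      -- The relabelled factor is `w (z (σ 0))`, and `σ 0 = 0`.
      with z h1 h2 h3 h5
    refine h1.trans (h3.trans ?_)
    rw [h5, h2, hσ]
    rfl
  -- `i` is the label of the tracer once particle `j` has been removed.
  · obtain ⟨i, hi⟩ := Fin.exists_succAbove_eq hj.symm
    have hmp := measurePreserving_forget d n j
    rw [← inner_conj_symm, inner_mulBdd_left (hw.comp_eval (0 : Fin (n + 1))), inner_conj_symm]
    have : mulBdd (fun z : Config d n => conj (w (z 0))) (constIn j g) =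
        constIn j (mulBdd (fun z : Fin n → Torus d => conj (w (z i))) g) := by
      refine Lp.ext ?_
      have h1 := Lp.coeFn_compMeasurePreserving
        (mulBdd (fun z : Fin n → Torus d => conj (w (z i))) g) hmp
      have h2 := Lp.coeFn_compMeasurePreserving g hmp
      have h3 := hmp.quasiMeasurePreserving.ae (coeFn_mulBdd (hw.conj.comp_eval i) g)
      filter_upwards [h1, h2, h3, coeFn_mulBdd (hw.conj.comp_eval (0 : Fin (n + 1)))
        (constIn j g)] with z h1 h2 h3 h4
      refine h4.trans (Eq.trans ?_ (h1.trans h3).symm)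
      rw [hi]
      exact congrArg (fun t => conj (w (z 0)) * t) h2
    rw [this]
    exact hΦ.2 j hj _

/-- Multiplication by `w(x)` on the `n`-excitation sector. -/
def mulSector (w : Torus d → ℂ) (n : ℕ) : sector d n →L[ℂ] sector d n :=
  (sector d n).orthogonalProjectionOnto ∘L mulBdd (fun z : Config d n => w (z 0)) ∘L
    (sector d n).subtypeL

/-- The projection in `mulSector` serves only to land in the sector; it acts trivially for bounded
`w`. -/
lemma coe_mulSector {w : Torus d → ℂ} (hw : IsBdd w) {n : ℕ} (Φ : sector d n) :
    (mulSector w n Φ : L2 (Config d n)) = mulBdd (fun z : Config d n => w (z 0)) Φ :=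
  congrArg Subtype.val
    (Submodule.orthogonalProjectionOnto_mem_subspace_eq_self
      (⟨_, mulBdd_mem_sector hw Φ.2⟩ : sector d n))

lemma inner_mulSector_left {w : Torus d → ℂ} (hw : IsBdd w) {n : ℕ} (Φ Ψ : sector d n) :
    ⟪mulSector w n Φ, Ψ⟫_ℂ = ⟪Φ, mulSector (fun x => conj (w x)) n Ψ⟫_ℂ := by
  rw [Submodule.coe_inner, Submodule.coe_inner, coe_mulSector hw, coe_mulSector hw.conj,
    inner_mulBdd_left (hw.comp_eval (0 : Fin (n + 1)))]

/-- The sector is invariant under the multiplication and under its adjoint, hence reduces it. -/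
lemma projection_mulBdd {w : Torus d → ℂ} (hw : IsBdd w) {n : ℕ} (Φ : L2 (Config d n)) :
    (sector d n).orthogonalProjectionOnto (mulBdd (fun z : Config d n => w (z 0)) Φ) =
      mulSector w n ((sector d n).orthogonalProjectionOnto Φ) := by
  refine ext_inner_right ℂ fun Ψ => ?_
  rw [inner_mulSector_left hw, Submodule.inner_orthogonalProjectionOnto_eq_of_mem_right,
    Submodule.inner_orthogonalProjectionOnto_eq_of_mem_right, coe_mulSector hw.conj,
    inner_mulBdd_left (hw.comp_eval (0 : Fin (n + 1)))]

lemma sum_norm_mulSector_sq_le {ι : Type*} {w : ι → Torus d → ℂ} (hw : ∀ j, IsBdd (w j)) {C : ℝ}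
    (s : Finset ι) (hC : ∀ x, ∑ j ∈ s, ‖w j x‖ ^ 2 ≤ C) {n : ℕ} (Φ : sector d n) :
    ∑ j ∈ s, ‖mulSector (w j) n Φ‖ ^ 2 ≤ C * ‖Φ‖ ^ 2 := by
  have := sum_norm_mulBdd_sq_le (fun j => (hw j).comp_eval (0 : Fin (n + 1))) s
    (fun z => hC (z 0)) (Φ : L2 (Config d n))
  simp only [← coe_mulSector (hw _)] at this
  exact this

end TracerMultiplication

/-! ### Creation and annihilation operators on the sectors -/

section Sectors

variable {d n : ℕ}

lemma coeFn_appendParticle (f : L2 (Torus d)) (Φ : L2 (Config d n)) :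
    appendParticle f Φ =ᵐ[volume] fun z : Config d (n + 1) =>
      f (z (Fin.last (n + 1))) * Φ (fun i => z ((Fin.last (n + 1)).succAbove i)) :=
  MemLp.coeFn_toLp (memLp_appendParticle f Φ)

lemma inner_appendParticle (f g : L2 (Torus d)) (Φ Ψ : L2 (Config d n)) :
    ⟪appendParticle f Φ, appendParticle g Ψ⟫_ℂ = ⟪f, g⟫_ℂ * ⟪Φ, Ψ⟫_ℂ := by
  have he := measurePreserving_insert d (n + 1) (Fin.last (n + 1))
  rw [L2.inner_def, L2.inner_def, L2.inner_def, ← integral_prod_mul]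
  rw [← he.integral_comp (MeasurableEquiv.measurableEmbedding _)]
  refine integral_congr_ae ?_
  filter_upwards [coeFn_appendParticle f Φ, coeFn_appendParticle g Ψ] with z h1 h2
  rw [h1, h2]
  simp only [RCLike.inner_apply, map_mul]
  change _ = (g (z (Fin.last (n + 1))) * conj (f (z (Fin.last (n + 1))))) *
    (Ψ (fun i => z ((Fin.last (n + 1)).succAbove i)) *
      conj (Φ (fun i => z ((Fin.last (n + 1)).succAbove i))))
  ring

/-- The vectors `e j ⊗ Φ j` are mutually orthogonal because their last factors are. -/
lemma norm_sum_appendParticle_sq {ι : Type*} {e : ι → L2 (Torus d)} (he : Orthonormal ℂ e)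
    (s : Finset ι) (Φ : ι → L2 (Config d n)) :
    ‖∑ j ∈ s, appendParticle (e j) (Φ j)‖ ^ 2 = ∑ j ∈ s, ‖Φ j‖ ^ 2 := by
  classical
  rw [← Complex.ofReal_inj]
  rw [← inner_self_eq_ofReal, sum_inner, Complex.ofReal_sum]
  refine Finset.sum_congr rfl fun j hj => ?_
  rw [inner_sum, ← inner_self_eq_ofReal, Finset.sum_eq_single_of_mem j hj]
  · rw [inner_appendParticle, orthonormal_iff_ite.1 he, if_pos rfl, one_mul]
  · intro k _ hk
    rw [inner_appendParticle, orthonormal_iff_ite.1 he, if_neg hk.symm, zero_mul]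

lemma norm_appendParticle (f : L2 (Torus d)) (Φ : L2 (Config d n)) :
    ‖appendParticle f Φ‖ = ‖f‖ * ‖Φ‖ := by
  change ‖(memLp_appendParticle f Φ).toLp _‖ = _
  rw [Lp.norm_toLp, (eLpNorm_appendParticle f Φ).2, ENNReal.toReal_mul, Lp.norm_def, Lp.norm_def]

lemma creSector_apply (f : L2 (Torus d)) (Φ : sector d n) :
    creSector n f Φ = ((Real.sqrt (n + 1) : ℝ) : ℂ) •
      (sector d (n + 1)).orthogonalProjectionOnto (appendParticle f (Φ : L2 (Config d n))) := rfl

/-- Projecting onto the sector is a contraction, so only the factor `√(n + 1)` is added to the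
Pythagorean identity. The `Φ j` may be arbitrary, which allows the estimate to be iterated. -/
lemma norm_sum_creSector_sq_le {ι : Type*} {e : ι → L2 (Torus d)} (he : Orthonormal ℂ e)
    (s : Finset ι) (Φ : ι → sector d n) :
    ‖∑ j ∈ s, creSector n (e j) (Φ j)‖ ^ 2 ≤ (n + 1) * ∑ j ∈ s, ‖Φ j‖ ^ 2 := by
  have h : ∑ j ∈ s, creSector n (e j) (Φ j) = ((Real.sqrt (n + 1) : ℝ) : ℂ) •
      (sector d (n + 1)).orthogonalProjectionOnto
        (∑ j ∈ s, appendParticle (e j) (Φ j : L2 (Config d n))) := by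
    rw [map_sum, Finset.smul_sum]
    rfl
  have h2 := Submodule.norm_orthogonalProjectionOnto_apply_le (sector d (n + 1))
    (∑ j ∈ s, appendParticle (e j) (Φ j : L2 (Config d n)))
  have h3 := norm_sum_appendParticle_sq he s fun j => (Φ j : L2 (Config d n))
  rw [h, norm_smul, mul_pow, Complex.norm_real, Real.norm_of_nonneg (Real.sqrt_nonneg _),
    Real.sq_sqrt (by positivity)]
  gcongr
  refine le_trans ?_ h3.le
  gcongr

lemma norm_creSector_sq_le (f : L2 (Torus d)) (Φ : sector d n) :
    ‖creSector n f Φ‖ ^ 2 ≤ (n + 1) * (‖f‖ ^ 2 * ‖Φ‖ ^ 2) := by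
  rw [creSector_apply, norm_smul, mul_pow, Complex.norm_real,
    Real.norm_of_nonneg (Real.sqrt_nonneg _), Real.sq_sqrt (by positivity), ← mul_pow]
  gcongr
  exact (Submodule.norm_orthogonalProjectionOnto_apply_le _ _).trans (norm_appendParticle f _).le

lemma inner_creSector_left (f : L2 (Torus d)) (Φ : sector d n) (Ψ : sector d (n + 1)) :
    ⟪creSector n f Φ, Ψ⟫_ℂ = ⟪Φ, annSector n f Ψ⟫_ℂ :=
  (ContinuousLinearMap.adjoint_inner_right _ _ _).symm

lemma inner_annSector_left (f : L2 (Torus d)) (Φ : sector d n) (Ψ : sector d (n + 1)) :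
    ⟪annSector n f Ψ, Φ⟫_ℂ = ⟪Ψ, creSector n f Φ⟫_ℂ :=
  ContinuousLinearMap.adjoint_inner_left _ _ _

lemma norm_annSector_sq_le (f : L2 (Torus d)) (Ψ : sector d (n + 1)) :
    ‖annSector n f Ψ‖ ^ 2 ≤ (n + 1) * (‖f‖ ^ 2 * ‖Ψ‖ ^ 2) := by
  -- Duality: `‖a Ψ‖² = ⟪Ψ, a* a Ψ⟫`; the bound for `a*` is inserted and one factor cancelled.
  have h1 : ‖annSector n f Ψ‖ ^ 2 ≤ ‖Ψ‖ * ‖creSector n f (annSector n f Ψ)‖ := by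
    refine le_trans (le_of_eq ?_) (norm_inner_le_norm (𝕜 := ℂ) _ _)
    rw [← inner_annSector_left]
    exact ((congrArg norm (inner_self_eq_ofReal _)).trans (by simp)).symm
  have h2 := norm_creSector_sq_le f (annSector n f Ψ)
  set a := ‖annSector n f Ψ‖ with ha
  set c := ‖creSector n f (annSector n f Ψ)‖
  rcases (show 0 ≤ a from norm_nonneg _).eq_or_lt with h0 | h0
  · rw [← h0, zero_pow two_ne_zero]; positivity
  · have h3 : (a ^ 2) ^ 2 ≤ ‖Ψ‖ ^ 2 * ((n + 1) * (‖f‖ ^ 2 * a ^ 2)) := by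
      calc (a ^ 2) ^ 2 ≤ (‖Ψ‖ * c) ^ 2 := by gcongr
        _ = ‖Ψ‖ ^ 2 * c ^ 2 := by ring
        _ ≤ _ := by gcongr
    have h4 : 0 < a ^ 2 := by positivity
    nlinarith

/-- Dual to `norm_sum_creSector_sq_le`: the left side is `⟪Ψ, ∑ a_j* a_j Ψ⟫`, so its square is at
most `(n + 1) ‖Ψ‖²` times itself. -/
lemma sum_norm_annSector_sq_le {ι : Type*} {e : ι → L2 (Torus d)} (he : Orthonormal ℂ e)
    (s : Finset ι) (Ψ : sector d (n + 1)) :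
    ∑ j ∈ s, ‖annSector n (e j) Ψ‖ ^ 2 ≤ (n + 1) * ‖Ψ‖ ^ 2 := by
  set a := ∑ j ∈ s, ‖annSector n (e j) Ψ‖ ^ 2 with ha
  have h1 : a ≤ ‖Ψ‖ * ‖∑ j ∈ s, creSector n (e j) (annSector n (e j) Ψ)‖ := by
    refine le_trans (le_of_eq ?_) ((Complex.re_le_norm _).trans
      (norm_inner_le_norm (𝕜 := ℂ) _ _))
    rw [inner_sum, Complex.re_sum]
    refine Finset.sum_congr rfl fun j _ => ?_
    rw [← inner_annSector_left]
    exact (congrArg Complex.re (inner_self_eq_ofReal _)).symm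
  have h2 := norm_sum_creSector_sq_le he s fun j => annSector n (e j) Ψ
  rw [← ha] at h2
  rcases (show 0 ≤ a from Finset.sum_nonneg fun _ _ => by positivity).eq_or_lt with h0 | h0
  · rw [← h0]; positivity
  · have h3 : a ^ 2 ≤ ‖Ψ‖ ^ 2 * ((n + 1) * a) := by
      calc a ^ 2 ≤ (‖Ψ‖ * ‖∑ j ∈ s, creSector n (e j) (annSector n (e j) Ψ)‖) ^ 2 := by gcongr
        _ = ‖Ψ‖ ^ 2 * ‖∑ j ∈ s, creSector n (e j) (annSector n (e j) Ψ)‖ ^ 2 := by ring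
        _ ≤ _ := by gcongr
    nlinarith

/-- The new particle is appended last, so the tracer keeps the label 0, and the projection commutes
with functions of the tracer. -/
lemma mulSector_creSector {w : Torus d → ℂ} (hw : IsBdd w) (f : L2 (Torus d)) (Φ : sector d n) :
    mulSector w (n + 1) (creSector n f Φ) = creSector n f (mulSector w n Φ) := by
  rw [creSector_apply, creSector_apply, map_smul, ← projection_mulBdd hw]
  congr 2
  refine Lp.ext ?_
  have hmp := measurePreserving_forget d (n + 1) (Fin.last (n + 1))
  have h1 := hmp.quasiMeasurePreserving.ae
    (coeFn_mulBdd (hw.comp_eval (0 : Fin (n + 1))) (Φ : L2 (Config d n)))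
  rw [coe_mulSector hw]
  filter_upwards [h1, coeFn_appendParticle f (Φ : L2 (Config d n)),
    coeFn_appendParticle f (mulBdd (fun z : Config d n => w (z 0)) (Φ : L2 (Config d n))),
    coeFn_mulBdd (hw.comp_eval (0 : Fin (n + 2))) (appendParticle f (Φ : L2 (Config d n)))]
    with z h1 h2 h3 h4
  rw [h4, h3, h2, h1]
  have : (Fin.last (n + 1)).succAbove 0 = (0 : Fin (n + 2)) := by simp
  rw [this]
  ring

lemma mulSector_annSector {w : Torus d → ℂ} (hw : IsBdd w) (f : L2 (Torus d))
    (Ψ : sector d (n + 1)) :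
    mulSector w n (annSector n f Ψ) = annSector n f (mulSector w (n + 1) Ψ) := by
  refine ext_inner_right ℂ fun Φ => ?_
  rw [inner_mulSector_left hw, inner_annSector_left, inner_annSector_left,
    ← mulSector_creSector hw.conj, ← inner_mulSector_left hw]

end Sectors

/-! ### The matrix elements of the interaction -/

section MatrixElements

variable {d : ℕ}

scoped instance : (volume : Measure (Torus d)).IsNegInvariant :=
  Measure.pi.isNegInvariant fun _ : Fin d => (volume : Measure UnitAddCircle)

lemma measurePreserving_sub_left_torus (x : Torus d) :
    MeasurePreserving (fun y : Torus d => x - y) volume volume :=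
  Measure.measurePreserving_sub_left volume x

/-- The function `y ↦ W(x - y)`. -/
def reflect (x : Torus d) (W : L2 (Torus d)) : L2 (Torus d) :=
  Lp.compMeasurePreserving _ (measurePreserving_sub_left_torus x) W

lemma coeFn_reflect (x : Torus d) (W : L2 (Torus d)) :
    reflect x W =ᵐ[volume] fun y => W (x - y) :=
  Lp.coeFn_compMeasurePreserving W (measurePreserving_sub_left_torus x)

lemma norm_reflect (x : Torus d) (W : L2 (Torus d)) : ‖reflect x W‖ = ‖W‖ :=
  Lp.norm_compMeasurePreserving W (measurePreserving_sub_left_torus x)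

/-- The function `x ↦ ∫ conj f(y) W(x - y) dy`. -/
def conv (f W : L2 (Torus d)) (x : Torus d) : ℂ := ⟪f, reflect x W⟫_ℂ

lemma conv_eq_integral (f W : L2 (Torus d)) (x : Torus d) :
    conv f W x = ∫ y, conj (f y) * W (x - y) := by
  rw [conv, L2.inner_def]
  refine integral_congr_ae ?_
  filter_upwards [coeFn_reflect x W] with y hy
  rw [hy, RCLike.inner_apply, mul_comm]

lemma norm_conv_le (f W : L2 (Torus d)) (x : Torus d) : ‖conv f W x‖ ≤ ‖f‖ * ‖W‖ :=
  (norm_inner_le_norm _ _).trans (by rw [norm_reflect])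

lemma stronglyMeasurable_sub (W : L2 (Torus d)) :
    StronglyMeasurable fun p : Torus d × Torus d => W (p.1 - p.2) :=
  (Lp.stronglyMeasurable W).comp_measurable (measurable_fst.sub measurable_snd)

lemma isBdd_conv (f W : L2 (Torus d)) : IsBdd (conv f W) := by
  refine ⟨?_, _, norm_conv_le f W⟩
  rw [funext (conv_eq_integral f W)]
  refine StronglyMeasurable.integral_prod_right ?_
  exact (Complex.continuous_conj.comp_stronglyMeasurable
    ((Lp.stronglyMeasurable f).comp_measurable measurable_snd)).mul (stronglyMeasurable_sub W)

/-- Bessel's inequality for `y ↦ W (x - y)`, whose norm does not depend on `x`. The bound holds at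
every `x`, as is needed for multiplication operators. -/
lemma sum_norm_conv_sq_le {ι : Type*} {e : ι → L2 (Torus d)} (he : Orthonormal ℂ e)
    (s : Finset ι) (W : L2 (Torus d)) (x : Torus d) :
    ∑ j ∈ s, ‖conv (e j) W x‖ ^ 2 ≤ ‖W‖ ^ 2 := by
  have := he.sum_inner_products_le (s := s) (reflect x W)
  rwa [norm_reflect] at this

lemma coeFn_star (V : L2 (Torus d)) : ⇑(star V : L2 (Torus d)) =ᵐ[volume] fun y => conj (V y) :=
  Lp.coeFn_star V

/-- `conv` conjugates its first argument, while some matrix elements contain an unconjugated `φ k`;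
passing to `star V` and conjugating removes the mismatch. -/
lemma conj_conv_star (f V : L2 (Torus d)) (x : Torus d) :
    conj (conv f (star V) x) = ∫ y, f y * V (x - y) := by
  rw [conv_eq_integral, ← integral_conj]
  refine integral_congr_ae ?_
  filter_upwards [(measurePreserving_sub_left_torus x).quasiMeasurePreserving.ae (coeFn_star V)]
    with y hy
  rw [hy, map_mul, Complex.conj_conj, Complex.conj_conj]

/-- Bessel's inequality for a doubly indexed family of matrix elements. -/
lemma summable_norm_inner_mulBdd_sq {e : ℕ → L2 (Torus d)} (he : Orthonormal ℂ e)
    {g : ℕ → Torus d → ℂ} (hg : ∀ k, IsBdd (g k)) {C : ℝ}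
    (hC : ∀ (s : Finset ℕ) x, ∑ k ∈ s, ‖g k x‖ ^ 2 ≤ C) (u : L2 (Torus d)) :
    Summable fun q : ℕ × ℕ => ‖⟪e q.1, mulBdd (g q.2) u⟫_ℂ‖ ^ 2 := by
  refine summable_of_sum_le (c := C * ‖u‖ ^ 2) (fun q => by positivity) fun s => ?_
  have hsub : s ⊆ s.image Prod.fst ×ˢ s.image Prod.snd := fun q hq =>
    Finset.mem_product.2 ⟨Finset.mem_image_of_mem _ hq, Finset.mem_image_of_mem _ hq⟩
  refine (Finset.sum_le_sum_of_subset_of_nonneg hsub fun q _ _ => by positivity).trans ?_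
  -- For fixed `k` the sum over `j` is controlled by Bessel; the remaining sum over `k` by the
  -- pointwise bound on the multipliers.
  rw [Finset.sum_product_right]
  exact (Finset.sum_le_sum fun k _ => he.sum_inner_products_le (mulBdd (g k) u)).trans
    (sum_norm_mulBdd_sq_le hg _ (hC _) u)

variable {φ : ℕ → L2 (Torus d)}

lemma matW_eq_conv (hφ : ⇑(φ 0) =ᵐ[volume] fun _ => (1 : ℂ)) (W : L2 (Torus d)) (j : ℕ) :
    matW φ W j 0 = conv (φ j) W := by
  funext x
  rw [conv_eq_integral]
  refine integral_congr_ae ?_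
  filter_upwards [hφ] with y hy
  rw [hy, mul_one]

lemma matV_eq_integral (hφ : ⇑(φ 0) =ᵐ[volume] fun _ => (1 : ℂ)) (V : L2 (Torus d)) (j k : ℕ) :
    matV φ V j k 0 0 = ∫ y, conj (φ j y) * conv (φ k) V y := by
  refine integral_congr_ae ?_
  filter_upwards [hφ] with y hy
  rw [conv_eq_integral, ← integral_const_mul]
  refine integral_congr_ae ?_
  filter_upwards [hφ] with y' hy'
  rw [hy, hy']
  ring

lemma matV_create_annihilate_eq_integral (hφ : ⇑(φ 0) =ᵐ[volume] fun _ => (1 : ℂ))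
    (V : L2 (Torus d)) (j k : ℕ) :
    matV φ V j 0 k 0 = ∫ y, conj (φ j y) * conj (conv (φ k) (star V) y) := by
  refine integral_congr_ae ?_
  filter_upwards [hφ] with y hy
  rw [conj_conv_star, ← integral_const_mul]
  refine integral_congr_ae ?_
  filter_upwards [hφ] with y' hy'
  rw [hy, hy', map_one]
  ring

lemma matV_annihilate_eq_integral (hφ : ⇑(φ 0) =ᵐ[volume] fun _ => (1 : ℂ))
    (V : L2 (Torus d)) (j k : ℕ) :
    matV φ V 0 0 j k = ∫ y, φ k y * conj (conv (φ j) (star V) y) := by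
  refine integral_congr_ae ?_
  filter_upwards [hφ] with y hy
  rw [conj_conv_star, ← integral_const_mul]
  refine integral_congr_ae ?_
  filter_upwards [hφ] with y' hy'
  rw [hy, hy', map_one]
  ring

lemma inner_mulBdd_one {u : L2 (Torus d)} (hu : ⇑u =ᵐ[volume] fun _ => (1 : ℂ))
    {g : Torus d → ℂ} (hg : IsBdd g) (f : L2 (Torus d)) :
    ⟪f, mulBdd g u⟫_ℂ = ∫ y, conj (f y) * g y := by
  rw [L2.inner_def]
  refine integral_congr_ae ?_
  filter_upwards [hu, coeFn_mulBdd hg u] with y h1 h2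
  rw [h2, h1, mul_one, RCLike.inner_apply, mul_comm]

/-- In this form the matrix is a family of Fourier coefficients of `conv (φ k) V`, ready for the
double Bessel inequality. -/
lemma matV_eq_inner (hφ : ⇑(φ 0) =ᵐ[volume] fun _ => (1 : ℂ)) (V : L2 (Torus d)) (j k : ℕ) :
    matV φ V j k 0 0 = ⟪φ j, mulBdd (conv (φ k) V) (φ 0)⟫_ℂ := by
  rw [matV_eq_integral hφ, inner_mulBdd_one hφ (isBdd_conv _ _)]

/-- Reduces the annihilation matrix to the creation matrix. It gives square summability and, when
`star V = V`, the adjoint relation between the two quadratic series. -/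
lemma matV_annihilate_eq_conj (hφ : ⇑(φ 0) =ᵐ[volume] fun _ => (1 : ℂ)) (V : L2 (Torus d))
    (j k : ℕ) : matV φ V 0 0 j k = conj (matV φ (star V) k j 0 0) := by
  rw [matV_annihilate_eq_integral hφ, matV_eq_integral hφ, ← integral_conj]
  simp only [map_mul, Complex.conj_conj]

lemma orthonormal_succ (he : Orthonormal ℂ φ) : Orthonormal ℂ fun j => φ (j + 1) :=
  he.comp _ (add_left_injective 1)

lemma summable_matV_create (he : Orthonormal ℂ φ) (hφ : ⇑(φ 0) =ᵐ[volume] fun _ => (1 : ℂ))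
    (V : L2 (Torus d)) :
    Summable fun q : ℕ × ℕ => ‖matV φ V (q.1 + 1) (q.2 + 1) 0 0‖ ^ 2 := by
  simp_rw [matV_eq_inner hφ]
  exact summable_norm_inner_mulBdd_sq (orthonormal_succ he) (fun k => isBdd_conv (φ (k + 1)) V)
    (fun s x => sum_norm_conv_sq_le (orthonormal_succ he) s V x) (φ 0)

lemma summable_matV_annihilate (he : Orthonormal ℂ φ)
    (hφ : ⇑(φ 0) =ᵐ[volume] fun _ => (1 : ℂ)) (V : L2 (Torus d)) :
    Summable fun q : ℕ × ℕ => ‖matV φ V 0 0 (q.1 + 1) (q.2 + 1)‖ ^ 2 := by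
  simp_rw [matV_annihilate_eq_conj hφ, RCLike.norm_conj]
  exact (Equiv.prodComm ℕ ℕ).summable_iff.2 (summable_matV_create he hφ (star V))

lemma summable_matV_create_annihilate (he : Orthonormal ℂ φ)
    (hφ : ⇑(φ 0) =ᵐ[volume] fun _ => (1 : ℂ)) (V : L2 (Torus d)) :
    Summable fun q : ℕ × ℕ => ‖matV φ V (q.1 + 1) 0 (q.2 + 1) 0‖ ^ 2 := by
  have h : ∀ j k, matV φ V j 0 k 0 =
      ⟪φ j, mulBdd (fun y => conj (conv (φ k) (star V) y)) (φ 0)⟫_ℂ := fun j k => by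
    rw [matV_create_annihilate_eq_integral hφ, inner_mulBdd_one hφ (isBdd_conv _ _).conj]
  simp_rw [h]
  refine summable_norm_inner_mulBdd_sq (orthonormal_succ he)
    (fun k => (isBdd_conv (φ (k + 1)) (star V)).conj) (C := ‖star V‖ ^ 2) (fun s x => ?_) (φ 0)
  simp_rw [RCLike.norm_conj]
  exact sum_norm_conv_sq_le (orthonormal_succ he) s (star V) x

lemma star_eq_self {V : L2 (Torus d)} (hV : ∀ᵐ y, conj (V y) = V y) : star V = V := by
  refine Lp.ext ?_
  filter_upwards [hV, coeFn_star V] with y h1 h2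
  rw [h2, h1]

lemma memLp_comp_sub (V : L2 (Torus d)) (x : Torus d) : MemLp (fun y => V (x - y)) 2 volume :=
  (memLp_congr_ae (coeFn_reflect x V)).1 (Lp.memLp (reflect x V))

lemma integrable_mul_comp_sub (g V : L2 (Torus d)) (x : Torus d) :
    Integrable fun y => g y * V (x - y) :=
  MemLp.integrable_mul (p := 2) (q := 2) (Lp.memLp g) (memLp_comp_sub V x)

/-- Needed only for Fubini, so a crude bound uniform in `x` is enough. -/
lemma integral_norm_mul_comp_sub_le (g V : L2 (Torus d)) (x : Torus d) :
    ∫ y, ‖g y * V (x - y)‖ ≤ ‖g‖ ^ 2 + ‖V‖ ^ 2 := by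
  have h1 : Integrable fun y => ‖g y‖ ^ 2 :=
    (Lp.memLp g).integrable_norm_pow (p := 2) (by norm_num)
  have h2 : Integrable fun y => ‖V (x - y)‖ ^ 2 :=
    (memLp_comp_sub V x).integrable_norm_pow (p := 2) (by norm_num)
  have h3 : ‖V‖ ^ 2 = ∫ y, ‖V (x - y)‖ ^ 2 := by
    rw [← norm_reflect x V, norm_sq_eq_integral]
    refine integral_congr_ae ?_
    filter_upwards [coeFn_reflect x V] with y hy
    rw [hy]
  rw [norm_sq_eq_integral g, h3, ← integral_add h1 h2]
  refine integral_mono (integrable_mul_comp_sub g V x).norm (h1.add h2) fun y => ?_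
  simp only [norm_mul]
  nlinarith [sq_nonneg (‖g y‖ - ‖V (x - y)‖), sq_nonneg ‖g y‖, sq_nonneg ‖V (x - y)‖]

lemma integrable_mul_conv_kernel (f g V : L2 (Torus d)) :
    Integrable (fun p : Torus d × Torus d => conj (f p.1) * (g p.2 * V (p.1 - p.2)))
      (volume.prod volume) := by
  have hm : StronglyMeasurable
      fun p : Torus d × Torus d => conj (f p.1) * (g p.2 * V (p.1 - p.2)) :=
    (Complex.continuous_conj.comp_stronglyMeasurable
      ((Lp.stronglyMeasurable f).comp_measurable measurable_fst)).mul
      (((Lp.stronglyMeasurable g).comp_measurable measurable_snd).mul (stronglyMeasurable_sub V))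
  refine (integrable_prod_iff hm.aestronglyMeasurable).2
    ⟨Filter.Eventually.of_forall fun x => (integrable_mul_comp_sub g V x).const_mul (conj (f x)),
      ?_⟩
  have hf : Integrable fun x => ‖f x‖ * (‖g‖ ^ 2 + ‖V‖ ^ 2) :=
    ((Lp.memLp f).integrable (by norm_num)).norm.mul_const _
  refine hf.mono' hm.norm.integral_prod_right'.aestronglyMeasurable
    (Filter.Eventually.of_forall fun x => ?_)
  have h1 : ∀ y, ‖conj (f x) * (g y * V (x - y))‖ = ‖f x‖ * ‖g y * V (x - y)‖ := fun y => by
    rw [norm_mul, RCLike.norm_conj]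
  rw [Real.norm_of_nonneg (integral_nonneg fun y => norm_nonneg _)]
  simp only [h1]
  rw [integral_const_mul]
  exact mul_le_mul_of_nonneg_left (integral_norm_mul_comp_sub_le g V x) (norm_nonneg _)

/-- The matrix `V_{j0k0}` is Hermitian for real even `V`. -/
lemma conj_matV_create_annihilate (hφ : ⇑(φ 0) =ᵐ[volume] fun _ => (1 : ℂ)) {V : L2 (Torus d)}
    (hV : ∀ᵐ y, conj (V y) = V y) (hV' : ∀ᵐ y, V (-y) = V y) (j k : ℕ) :
    conj (matV φ V k 0 j 0) = matV φ V j 0 k 0 := by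
  rw [matV_create_annihilate_eq_integral hφ, matV_create_annihilate_eq_integral hφ,
    ← integral_conj]
  have h1 : ∀ y, conj (φ j y) * conj (conv (φ k) (star V) y) =
      ∫ y', conj (φ j y) * (φ k y' * V (y - y')) := fun y => by
    rw [conj_conv_star, integral_const_mul]
  simp_rw [h1]
  rw [integral_integral_swap (integrable_mul_conv_kernel (φ j) (φ k) V)]
  refine integral_congr_ae (Filter.Eventually.of_forall fun y => ?_)
  simp only [star_eq_self hV]
  rw [map_mul, Complex.conj_conj, Complex.conj_conj, conv_eq_integral, ← integral_const_mul]
  refine integral_congr_ae ?_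
  -- Evenness at the point `y - x` exchanges `V (x - y)` and `V (y - x)`.
  filter_upwards [(measurePreserving_sub_left_torus y).quasiMeasurePreserving.ae hV'] with x hx
  rw [← hx, neg_sub]
  ring

end MatrixElements

/-! ### Strong sums on the sectors -/

section StrongSums

/-- The numbers `b i x` are summable by `h2`, and `h1` then makes the operator series Cauchy; the
product `K * M` bounds all partial sums at once. -/
lemma exists_strongSum_of_sq {ι E F : Type*} [NormedAddCommGroup E] [NormedSpace ℂ E]
    [NormedAddCommGroup F] [NormedSpace ℂ F] [CompleteSpace F] {T : ι → E →L[ℂ] F}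
    {b : ι → E → ℝ} {K M C : ℝ} (hK : 0 ≤ K) (hC : 0 ≤ C) (hb : ∀ i x, 0 ≤ b i x)
    (h1 : ∀ (s : Finset ι) x, ‖∑ i ∈ s, T i x‖ ^ 2 ≤ K * ∑ i ∈ s, b i x)
    (h2 : ∀ (s : Finset ι) x, ∑ i ∈ s, b i x ≤ M * ‖x‖ ^ 2) (h : K * M ≤ C ^ 2) :
    ∃ A : E →L[ℂ] F, (∀ x, HasSum (fun i => T i x) (A x)) ∧
      (∀ (s : Finset ι) x, ‖∑ i ∈ s, T i x‖ ≤ C * ‖x‖) ∧ ∀ x, ‖A x‖ ≤ C * ‖x‖ := by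
  have hs : ∀ (s : Finset ι) x, ‖∑ i ∈ s, T i x‖ ≤ C * ‖x‖ := by
    intro s x
    refine le_of_sq_le_sq ?_ (by positivity)
    calc ‖∑ i ∈ s, T i x‖ ^ 2 ≤ K * (M * ‖x‖ ^ 2) := (h1 s x).trans (by gcongr; exact h2 s x)
      _ = K * M * ‖x‖ ^ 2 := by ring
      _ ≤ C ^ 2 * ‖x‖ ^ 2 := by gcongr
      _ = (C * ‖x‖) ^ 2 := by ring
  obtain ⟨A, hA, hA'⟩ := exists_strongSum (T := T) (fun x => summable_of_norm_sum_sq_le hK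
    (summable_of_sum_le (fun i => hb i x) fun s => h2 s x) fun s => h1 s x) hs
  exact ⟨A, hA, hs, hA'⟩

/-- Unconditional convergence involves arbitrary finite sets of pairs, while the orthonormality
estimates treat one index at a time. Extension by zero to a rectangle reconciles the two. -/
lemma exists_sum_eq_sum_sum (F : Finset (ℕ × ℕ)) : ∃ J K : Finset ℕ,
    ∀ {M : Type} [AddCommMonoid M] (f : ℕ × ℕ → M),
      ∑ q ∈ F, f q = ∑ j ∈ J, ∑ k ∈ K, if (j, k) ∈ F then f (j, k) else 0 := by
  refine ⟨F.image Prod.fst, F.image Prod.snd, fun f => ?_⟩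
  have hsub : F ⊆ F.image Prod.fst ×ˢ F.image Prod.snd := fun q hq =>
    Finset.mem_product.2 ⟨Finset.mem_image_of_mem _ hq, Finset.mem_image_of_mem _ hq⟩
  rw [← Finset.sum_product (s := F.image Prod.fst) (t := F.image Prod.snd)
    (f := fun q => if q ∈ F then f q else 0), ← Finset.sum_filter,
    Finset.filter_mem_eq_inter, Finset.inter_eq_right.2 hsub]

lemma norm_sum_smul_sq_le {ι E : Type*} [NormedAddCommGroup E] [NormedSpace ℂ E] (s : Finset ι)
    (c : ι → ℂ) (v : ι → E) :
    ‖∑ i ∈ s, c i • v i‖ ^ 2 ≤ (∑ i ∈ s, ‖c i‖ ^ 2) * ∑ i ∈ s, ‖v i‖ ^ 2 := by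
  refine le_trans ?_ (Finset.sum_mul_sq_le_sq_mul_sq s (fun i => ‖c i‖) fun i => ‖v i‖)
  gcongr
  refine (norm_sum_le _ _).trans (le_of_eq ?_)
  simp only [norm_smul]

lemma sq_le_of_sq_sq_le {a b : ℝ} (hb : 0 ≤ b) (h : (a ^ 2) ^ 2 ≤ b * a ^ 2) : a ^ 2 ≤ b := by
  rcases (sq_nonneg a).eq_or_lt with h0 | h0
  · rwa [← h0]
  · nlinarith

variable {d : ℕ} {e : ℕ → L2 (Torus d)} (he : Orthonormal ℂ e)

include he

/-- `norm_sum_creSector_sq_le` is applied twice, for the outer creator with factor `n + 2` and for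
the inner one with factor `n + 1`; the square summability of `B` does the rest. -/
lemma exists_strongSum_create_create {B : ℕ × ℕ → ℂ} {β : ℝ} (hβ0 : 0 ≤ β)
    (hβ : ∀ F : Finset (ℕ × ℕ), ∑ q ∈ F, ‖B q‖ ^ 2 ≤ β ^ 2) (n : ℕ) :
    ∃ A : sector d n →L[ℂ] sector d (n + 2),
      (∀ x, HasSum (fun q => B q • creSector (n + 1) (e q.1) (creSector n (e q.2) x)) (A x)) ∧
      (∀ (F : Finset (ℕ × ℕ)) x,
        ‖∑ q ∈ F, B q • creSector (n + 1) (e q.1) (creSector n (e q.2) x)‖ ≤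
          β * (n + 2) * ‖x‖) ∧ ∀ x, ‖A x‖ ≤ β * (n + 2) * ‖x‖ := by
  refine exists_strongSum_of_sq
    (T := fun q => B q • (creSector (n + 1) (e q.1) ∘L creSector n (e q.2)))
    (b := fun q x => ‖B q‖ ^ 2 * ‖x‖ ^ 2) (K := (n + 2) * (n + 1)) (M := β ^ 2) (by positivity)
    (by positivity) (fun q x => by positivity) (fun F x => ?_) (fun F x => ?_) ?_
  · obtain ⟨J, K, hJK⟩ := exists_sum_eq_sum_sum F
    rw [hJK, hJK]
    have h1 : ∀ j, (∑ k ∈ K, if (j, k) ∈ F then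
        (B (j, k) • (creSector (n + 1) (e j) ∘L creSector n (e k))) x else 0) =
        creSector (n + 1) (e j)
          (∑ k ∈ K, creSector n (e k) (if (j, k) ∈ F then B (j, k) • x else 0)) := by
      intro j
      rw [map_sum]
      refine Finset.sum_congr rfl fun k _ => ?_
      split_ifs
      · simp
      · simp
    simp only [h1]
    refine (norm_sum_creSector_sq_le he J _).trans ?_
    rw [mul_assoc, Finset.mul_sum (a := (n + 1 : ℝ))]
    push_cast
    rw [show (n : ℝ) + 1 + 1 = n + 2 by ring]
    gcongr with j _
    refine (norm_sum_creSector_sq_le he K _).trans (le_of_eq ?_)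
    congr 1
    refine Finset.sum_congr rfl fun k _ => ?_
    split_ifs
    · rw [norm_smul, mul_pow]
    · simp
  · rw [← Finset.sum_mul]
    gcongr
    exact hβ F
  · nlinarith [sq_nonneg β, mul_nonneg (sq_nonneg β) (Nat.cast_nonneg (α := ℝ) n)]

/-- The creators are handled by orthonormality, the annihilators by Cauchy–Schwarz in `k`. The norm
is at most `β (n + 1)`; it is relaxed to `n + 2` so that all blocks share one form. -/
lemma exists_strongSum_create_annihilate {B : ℕ × ℕ → ℂ} {β : ℝ} (hβ0 : 0 ≤ β)
    (hβ : ∀ F : Finset (ℕ × ℕ), ∑ q ∈ F, ‖B q‖ ^ 2 ≤ β ^ 2) (n : ℕ) :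
    ∃ A : sector d (n + 1) →L[ℂ] sector d (n + 1),
      (∀ x, HasSum (fun q => B q • creSector n (e q.1) (annSector n (e q.2) x)) (A x)) ∧
      (∀ (F : Finset (ℕ × ℕ)) x,
        ‖∑ q ∈ F, B q • creSector n (e q.1) (annSector n (e q.2) x)‖ ≤
          β * (n + 2) * ‖x‖) ∧ ∀ x, ‖A x‖ ≤ β * (n + 2) * ‖x‖ := by
  refine exists_strongSum_of_sq
    (T := fun q => B q • (creSector n (e q.1) ∘L annSector n (e q.2)))
    (b := fun q x => ‖B q‖ ^ 2 * ‖x‖ ^ 2) (K := (n + 1) * (n + 1)) (M := β ^ 2) (by positivity)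
    (by positivity) (fun q x => by positivity) (fun F x => ?_) (fun F x => ?_) ?_
  · obtain ⟨J, K, hJK⟩ := exists_sum_eq_sum_sum F
    rw [hJK, hJK]
    have h1 : ∀ j, (∑ k ∈ K, if (j, k) ∈ F then
        (B (j, k) • (creSector n (e j) ∘L annSector n (e k))) x else 0) =
        creSector n (e j)
          (∑ k ∈ K, (if (j, k) ∈ F then B (j, k) else 0) • annSector n (e k) x) := by
      intro j
      rw [map_sum]
      refine Finset.sum_congr rfl fun k _ => ?_
      split_ifs
      · simp
      · simp
    simp only [h1]
    refine (norm_sum_creSector_sq_le he J _).trans ?_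
    rw [mul_assoc]
    refine mul_le_mul_of_nonneg_left ?_ (by positivity)
    rw [Finset.mul_sum]
    refine Finset.sum_le_sum fun j _ => ?_
    refine (norm_sum_smul_sq_le K _ _).trans ?_
    have h2 := sum_norm_annSector_sq_le he K x
    calc (∑ k ∈ K, ‖if (j, k) ∈ F then B (j, k) else 0‖ ^ 2) *
          ∑ k ∈ K, ‖annSector n (e k) x‖ ^ 2
        ≤ (∑ k ∈ K, ‖if (j, k) ∈ F then B (j, k) else 0‖ ^ 2) * ((n + 1) * ‖x‖ ^ 2) := by
          gcongr
      _ = (n + 1) * ∑ k ∈ K, if (j, k) ∈ F then ‖B (j, k)‖ ^ 2 * ‖x‖ ^ 2 else 0 := by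
          rw [mul_left_comm, Finset.sum_mul]
          congr 1
          refine Finset.sum_congr rfl fun k _ => ?_
          split_ifs
          · rfl
          · simp
  · rw [← Finset.sum_mul]
    gcongr
    exact hβ F
  · nlinarith [sq_nonneg β, mul_nonneg (sq_nonneg β) (Nat.cast_nonneg (α := ℝ) n)]

/-- The one-index bound is used twice, first for the outer annihilator with the inner one fixed. -/
lemma sum_norm_annSector_annSector_sq_le {n : ℕ} (F : Finset (ℕ × ℕ)) (x : sector d (n + 2)) :
    ∑ q ∈ F, ‖annSector n (e q.1) (annSector (n + 1) (e q.2) x)‖ ^ 2 ≤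
      (n + 1) * (n + 2) * ‖x‖ ^ 2 := by
  have hsub : F ⊆ F.image Prod.fst ×ˢ F.image Prod.snd := fun q hq =>
    Finset.mem_product.2 ⟨Finset.mem_image_of_mem _ hq, Finset.mem_image_of_mem _ hq⟩
  refine (Finset.sum_le_sum_of_subset_of_nonneg hsub fun q _ _ => sq_nonneg _).trans ?_
  rw [Finset.sum_product_right]
  have h1 : ∀ k, ∑ j ∈ F.image Prod.fst, ‖annSector n (e j) (annSector (n + 1) (e k) x)‖ ^ 2 ≤
      (n + 1) * ‖annSector (n + 1) (e k) x‖ ^ 2 := fun k =>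
    sum_norm_annSector_sq_le he _ (annSector (n + 1) (e k) x)
  have h2 := sum_norm_annSector_sq_le (n := n + 1) he (F.image Prod.snd) x
  refine (Finset.sum_le_sum fun k _ => h1 k).trans ?_
  rw [← Finset.mul_sum, mul_assoc]
  refine mul_le_mul_of_nonneg_left (h2.trans (le_of_eq ?_)) (by positivity)
  push_cast
  ring

lemma exists_strongSum_annihilate_annihilate {B : ℕ × ℕ → ℂ} {β : ℝ} (hβ0 : 0 ≤ β)
    (hβ : ∀ F : Finset (ℕ × ℕ), ∑ q ∈ F, ‖B q‖ ^ 2 ≤ β ^ 2) (n : ℕ) :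
    ∃ A : sector d (n + 2) →L[ℂ] sector d n,
      (∀ x, HasSum (fun q => B q • annSector n (e q.1) (annSector (n + 1) (e q.2) x)) (A x)) ∧
      (∀ (F : Finset (ℕ × ℕ)) x,
        ‖∑ q ∈ F, B q • annSector n (e q.1) (annSector (n + 1) (e q.2) x)‖ ≤
          β * (n + 2) * ‖x‖) ∧ ∀ x, ‖A x‖ ≤ β * (n + 2) * ‖x‖ := by
  refine exists_strongSum_of_sq
    (T := fun q => B q • (annSector n (e q.1) ∘L annSector (n + 1) (e q.2)))
    (b := fun q x => ‖B q‖ ^ 2 * ‖x‖ ^ 2) (K := (n + 1) * (n + 2)) (M := β ^ 2) (by positivity)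
    (by positivity) (fun q x => by positivity) (fun F x => ?_) (fun F x => ?_) ?_
  · refine (norm_sum_smul_sq_le F _ _).trans ?_
    refine (mul_le_mul_of_nonneg_left (sum_norm_annSector_annSector_sq_le he F x)
      (Finset.sum_nonneg fun q _ => sq_nonneg _)).trans (le_of_eq ?_)
    rw [← Finset.sum_mul]
    ring
  · rw [← Finset.sum_mul]
    gcongr
    exact hβ F
  · nlinarith [sq_nonneg β, mul_nonneg (sq_nonneg β) (Nat.cast_nonneg (α := ℝ) n)]

variable {w : ℕ → Torus d → ℂ} (hw : ∀ j, IsBdd (w j)) {β : ℝ} (hβ0 : 0 ≤ β)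
  (hβ : ∀ (s : Finset ℕ) x, ∑ j ∈ s, ‖w j x‖ ^ 2 ≤ β ^ 2)

include hw hβ0 hβ

/-- Once the multiplier is commuted to the right, each term is a creator applied to `w_j x`, and the
pointwise Bessel bound sums `‖w_j x‖²`. -/
lemma exists_strongSum_mul_create (n : ℕ) :
    ∃ A : sector d n →L[ℂ] sector d (n + 1),
      (∀ x, HasSum (fun j => mulSector (w j) (n + 1) (creSector n (e j) x)) (A x)) ∧
      (∀ (s : Finset ℕ) x, ‖∑ j ∈ s, mulSector (w j) (n + 1) (creSector n (e j) x)‖ ≤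
          β * (n + 2) * ‖x‖) ∧ ∀ x, ‖A x‖ ≤ β * (n + 2) * ‖x‖ := by
  refine exists_strongSum_of_sq (T := fun j => mulSector (w j) (n + 1) ∘L creSector n (e j))
    (b := fun j x => ‖mulSector (w j) n x‖ ^ 2) (K := n + 1) (M := β ^ 2) (by positivity)
    (by positivity) (fun q x => by positivity) (fun s x => ?_)
    (fun s x => sum_norm_mulSector_sq_le hw s (hβ s) x) ?_
  · simp only [ContinuousLinearMap.comp_apply, mulSector_creSector (hw _)]
    exact norm_sum_creSector_sq_le he s _
  · nlinarith [sq_nonneg β, mul_nonneg (sq_nonneg β) (Nat.cast_nonneg (α := ℝ) n),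
      mul_nonneg (sq_nonneg β) (sq_nonneg (n : ℝ))]

lemma exists_strongSum_mul_annihilate (n : ℕ) :
    ∃ A : sector d (n + 1) →L[ℂ] sector d n,
      (∀ x, HasSum (fun j => mulSector (fun z => conj (w j z)) n (annSector n (e j) x)) (A x)) ∧
      (∀ (s : Finset ℕ) x,
        ‖∑ j ∈ s, mulSector (fun z => conj (w j z)) n (annSector n (e j) x)‖ ≤
          β * (n + 2) * ‖x‖) ∧ ∀ x, ‖A x‖ ≤ β * (n + 2) * ‖x‖ := by
  refine exists_strongSum_of_sq
    (T := fun j => mulSector (fun z => conj (w j z)) n ∘L annSector n (e j))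
    (b := fun j x => ‖annSector n (e j) x‖ ^ 2) (K := β ^ 2) (M := n + 1) (by positivity)
    (by positivity) (fun q x => by positivity) (fun s x => ?_)
    (fun s x => sum_norm_annSector_sq_le he s x) ?_
  · set S := ∑ j ∈ s, (mulSector (fun z => conj (w j z)) n ∘L annSector n (e j)) x with hS
    -- The partial sum is paired with itself and the multipliers moved onto it, where `∑ ‖w_j S‖² ≤
    -- β² ‖S‖²` is available. The summable factors `‖a_j x‖²` remain and control the tails.
    have h1 : ‖S‖ ^ 2 ≤ ∑ j ∈ s, ‖mulSector (w j) n S‖ * ‖annSector n (e j) x‖ := by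
      have h2 : ((‖S‖ ^ 2 : ℝ) : ℂ) = ∑ j ∈ s, ⟪mulSector (w j) n S, annSector n (e j) x⟫_ℂ := by
        rw [← inner_self_eq_ofReal]
        nth_rw 2 [hS]
        rw [inner_sum]
        refine Finset.sum_congr rfl fun j _ => ?_
        rw [inner_mulSector_left (hw j)]
        rfl
      have h3 := congrArg norm h2
      rw [Complex.norm_real, Real.norm_of_nonneg (by positivity)] at h3
      rw [h3]
      exact (norm_sum_le _ _).trans (Finset.sum_le_sum fun j _ => norm_inner_le_norm (𝕜 := ℂ)
        (mulSector (w j) n S) (annSector n (e j) x))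
    have h4 : (‖S‖ ^ 2) ^ 2 ≤ (β ^ 2 * ‖S‖ ^ 2) * ∑ j ∈ s, ‖annSector n (e j) x‖ ^ 2 := by
      refine (pow_le_pow_left₀ (sq_nonneg _) h1 2).trans ?_
      refine (Finset.sum_mul_sq_le_sq_mul_sq _ _ _).trans ?_
      exact mul_le_mul_of_nonneg_right (sum_norm_mulSector_sq_le hw s (hβ s) S)
        (Finset.sum_nonneg fun j _ => sq_nonneg _)
    exact sq_le_of_sq_sq_le (mul_nonneg (sq_nonneg _)
      (Finset.sum_nonneg fun j _ => sq_nonneg _)) (h4.trans (le_of_eq (by ring)))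
  · nlinarith [sq_nonneg β, mul_nonneg (sq_nonneg β) (Nat.cast_nonneg (α := ℝ) n),
      mul_nonneg (sq_nonneg β) (sq_nonneg (n : ℝ))]

end StrongSums

/-! ### The interaction on the domain of the number operator -/

section Fock

variable {d : ℕ}

/-- The moment `∑ₙ (n + 1)^r ‖Φ⁽ⁿ⁾‖²` of the particle number is finite. -/
def HasMoment (r : ℕ) (Φ : Hplus d) : Prop :=
  Summable fun n : ℕ => ((n : ℝ) + 1) ^ r * ‖Φ n‖ ^ 2

/-- The second moment of the particle number. -/
def secondMoment (Φ : Hplus d) : ℝ := ∑' n : ℕ, ((n : ℝ) + 1) ^ 2 * ‖Φ n‖ ^ 2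

/-- The factor `√(n + 1)` costs one power of the number weight, so two moments allow a product of
two creators or annihilators. The factor `2 ^ r` absorbs the shift, as `n + 2 ≤ 2 (n + 1)`. -/
lemma exists_mem_graph_cre {r : ℕ} {Φ : Hplus d} (h : HasMoment (r + 1) Φ) (f : L2 (Torus d)) :
    ∃ Ψ : Hplus d, (Φ, Ψ) ∈ (cre f).graph ∧ Ψ 0 = 0 ∧
      (∀ n, Ψ (n + 1) = creSector n f (Φ n)) ∧ HasMoment r Ψ := by
  let S : ∀ n, sector d n := fun n => Nat.casesOn n 0 fun n => creSector n f (Φ n)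
  have hb : ∀ n : ℕ, ((n + 1 : ℕ) + 1 : ℝ) ^ r * ‖S (n + 1)‖ ^ 2 ≤
      2 ^ r * ‖f‖ ^ 2 * (((n : ℝ) + 1) ^ (r + 1) * ‖Φ n‖ ^ 2) := by
    intro n
    have h1 : ((n + 1 : ℕ) + 1 : ℝ) ^ r ≤ 2 ^ r * ((n : ℝ) + 1) ^ r := by
      rw [← mul_pow]
      refine pow_le_pow_left₀ (by positivity) ?_ r
      push_cast
      linarith [n.cast_nonneg (α := ℝ)]
    calc ((n + 1 : ℕ) + 1 : ℝ) ^ r * ‖S (n + 1)‖ ^ 2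
        ≤ (2 ^ r * ((n : ℝ) + 1) ^ r) * ((n + 1) * (‖f‖ ^ 2 * ‖Φ n‖ ^ 2)) :=
          mul_le_mul h1 (norm_creSector_sq_le f (Φ n)) (by positivity) (by positivity)
      _ = _ := by ring
  have hm : Summable fun n : ℕ => ((n : ℝ) + 1) ^ r * ‖S n‖ ^ 2 := by
    rw [← summable_nat_add_iff 1]
    exact Summable.of_nonneg_of_le (fun n => by positivity) hb (h.mul_left _)
  have hS : Memℓp S 2 := by
    refine memℓp_two_iff.2 (Summable.of_nonneg_of_le (fun n => by positivity) (fun n => ?_) hm)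
    exact le_mul_of_one_le_left (by positivity)
      (one_le_pow₀ (by linarith [n.cast_nonneg (α := ℝ)]))
  exact ⟨⟨S, hS⟩, (mem_graph_toLinearPMap_iff (creGraph_functional f)).2 ⟨rfl, fun n => rfl⟩,
    rfl, fun n => rfl, hm⟩

lemma exists_mem_graph_ann {r : ℕ} {Φ : Hplus d} (h : HasMoment (r + 1) Φ) (f : L2 (Torus d)) :
    ∃ Ψ : Hplus d, (Φ, Ψ) ∈ (ann f).graph ∧
      (∀ n, Ψ n = annSector n f (Φ (n + 1))) ∧ HasMoment r Ψ := by
  let S : ∀ n, sector d n := fun n => annSector n f (Φ (n + 1))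
  have hb : ∀ n : ℕ, ((n : ℝ) + 1) ^ r * ‖S n‖ ^ 2 ≤
      ‖f‖ ^ 2 * (((n + 1 : ℕ) + 1 : ℝ) ^ (r + 1) * ‖Φ (n + 1)‖ ^ 2) := by
    intro n
    have h1 : ((n : ℝ) + 1) ^ (r + 1) ≤ ((n + 1 : ℕ) + 1 : ℝ) ^ (r + 1) := by
      refine pow_le_pow_left₀ (by positivity) ?_ _
      push_cast
      linarith
    calc ((n : ℝ) + 1) ^ r * ‖S n‖ ^ 2
        ≤ ((n : ℝ) + 1) ^ r * ((n + 1) * (‖f‖ ^ 2 * ‖Φ (n + 1)‖ ^ 2)) :=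
          mul_le_mul_of_nonneg_left (norm_annSector_sq_le f (Φ (n + 1))) (by positivity)
      _ = ‖f‖ ^ 2 * (((n : ℝ) + 1) ^ (r + 1) * ‖Φ (n + 1)‖ ^ 2) := by ring
      _ ≤ _ := by gcongr
  have hm : Summable fun n : ℕ => ((n : ℝ) + 1) ^ r * ‖S n‖ ^ 2 :=
    Summable.of_nonneg_of_le (fun n => by positivity) hb
      (((summable_nat_add_iff 1).2 h).mul_left _)
  have hS : Memℓp S 2 := by
    refine memℓp_two_iff.2 (Summable.of_nonneg_of_le (fun n => by positivity) (fun n => ?_) hm)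
    exact le_mul_of_one_le_left (by positivity)
      (one_le_pow₀ (by linarith [n.cast_nonneg (α := ℝ)]))
  exact ⟨⟨S, hS⟩, (mem_graph_toLinearPMap_iff (annGraph_functional f)).2 fun n => rfl,
    fun n => rfl, hm⟩

lemma exists_mem_graph_tracerMul {w : Torus d → ℂ} (hw : IsBdd w) (Φ : Hplus d) :
    ∃ Ψ : Hplus d, (Φ, Ψ) ∈ (tracerMul w).graph ∧ ∀ n, Ψ n = mulSector w n (Φ n) := by
  obtain ⟨C, hC⟩ := hw.2
  have hb : ∀ n, ‖mulSector w n (Φ n)‖ ^ 2 ≤ C ^ 2 * ‖Φ n‖ ^ 2 := by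
    intro n
    have := sum_norm_mulSector_sq_le (w := fun _ : Unit => w) (fun _ => hw) {()} (C := C ^ 2)
      (fun x => by simpa using pow_le_pow_left₀ (norm_nonneg _) (hC x) 2) (Φ n)
    simpa using this
  have hS : Memℓp (fun n => mulSector w n (Φ n)) 2 :=
    memℓp_two_iff.2 (Summable.of_nonneg_of_le (fun n => sq_nonneg _) hb
      ((lp_summable_sq Φ).mul_left _))
  refine ⟨⟨_, hS⟩, (mem_graph_toLinearPMap_iff (tracerMulGraph_functional w)).2 fun n => ?_,
    fun n => rfl⟩
  change ⇑(mulSector w n (Φ n) : L2 (Config d n)) =ᵐ[volume] _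
  rw [coe_mulSector hw]
  exact coeFn_mulBdd (hw.comp_eval (0 : Fin (n + 1))) _

/-- The sequence `u` moved up by one place. -/
def shiftUp (u : ℕ → ℝ) : ℕ → ℝ := fun n => Nat.casesOn n 0 u

lemma hasSum_shiftUp {u : ℕ → ℝ} (hu : Summable u) : HasSum (shiftUp u) (∑' n, u n) := by
  rw [← hasSum_nat_add_iff' 1]
  simpa [shiftUp] using hu.hasSum

lemma tsum_nat_add_le {u : ℕ → ℝ} (hu : Summable u) (h0 : ∀ n, 0 ≤ u n) (k : ℕ) :
    ∑' n, u (n + k) ≤ ∑' n, u n := by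
  rw [← hu.sum_add_tsum_nat_add k]
  exact le_add_of_nonneg_left (Finset.sum_nonneg fun n _ => h0 n)

/-- Turns linear block growth into the second-moment weight of the source sector `k`; the 4 comes
from `n + 2 ≤ 2 (k + 1)`. -/
lemma sq_norm_le_of_linear_growth {E : Type*} [NormedAddCommGroup E] {β : ℝ} {n k : ℕ}
    (hnk : n ≤ k) {x : ℝ} {y : E} (h : ‖y‖ ≤ β * (n + 2) * x) :
    ‖y‖ ^ 2 ≤ 4 * β ^ 2 * (((k : ℝ) + 1) ^ 2 * x ^ 2) := by
  have hnk' : (n : ℝ) ≤ k := Nat.cast_le.2 hnk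
  calc ‖y‖ ^ 2 ≤ (β * (n + 2) * x) ^ 2 := pow_le_pow_left₀ (norm_nonneg _) h 2
    _ = β ^ 2 * x ^ 2 * (n + 2) ^ 2 := by ring
    _ ≤ β ^ 2 * x ^ 2 * (2 * ((k : ℝ) + 1)) ^ 2 := by
      refine mul_le_mul_of_nonneg_left ?_ (by positivity)
      exact pow_le_pow_left₀ (by positivity) (by linarith [n.cast_nonneg (α := ℝ)]) 2
    _ = _ := by ring

variable {e : ℕ → L2 (Torus d)} {B : ℕ × ℕ → ℂ} {w : ℕ → Torus d → ℂ} {β : ℝ}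

set_option maxHeartbeats 1000000 in
-- The series converges in each sector by `hA`. Convergence in the Hilbert sum follows by dominated
-- convergence, with the terms of the second moment as majorant; the four lemmas after it have the
-- same mechanism.
lemma exists_mem_graph_create_create {A : ∀ n, sector d n →L[ℂ] sector d (n + 2)}
    (hA : ∀ n x, HasSum (fun q => B q • creSector (n + 1) (e q.1) (creSector n (e q.2) x))
      (A n x))
    (hF : ∀ n (F : Finset (ℕ × ℕ)) x,
      ‖∑ q ∈ F, B q • creSector (n + 1) (e q.1) (creSector n (e q.2) x)‖ ≤
        β * (n + 2) * ‖x‖)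
    {Φ : Hplus d} (hΦ : HasMoment 2 Φ) :
    ∃ Ψ : Hplus d,
      (Φ, Ψ) ∈ (opSum fun q : ℕ × ℕ => B q • opComp (cre (e q.1)) (cre (e q.2))).graph ∧
      (Ψ 0 = 0 ∧ Ψ 1 = 0 ∧ ∀ n, Ψ (n + 2) = A n (Φ n)) ∧
      ‖Ψ‖ ^ 2 ≤ 4 * β ^ 2 * secondMoment Φ := by
  have hu : ∀ q : ℕ × ℕ, ∃ u : Hplus d,
      (Φ, u) ∈ (B q • opComp (cre (e q.1)) (cre (e q.2))).graph ∧ u 0 = 0 ∧ u 1 = 0 ∧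
      ∀ n, u (n + 2) = B q • creSector (n + 1) (e q.1) (creSector n (e q.2) (Φ n)) := by
    intro q
    obtain ⟨Φ₁, h1, h10, h11, hm⟩ := exists_mem_graph_cre (r := 1) hΦ (e q.2)
    obtain ⟨Φ₂, h2, h20, h21, -⟩ := exists_mem_graph_cre (r := 0) hm (e q.1)
    refine ⟨B q • Φ₂, mem_graph_smul _ (mem_graph_opComp h1 h2), ?_, ?_, fun n => ?_⟩
    · exact (congrArg (fun t => B q • t) h20).trans (smul_zero _)
    · refine (congrArg (fun t => B q • t) ((h21 0).trans ?_)).trans (smul_zero _)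
      exact (congrArg (creSector 0 (e q.1)) h10).trans (map_zero _)
    · exact congrArg (fun t => B q • t)
        ((h21 (n + 1)).trans (congrArg (creSector (n + 1) (e q.1)) (h11 n)))
  choose u hug hu0 hu1 hu2 using hu
  have hμ : Summable fun n : ℕ => 4 * β ^ 2 * (((n : ℝ) + 1) ^ 2 * ‖Φ n‖ ^ 2) := hΦ.mul_left _
  have hg := hasSum_shiftUp hμ
  -- The majorant is moved up twice, since block `n` lands in sector `n + 2`.
  have hg' := hasSum_shiftUp hg.summable
  obtain ⟨Ψ, hΨ, hsum, hn⟩ := lp_hasSum_of_dominated (u := u)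
    (S := fun n => Nat.casesOn n 0 fun n => Nat.casesOn n 0 fun n => A n (Φ n))
    (fun n => by
      rcases n with _ | _ | n
      · simp only [hu0]; exact hasSum_zero
      · simp only [hu1]; exact hasSum_zero
      · simp only [hu2]; exact hA n (Φ n)) hg'.summable
    (fun s n => by
      rcases n with _ | _ | n
      · simp [hu0, shiftUp]
      · simp [hu1, shiftUp]
      · simp only [hu2]
        exact sq_norm_le_of_linear_growth le_rfl (hF n s (Φ n)))
  refine ⟨Ψ, mem_graph_opSum hug hsum, ⟨hΨ 0, hΨ 1, fun n => hΨ (n + 2)⟩, ?_⟩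
  rwa [hg'.tsum_eq, hg.tsum_eq, tsum_mul_left] at hn

set_option maxHeartbeats 1000000 in
lemma exists_mem_graph_create_annihilate {A : ∀ n, sector d (n + 1) →L[ℂ] sector d (n + 1)}
    (hA : ∀ n x, HasSum (fun q => B q • creSector n (e q.1) (annSector n (e q.2) x)) (A n x))
    (hF : ∀ n (F : Finset (ℕ × ℕ)) x,
      ‖∑ q ∈ F, B q • creSector n (e q.1) (annSector n (e q.2) x)‖ ≤ β * (n + 2) * ‖x‖)
    {Φ : Hplus d} (hΦ : HasMoment 2 Φ) :
    ∃ Ψ : Hplus d,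
      (Φ, Ψ) ∈ (opSum fun q : ℕ × ℕ => B q • opComp (cre (e q.1)) (ann (e q.2))).graph ∧
      (Ψ 0 = 0 ∧ ∀ n, Ψ (n + 1) = A n (Φ (n + 1))) ∧
      ‖Ψ‖ ^ 2 ≤ 4 * β ^ 2 * secondMoment Φ := by
  have hu : ∀ q : ℕ × ℕ, ∃ u : Hplus d,
      (Φ, u) ∈ (B q • opComp (cre (e q.1)) (ann (e q.2))).graph ∧ u 0 = 0 ∧
      ∀ n, u (n + 1) = B q • creSector n (e q.1) (annSector n (e q.2) (Φ (n + 1))) := by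
    intro q
    obtain ⟨Φ₁, h1, h11, hm⟩ := exists_mem_graph_ann (r := 1) hΦ (e q.2)
    obtain ⟨Φ₂, h2, h20, h21, -⟩ := exists_mem_graph_cre (r := 0) hm (e q.1)
    refine ⟨B q • Φ₂, mem_graph_smul _ (mem_graph_opComp h1 h2), ?_, fun n => ?_⟩
    · exact (congrArg (fun t => B q • t) h20).trans (smul_zero _)
    · exact congrArg (fun t => B q • t)
        ((h21 n).trans (congrArg (creSector n (e q.1)) (h11 n)))
  choose u hug hu0 hu1 using hu
  have hμ : Summable fun n : ℕ => 4 * β ^ 2 * (((n : ℝ) + 1) ^ 2 * ‖Φ n‖ ^ 2) := hΦ.mul_left _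
  obtain ⟨Ψ, hΨ, hsum, hn⟩ := lp_hasSum_of_dominated (u := u)
    (S := fun n => Nat.casesOn n 0 fun n => A n (Φ (n + 1)))
    (fun n => by
      rcases n with _ | n
      · simp only [hu0]; exact hasSum_zero
      · simp only [hu1]; exact hA n (Φ (n + 1))) hμ
    (fun s n => by
      rcases n with _ | n
      · simp only [hu0, Finset.sum_const_zero, norm_zero]
        rw [zero_pow two_ne_zero]
        positivity
      · simp only [hu1]
        exact sq_norm_le_of_linear_growth (Nat.le_succ n) (hF n s (Φ (n + 1))))
  refine ⟨Ψ, mem_graph_opSum hug hsum, ⟨hΨ 0, fun n => hΨ (n + 1)⟩, ?_⟩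
  rwa [tsum_mul_left] at hn

set_option maxHeartbeats 1000000 in
lemma exists_mem_graph_annihilate_annihilate {A : ∀ n, sector d (n + 2) →L[ℂ] sector d n}
    (hA : ∀ n x, HasSum (fun q => B q • annSector n (e q.1) (annSector (n + 1) (e q.2) x))
      (A n x))
    (hF : ∀ n (F : Finset (ℕ × ℕ)) x,
      ‖∑ q ∈ F, B q • annSector n (e q.1) (annSector (n + 1) (e q.2) x)‖ ≤
        β * (n + 2) * ‖x‖)
    {Φ : Hplus d} (hΦ : HasMoment 2 Φ) :
    ∃ Ψ : Hplus d,
      (Φ, Ψ) ∈ (opSum fun q : ℕ × ℕ => B q • opComp (ann (e q.1)) (ann (e q.2))).graph ∧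
      (∀ n, Ψ n = A n (Φ (n + 2))) ∧ ‖Ψ‖ ^ 2 ≤ 4 * β ^ 2 * secondMoment Φ := by
  have hu : ∀ q : ℕ × ℕ, ∃ u : Hplus d,
      (Φ, u) ∈ (B q • opComp (ann (e q.1)) (ann (e q.2))).graph ∧
      ∀ n, u n = B q • annSector n (e q.1) (annSector (n + 1) (e q.2) (Φ (n + 2))) := by
    intro q
    obtain ⟨Φ₁, h1, h11, hm⟩ := exists_mem_graph_ann (r := 1) hΦ (e q.2)
    obtain ⟨Φ₂, h2, h21, -⟩ := exists_mem_graph_ann (r := 0) hm (e q.1)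
    refine ⟨B q • Φ₂, mem_graph_smul _ (mem_graph_opComp h1 h2), fun n => ?_⟩
    exact congrArg (fun t => B q • t)
      ((h21 n).trans (congrArg (annSector n (e q.1)) (h11 (n + 1))))
  choose u hug hu1 using hu
  have hμ : Summable fun n : ℕ => 4 * β ^ 2 * (((n : ℝ) + 1) ^ 2 * ‖Φ n‖ ^ 2) := hΦ.mul_left _
  obtain ⟨Ψ, hΨ, hsum, hn⟩ := lp_hasSum_of_dominated (u := u) (S := fun n => A n (Φ (n + 2)))
    (fun n => by simp only [hu1]; exact hA n (Φ (n + 2))) ((summable_nat_add_iff 2).2 hμ)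
    (fun s n => by
      simp only [hu1]
      exact sq_norm_le_of_linear_growth (Nat.le_add_right n 2) (hF n s (Φ (n + 2))))
  refine ⟨Ψ, mem_graph_opSum hug hsum, hΨ, ?_⟩
  refine hn.trans ((tsum_nat_add_le hμ (fun n => by positivity) 2).trans (le_of_eq ?_))
  rw [tsum_mul_left]
  rfl

set_option maxHeartbeats 1000000 in
lemma exists_mem_graph_mul_create {A : ∀ n, sector d n →L[ℂ] sector d (n + 1)}
    (hw : ∀ j, IsBdd (w j))
    (hA : ∀ n x, HasSum (fun j => mulSector (w j) (n + 1) (creSector n (e j) x)) (A n x))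
    (hF : ∀ n (s : Finset ℕ) x,
      ‖∑ j ∈ s, mulSector (w j) (n + 1) (creSector n (e j) x)‖ ≤ β * (n + 2) * ‖x‖)
    {Φ : Hplus d} (hΦ : HasMoment 2 Φ) :
    ∃ Ψ : Hplus d,
      (Φ, Ψ) ∈ (opSum fun j : ℕ => opComp (tracerMul (w j)) (cre (e j))).graph ∧
      (Ψ 0 = 0 ∧ ∀ n, Ψ (n + 1) = A n (Φ n)) ∧
      ‖Ψ‖ ^ 2 ≤ 4 * β ^ 2 * secondMoment Φ := by
  have hu : ∀ j : ℕ, ∃ u : Hplus d, (Φ, u) ∈ (opComp (tracerMul (w j)) (cre (e j))).graph ∧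
      u 0 = 0 ∧ ∀ n, u (n + 1) = mulSector (w j) (n + 1) (creSector n (e j) (Φ n)) := by
    intro j
    obtain ⟨Φ₁, h1, h10, h11, -⟩ := exists_mem_graph_cre (r := 1) hΦ (e j)
    obtain ⟨Φ₂, h2, h21⟩ := exists_mem_graph_tracerMul (hw j) Φ₁
    refine ⟨Φ₂, mem_graph_opComp h1 h2, ?_, fun n => ?_⟩
    · rw [h21, h10, map_zero]
    · rw [h21, h11]
  choose u hug hu0 hu1 using hu
  have hμ : Summable fun n : ℕ => 4 * β ^ 2 * (((n : ℝ) + 1) ^ 2 * ‖Φ n‖ ^ 2) := hΦ.mul_left _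
  have hg := hasSum_shiftUp hμ
  obtain ⟨Ψ, hΨ, hsum, hn⟩ := lp_hasSum_of_dominated (u := u)
    (S := fun n => Nat.casesOn n 0 fun n => A n (Φ n))
    (fun n => by
      rcases n with _ | n
      · simp only [hu0]; exact hasSum_zero
      · simp only [hu1]; exact hA n (Φ n)) hg.summable
    (fun s n => by
      rcases n with _ | n
      · simp [hu0, shiftUp]
      · simp only [hu1]
        exact sq_norm_le_of_linear_growth le_rfl (hF n s (Φ n)))
  refine ⟨Ψ, mem_graph_opSum hug hsum, ⟨hΨ 0, fun n => hΨ (n + 1)⟩, ?_⟩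
  rwa [hg.tsum_eq, tsum_mul_left] at hn

set_option maxHeartbeats 1000000 in
lemma exists_mem_graph_mul_annihilate {A : ∀ n, sector d (n + 1) →L[ℂ] sector d n}
    (hw : ∀ j, IsBdd (w j))
    (hA : ∀ n x, HasSum (fun j => mulSector (w j) n (annSector n (e j) x)) (A n x))
    (hF : ∀ n (s : Finset ℕ) x,
      ‖∑ j ∈ s, mulSector (w j) n (annSector n (e j) x)‖ ≤ β * (n + 2) * ‖x‖)
    {Φ : Hplus d} (hΦ : HasMoment 2 Φ) :
    ∃ Ψ : Hplus d,
      (Φ, Ψ) ∈ (opSum fun j : ℕ => opComp (tracerMul (w j)) (ann (e j))).graph ∧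
      (∀ n, Ψ n = A n (Φ (n + 1))) ∧ ‖Ψ‖ ^ 2 ≤ 4 * β ^ 2 * secondMoment Φ := by
  have hu : ∀ j : ℕ, ∃ u : Hplus d, (Φ, u) ∈ (opComp (tracerMul (w j)) (ann (e j))).graph ∧
      ∀ n, u n = mulSector (w j) n (annSector n (e j) (Φ (n + 1))) := by
    intro j
    obtain ⟨Φ₁, h1, h11, -⟩ := exists_mem_graph_ann (r := 1) hΦ (e j)
    obtain ⟨Φ₂, h2, h21⟩ := exists_mem_graph_tracerMul (hw j) Φ₁
    exact ⟨Φ₂, mem_graph_opComp h1 h2, fun n => by rw [h21, h11]⟩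
  choose u hug hu1 using hu
  have hμ : Summable fun n : ℕ => 4 * β ^ 2 * (((n : ℝ) + 1) ^ 2 * ‖Φ n‖ ^ 2) := hΦ.mul_left _
  obtain ⟨Ψ, hΨ, hsum, hn⟩ := lp_hasSum_of_dominated (u := u) (S := fun n => A n (Φ (n + 1)))
    (fun n => by simp only [hu1]; exact hA n (Φ (n + 1))) ((summable_nat_add_iff 1).2 hμ)
    (fun s n => by
      simp only [hu1]
      exact sq_norm_le_of_linear_growth (Nat.le_succ n) (hF n s (Φ (n + 1))))
  refine ⟨Ψ, mem_graph_opSum hug hsum, hΨ, ?_⟩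
  refine hn.trans ((tsum_nat_add_le hμ (fun n => by positivity) 1).trans (le_of_eq ?_))
  rw [tsum_mul_left]
  rfl

end Fock

/-! ### The block decomposition of the interaction -/

section Interaction

variable {d : ℕ}

/-- The blocks of an operator that changes the number of excitations by at most two. -/
structure Blocks (d : ℕ) where
  /-- the block preserving the number of excitations -/
  diag : ∀ n, sector d (n + 1) →L[ℂ] sector d (n + 1)
  /-- the block creating one excitation -/
  raise : ∀ n, sector d n →L[ℂ] sector d (n + 1)
  /-- the block annihilating one excitation -/
  lower : ∀ n, sector d (n + 1) →L[ℂ] sector d n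
  /-- the block creating two excitations -/
  raiseTwo : ∀ n, sector d n →L[ℂ] sector d (n + 2)
  /-- the block annihilating two excitations -/
  lowerTwo : ∀ n, sector d (n + 2) →L[ℂ] sector d n

/-- `Ψ` is the image of `Φ` under the operator with the given blocks. -/
def Blocks.IsImage (A : Blocks d) (Φ Ψ : Hplus d) : Prop :=
  ∃ S0 S2 S2' S1 S1' : Hplus d,
    Ψ = (2 : ℂ) • S0 + S2 + S2' + S1 + S1' ∧
    -- The operators `a_j* a_k` vanish on sector 0, so `diag n` belongs to sector `n + 1`.
    (S0 0 = 0 ∧ ∀ n, S0 (n + 1) = A.diag n (Φ (n + 1))) ∧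
    (S2 0 = 0 ∧ S2 1 = 0 ∧ ∀ n, S2 (n + 2) = A.raiseTwo n (Φ n)) ∧
    (∀ n, S2' n = A.lowerTwo n (Φ (n + 2))) ∧
    (S1 0 = 0 ∧ ∀ n, S1 (n + 1) = A.raise n (Φ n)) ∧
    ∀ n, S1' n = A.lower n (Φ (n + 1))

/-- The blocks are those of a symmetric operator. -/
structure Blocks.IsSymm (A : Blocks d) : Prop where
  diag : ∀ n x y, ⟪A.diag n x, y⟫_ℂ = ⟪x, A.diag n y⟫_ℂ
  raise : ∀ n x y, ⟪A.raise n x, y⟫_ℂ = ⟪x, A.lower n y⟫_ℂ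
  raiseTwo : ∀ n x y, ⟪A.raiseTwo n x, y⟫_ℂ = ⟪x, A.lowerTwo n y⟫_ℂ

/-- Adjoints of strong sums may be taken termwise after a reindexing. The permutation is there
because taking the adjoint of a product of two mode operators swaps their indices. -/
lemma inner_eq_of_hasSum {ι E F : Type*} [NormedAddCommGroup E] [InnerProductSpace ℂ E]
    [NormedAddCommGroup F] [InnerProductSpace ℂ F] (σ : ι ≃ ι) {u : ι → E} {v : ι → F} {x : F}
    {y : E} {a : E} {b : F} (hu : HasSum u a) (hv : HasSum v b)
    (h : ∀ i, ⟪u i, y⟫_ℂ = ⟪x, v (σ i)⟫_ℂ) : ⟪a, y⟫_ℂ = ⟪x, b⟫_ℂ := by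
  have h1 : HasSum (fun i => ⟪y, u i⟫_ℂ) ⟪y, a⟫_ℂ := hu.mapL (innerSL ℂ y)
  have h2 : HasSum (fun i => ⟪x, v (σ i)⟫_ℂ) ⟪x, b⟫_ℂ :=
    (σ.hasSum_iff.2 hv).mapL (innerSL ℂ x)
  have h3 : HasSum (fun i => conj ⟪y, u i⟫_ℂ) (conj ⟪y, a⟫_ℂ) :=
    Complex.conjCLE.toContinuousLinearMap.hasSum h1
  simp only [inner_conj_symm, h] at h3
  exact h3.unique h2

lemma inner_smul_eq_inner_smul {E F : Type*} [NormedAddCommGroup E] [InnerProductSpace ℂ E]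
    [NormedAddCommGroup F] [InnerProductSpace ℂ F] {u y : E} {x v : F} {a b : ℂ}
    (hab : conj a = b) (h : ⟪u, y⟫_ℂ = ⟪x, v⟫_ℂ) : ⟪a • u, y⟫_ℂ = ⟪x, b • v⟫_ℂ := by
  rw [inner_smul_left, inner_smul_right, hab, h]

lemma exists_sq_bound {ι : Type*} {B : ι → ℂ} (h : Summable fun q => ‖B q‖ ^ 2) :
    ∃ β : ℝ, 0 ≤ β ∧ ∀ F : Finset ι, ∑ q ∈ F, ‖B q‖ ^ 2 ≤ β ^ 2 := by
  refine ⟨Real.sqrt (∑' q, ‖B q‖ ^ 2), Real.sqrt_nonneg _, fun F => ?_⟩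
  rw [Real.sq_sqrt (tsum_nonneg fun q => by positivity)]
  exact h.sum_le_tsum F fun q _ => by positivity

/-- Each term is at most `2 c √M`, and the weights `2 + 1 + 1 + 1 + 1` give 12. -/
lemma norm_five_terms_le {E : Type*} [NormedAddCommGroup E] [NormedSpace ℂ E]
    {x₀ x₁ x₂ x₃ x₄ : E} {c M : ℝ} (hc : 0 ≤ c) (hM : 0 ≤ M) (h₀ : ‖x₀‖ ^ 2 ≤ 4 * c ^ 2 * M)
    (h₁ : ‖x₁‖ ^ 2 ≤ 4 * c ^ 2 * M) (h₂ : ‖x₂‖ ^ 2 ≤ 4 * c ^ 2 * M)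
    (h₃ : ‖x₃‖ ^ 2 ≤ 4 * c ^ 2 * M) (h₄ : ‖x₄‖ ^ 2 ≤ 4 * c ^ 2 * M) :
    ‖(2 : ℂ) • x₀ + x₁ + x₂ + x₃ + x₄‖ ≤ 12 * c * Real.sqrt M := by
  have hsq : ∀ x : E, ‖x‖ ^ 2 ≤ 4 * c ^ 2 * M → ‖x‖ ≤ 2 * c * Real.sqrt M := fun x hx => by
    refine le_of_sq_le_sq (hx.trans (le_of_eq ?_)) (by positivity)
    rw [mul_pow, Real.sq_sqrt hM]
    ring
  have e0 := hsq _ h₀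
  have e1 := hsq _ h₁
  have e2 := hsq _ h₂
  have e3 := hsq _ h₃
  have e4 := hsq _ h₄
  have t1 := norm_add_le ((2 : ℂ) • x₀ + x₁ + x₂ + x₃) x₄
  have t2 := norm_add_le ((2 : ℂ) • x₀ + x₁ + x₂) x₃
  have t3 := norm_add_le ((2 : ℂ) • x₀ + x₁) x₂
  have t4 := norm_add_le ((2 : ℂ) • x₀) x₁
  have t5 : ‖(2 : ℂ) • x₀‖ = 2 * ‖x₀‖ := by rw [norm_smul]; norm_num
  linarith

set_option maxHeartbeats 1000000 in
-- Everything that both parts need about the interaction. Growth is recorded only for the raising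
-- blocks, since symmetry later turns the lowering ones into these. Complex `W` is harmless: its two
-- terms are mutually adjoint as defined.
theorem exists_blocks {φ : ℕ → L2 (Torus d)} (he : Orthonormal ℂ φ)
    (hφ : ⇑(φ 0) =ᵐ[volume] fun _ => (1 : ℂ)) (V W : L2 (Torus d)) :
    ∃ (A : Blocks d) (c : ℝ), 0 ≤ c ∧
      (∀ n x, ‖A.raise n x‖ ≤ c * (n + 2) * ‖x‖) ∧
      (∀ n x, ‖A.raiseTwo n x‖ ≤ c * (n + 2) * ‖x‖) ∧
      (∀ Φ, HasMoment 2 Φ → ∃ Ψ, (Φ, Ψ) ∈ (interaction φ V W).graph ∧ A.IsImage Φ Ψ ∧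
        ‖Ψ‖ ≤ 12 * c * Real.sqrt (secondMoment Φ)) ∧
      ((∀ᵐ y, conj (V y) = V y) → (∀ᵐ y, V (-y) = V y) → A.IsSymm) := by
  have he' := orthonormal_succ he
  obtain ⟨β0, h00, h0⟩ := exists_sq_bound (summable_matV_create_annihilate he hφ V)
  obtain ⟨β2, h20, h2⟩ := exists_sq_bound (summable_matV_create he hφ V)
  obtain ⟨β2', h20', h2'⟩ := exists_sq_bound (summable_matV_annihilate he hφ V)
  -- A single constant dominating the bounds of all five families.
  set c := β0 + β2 + β2' + ‖W‖ with hc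
  have hW0 := norm_nonneg W
  have hc0 : 0 ≤ c := by positivity
  have hw : ∀ j, IsBdd (matW φ W (j + 1) 0) := fun j => by
    rw [matW_eq_conv hφ]; exact isBdd_conv _ _
  have hwβ : ∀ (s : Finset ℕ) x, ∑ j ∈ s, ‖matW φ W (j + 1) 0 x‖ ^ 2 ≤ c ^ 2 := fun s x => by
    simp only [matW_eq_conv hφ]
    exact (sum_norm_conv_sq_le he' s W x).trans (pow_le_pow_left₀ hW0 (by linarith) 2)
  choose A0 hA0 hF0 hB0 using fun n => exists_strongSum_create_annihilate (d := d)
    (B := fun q => matV φ V (q.1 + 1) 0 (q.2 + 1) 0) he' hc0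
    (fun F => (h0 F).trans (pow_le_pow_left₀ h00 (by linarith) 2)) n
  choose A2 hA2 hF2 hB2 using fun n => exists_strongSum_create_create (d := d)
    (B := fun q => matV φ V (q.1 + 1) (q.2 + 1) 0 0) he' hc0
    (fun F => (h2 F).trans (pow_le_pow_left₀ h20 (by linarith) 2)) n
  choose A2' hA2' hF2' hB2' using fun n => exists_strongSum_annihilate_annihilate (d := d)
    (B := fun q => matV φ V 0 0 (q.1 + 1) (q.2 + 1)) he' hc0
    (fun F => (h2' F).trans (pow_le_pow_left₀ h20' (by linarith) 2)) n
  choose A1 hA1 hF1 hB1 using fun n => exists_strongSum_mul_create he' hw hc0 hwβ n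
  choose A1' hA1' hF1' hB1' using fun n => exists_strongSum_mul_annihilate he' hw hc0 hwβ n
  refine ⟨⟨A0, A1, A1', A2, A2'⟩, c, hc0, hB1, hB2, fun Φ hΦ => ?_, fun hV hV' => ?_⟩
  · obtain ⟨S0, g0, p0, q0⟩ := exists_mem_graph_create_annihilate (e := fun j => φ (j + 1))
      (B := fun q => matV φ V (q.1 + 1) 0 (q.2 + 1) 0) hA0 hF0 hΦ
    obtain ⟨S2, g2, p2, q2⟩ := exists_mem_graph_create_create (e := fun j => φ (j + 1))
      (B := fun q => matV φ V (q.1 + 1) (q.2 + 1) 0 0) hA2 hF2 hΦ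
    obtain ⟨S2', g2', p2', q2'⟩ := exists_mem_graph_annihilate_annihilate (e := fun j => φ (j + 1))
      (B := fun q => matV φ V 0 0 (q.1 + 1) (q.2 + 1)) hA2' hF2' hΦ
    obtain ⟨S1, g1, p1, q1⟩ := exists_mem_graph_mul_create (e := fun j => φ (j + 1)) hw hA1 hF1 hΦ
    obtain ⟨S1', g1', p1', q1'⟩ :=
      exists_mem_graph_mul_annihilate (e := fun j => φ (j + 1))
        (w := fun j x => conj (matW φ W (j + 1) 0 x)) (fun j => (hw j).conj) hA1' hF1' hΦ
    refine ⟨(2 : ℂ) • S0 + S2 + S2' + S1 + S1', ?_, ⟨S0, S2, S2', S1, S1', rfl, p0, p2, p2', p1, p1'⟩,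
      ?_⟩
    · exact mem_graph_add (mem_graph_add
        (mem_graph_add (mem_graph_add (mem_graph_smul 2 g0) g2) g2') g1) g1'
    · exact norm_five_terms_le hc0 (tsum_nonneg fun n => by positivity) q0 q2 q2' q1 q1'
  · refine ⟨fun n x y => ?_, fun n x y => ?_, fun n x y => ?_⟩
    · refine inner_eq_of_hasSum (E := sector d (n + 1)) (F := sector d (n + 1))
        (Equiv.prodComm ℕ ℕ) (hA0 n x) (hA0 n y) fun q => ?_
      refine inner_smul_eq_inner_smul (E := sector d (n + 1)) (F := sector d (n + 1))
        (conj_matV_create_annihilate hφ hV hV' _ _) ?_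
      rw [inner_creSector_left, inner_annSector_left]
      rfl
    · refine inner_eq_of_hasSum (E := sector d (n + 1)) (F := sector d n)
        (Equiv.refl ℕ) (hA1 n x) (hA1' n y) fun j => ?_
      rw [inner_mulSector_left (hw j), inner_creSector_left, ← mulSector_annSector (hw j).conj]
      rfl
    · refine inner_eq_of_hasSum (E := sector d (n + 2)) (F := sector d n)
        (Equiv.prodComm ℕ ℕ) (hA2 n x) (hA2' n y) fun q => ?_
      refine inner_smul_eq_inner_smul (E := sector d (n + 2)) (F := sector d n) ?_ ?_
      · rw [matV_annihilate_eq_conj hφ, star_eq_self hV]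
        rfl
      · rw [inner_creSector_left, inner_creSector_left]
        rfl

/-! ### Comparison with the number operator. -/

lemma mem_graph_numberOp_iff {Φ Ψ : Hplus d} :
    (Φ, Ψ) ∈ (numberOp d).graph ↔ ∀ n : ℕ, Ψ n = (n : ℂ) • Φ n :=
  mem_graph_toLinearPMap_iff (numberGraph_functional d)

lemma hasMoment_of_mem_graph_numberOp {Φ Ψ : Hplus d} (h : (Φ, Ψ) ∈ (numberOp d).graph) :
    HasMoment 2 Φ ∧ secondMoment Φ ≤ 2 * ‖Ψ‖ ^ 2 + 2 * ‖Φ‖ ^ 2 := by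
  rw [mem_graph_numberOp_iff] at h
  -- This is `(n + 1)² ≤ 2 n² + 2`, that is, `(n - 1)² ≥ 0`.
  have hb : ∀ n : ℕ, ((n : ℝ) + 1) ^ 2 * ‖Φ n‖ ^ 2 ≤ 2 * ‖Ψ n‖ ^ 2 + 2 * ‖Φ n‖ ^ 2 := by
    intro n
    rw [h n, norm_smul, Complex.norm_natCast]
    nlinarith [mul_nonneg (sq_nonneg ((n : ℝ) - 1)) (sq_nonneg ‖Φ n‖)]
  have hs : Summable fun n => 2 * ‖Ψ n‖ ^ 2 + 2 * ‖Φ n‖ ^ 2 :=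
    ((lp_summable_sq Ψ).mul_left 2).add ((lp_summable_sq Φ).mul_left 2)
  have hm : HasMoment 2 Φ := Summable.of_nonneg_of_le (fun n => by positivity) hb hs
  refine ⟨hm, (Summable.tsum_le_tsum hb hm hs).trans (le_of_eq ?_)⟩
  rw [((lp_summable_sq Ψ).mul_left 2).tsum_add ((lp_summable_sq Φ).mul_left 2), tsum_mul_left,
    tsum_mul_left, lp_norm_sq, lp_norm_sq]

lemma isRelativelyBounded_of_mem_graph {E : Type*} [NormedAddCommGroup E] [NormedSpace ℂ E]
    {A B : E →ₗ.[ℂ] E} {c : ℝ} (hc : 0 ≤ c)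
    (h : ∀ x y, (x, y) ∈ B.graph → ∃ z, (x, z) ∈ A.graph ∧ ‖z‖ ≤ c * ‖y‖ + c * ‖x‖) :
    IsRelativelyBounded A B := by
  have hdom : B.domain ≤ A.domain := by
    intro x hx
    obtain ⟨y, hy⟩ := LinearPMap.mem_domain_iff.1 hx
    obtain ⟨z, hz, -⟩ := h x y hy
    exact LinearPMap.mem_domain_of_mem_graph hz
  refine ⟨hdom, c, c, hc, hc, fun x => ?_⟩
  obtain ⟨z, hz, hn⟩ := h x _ (LinearPMap.mem_graph B x)
  rwa [LinearPMap.mem_graph_snd_inj A (LinearPMap.mem_graph A ⟨(x : E), hdom x.2⟩) hz rfl]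

lemma sqrt_le_of_le_sq_add_sq {M a b : ℝ} (ha : 0 ≤ a) (hb : 0 ≤ b)
    (h : M ≤ 2 * a ^ 2 + 2 * b ^ 2) : Real.sqrt M ≤ 2 * (a + b) := by
  refine Real.sqrt_le_iff.2 ⟨by positivity, h.trans ?_⟩
  nlinarith [mul_nonneg ha hb, sq_nonneg a, sq_nonneg b]

set_option maxHeartbeats 1000000 in
theorem isRelativelyBounded_interaction {φ : ℕ → L2 (Torus d)} (he : Orthonormal ℂ φ)
    (hφ : ⇑(φ 0) =ᵐ[volume] fun _ => (1 : ℂ)) (V W : L2 (Torus d)) :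
    IsRelativelyBounded (interaction φ V W) (numberOp d) := by
  obtain ⟨A, c, hc, -, -, hA, -⟩ := exists_blocks he hφ V W
  refine isRelativelyBounded_of_mem_graph (c := 24 * c) (by positivity) fun Φ Ψ h => ?_
  obtain ⟨hm, hle⟩ := hasMoment_of_mem_graph_numberOp h
  obtain ⟨Θ, hΘ, -, hn⟩ := hA Φ hm
  refine ⟨Θ, hΘ, hn.trans ?_⟩
  have h1 := sqrt_le_of_le_sq_add_sq (norm_nonneg Ψ) (norm_nonneg Φ) hle
  refine (mul_le_mul_of_nonneg_left h1 (by positivity)).trans (le_of_eq (by ring))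

end Interaction

/-! ### Plane waves -/

section PlaneWaves

variable {d n : ℕ}

lemma coeFn_planeWave (k : Fin n → Fin d → ℤ) :
    ⇑(planeWave k) =ᵐ[volume] fun z : Fin n → Torus d => ∏ i, UnitAddTorus.mFourier (k i) (z i) :=
  ContinuousMap.coeFn_toLp (p := 2) (𝕜 := ℂ) (volume : Measure (Fin n → Torus d)) _

/-- The identification of `L²` of `n` particles with `L²` of a torus of dimension `n d`. -/
def uncurryIsometry (d n : ℕ) :
    L2 (Fin n → Torus d) →ₗᵢ[ℂ] L2 (UnitAddTorus (Fin n × Fin d)) :=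
  Lp.compMeasurePreservingₗᵢ ℂ _ (measurePreserving_curry d n)

lemma uncurryIsometry_planeWave (k : Fin n → Fin d → ℤ) :
    uncurryIsometry d n (planeWave k) = UnitAddTorus.mFourierLp 2 fun q => k q.1 q.2 := by
  have hU := measurePreserving_curry d n
  refine Lp.ext ?_
  have h1 := Lp.coeFn_compMeasurePreserving (planeWave k) hU
  have h2 := hU.quasiMeasurePreserving.ae (coeFn_planeWave k)
  filter_upwards [h1, h2, UnitAddTorus.coeFn_mFourierLp 2 fun q : Fin n × Fin d => k q.1 q.2]
    with w h1 h2 h3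
  refine h1.trans (Eq.trans h2 ?_)
  rw [h3]
  simp [UnitAddTorus.mFourier, Fintype.prod_prod_type]

lemma orthonormal_planeWave : Orthonormal ℂ (planeWave : (Fin n → Fin d → ℤ) → _) := by
  rw [← (uncurryIsometry d n).orthonormal_comp_iff]
  have h : uncurryIsometry d n ∘ planeWave =
      fun k : Fin n → Fin d → ℤ => UnitAddTorus.mFourierLp 2 fun q : Fin n × Fin d => k q.1 q.2 :=
    funext uncurryIsometry_planeWave
  rw [h]
  refine UnitAddTorus.orthonormal_mFourier.comp
    (fun (k : Fin n → Fin d → ℤ) (q : Fin n × Fin d) => k q.1 q.2) fun k k' hk => ?_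
  funext i a
  exact congrFun hk (i, a)

/-- The Hilbert basis of plane waves. -/
def planeWaveBasis (d n : ℕ) : HilbertBasis (Fin n → Fin d → ℤ) ℂ (L2 (Fin n → Torus d)) :=
  HilbertBasis.mkOfOrthogonalEqBot orthonormal_planeWave (by
    rw [Submodule.eq_bot_iff]
    intro Φ hΦ
    refine eq_zero_of_planeWave Φ fun k => ?_
    exact (Submodule.mem_orthogonal _ _).1 hΦ _ (Submodule.subset_span ⟨k, rfl⟩))

lemma planeWaveBasis_apply (k : Fin n → Fin d → ℤ) : planeWaveBasis d n k = planeWave k := by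
  rw [planeWaveBasis, HilbertBasis.coe_mkOfOrthogonalEqBot]

/-- Parseval's identity: a Fourier multiplier with real symbol is symmetric. -/
lemma inner_eq_of_multiplier {r : (Fin n → Fin d → ℤ) → ℝ} {x y x' y' : L2 (Fin n → Torus d)}
    (h : ∀ k, ⟪planeWave k, y⟫_ℂ = r k * ⟪planeWave k, x⟫_ℂ)
    (h' : ∀ k, ⟪planeWave k, y'⟫_ℂ = r k * ⟪planeWave k, x'⟫_ℂ) : ⟪y, x'⟫_ℂ = ⟪x, y'⟫_ℂ := by
  have h1 := (planeWaveBasis d n).tsum_inner_mul_inner y x'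
  have h2 := (planeWaveBasis d n).tsum_inner_mul_inner x y'
  refine h1.symm.trans (Eq.trans (tsum_congr fun k => ?_) h2)
  rw [planeWaveBasis_apply, h' k, ← inner_conj_symm, h k, map_mul, Complex.conj_ofReal,
    inner_conj_symm]
  ring

lemma hasSum_norm_inner_planeWave_sq (x : L2 (Fin n → Torus d)) :
    HasSum (fun k => ‖⟪planeWave k, x⟫_ℂ‖ ^ 2) (‖x‖ ^ 2) := by
  have h := (planeWaveBasis d n).hasSum_inner_mul_inner x x
  have h2 : ∀ k, ⟪x, planeWaveBasis d n k⟫_ℂ * ⟪planeWaveBasis d n k, x⟫_ℂ =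
      ((‖⟪planeWave k, x⟫_ℂ‖ ^ 2 : ℝ) : ℂ) := fun k => by
    rw [planeWaveBasis_apply, ← inner_conj_symm, Complex.conj_mul']
    push_cast
    rfl
  simp_rw [h2] at h
  rw [inner_self_eq_ofReal] at h
  exact Complex.hasSum_ofReal.1 h

lemma norm_le_of_planeWave {x y : L2 (Fin n → Torus d)}
    (h : ∀ k, ‖⟪planeWave k, x⟫_ℂ‖ ≤ ‖⟪planeWave k, y⟫_ℂ‖) : ‖x‖ ^ 2 ≤ ‖y‖ ^ 2 :=
  hasSum_le (fun k => pow_le_pow_left₀ (norm_nonneg _) (h k) 2) (hasSum_norm_inner_planeWave_sq x)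
    (hasSum_norm_inner_planeWave_sq y)

lemma relabel_planeWave (σ : Equiv.Perm (Fin n)) (k : Fin n → Fin d → ℤ) :
    relabel σ (planeWave k) = planeWave fun i => k (σ.symm i) := by
  have hmp := measurePreserving_perm d n σ
  refine Lp.ext ?_
  filter_upwards [Lp.coeFn_compMeasurePreserving (planeWave k) hmp,
    hmp.quasiMeasurePreserving.ae (coeFn_planeWave k),
    coeFn_planeWave fun i => k (σ.symm i)] with z h1 h2 h3
  refine h1.trans (Eq.trans h2 (Eq.trans ?_ h3.symm))
  refine Eq.trans ?_ (Equiv.prod_comp σ fun i => UnitAddTorus.mFourier (k (σ.symm i)) (z i))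
  exact Finset.prod_congr rfl fun i _ => by rw [Equiv.symm_apply_apply]

lemma constIn_planeWave (j : Fin (n + 1)) (k : Fin n → Fin d → ℤ) :
    constIn j (planeWave k) = planeWave (j.insertNth 0 k : Fin (n + 1) → Fin d → ℤ) := by
  have hmp := measurePreserving_forget d n j
  refine Lp.ext ?_
  filter_upwards [Lp.coeFn_compMeasurePreserving (planeWave k) hmp,
    hmp.quasiMeasurePreserving.ae (coeFn_planeWave k),
    coeFn_planeWave (j.insertNth 0 k : Fin (n + 1) → Fin d → ℤ)] with z h1 h2 h3
  refine h1.trans (Eq.trans h2 (Eq.trans ?_ h3.symm))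
  rw [Fin.prod_univ_succAbove _ j]
  simp only [Fin.insertNth_apply_same, Fin.insertNth_apply_succAbove, UnitAddTorus.mFourier_zero,
    ContinuousMap.one_apply, one_mul]

/-- The adjoint of `constIn j` maps this wave to a function all of whose Fourier coefficients
vanish. -/
lemma inner_constIn_planeWave {j : Fin (n + 1)} {k : Fin (n + 1) → Fin d → ℤ} (hk : k j ≠ 0)
    (g : L2 (Fin n → Torus d)) : ⟪constIn j g, planeWave k⟫_ℂ = 0 := by
  let h := ContinuousLinearMap.adjoint (constIn (d := d) j).toContinuousLinearMap (planeWave k)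
  have hh : ∀ f, ⟪f, h⟫_ℂ = ⟪constIn j f, planeWave k⟫_ℂ := fun f =>
    ContinuousLinearMap.adjoint_inner_right _ _ _
  have h0 : h = 0 := by
    refine eq_zero_of_planeWave h fun k' => ?_
    rw [hh, constIn_planeWave]
    refine orthonormal_planeWave.2 fun hkk => hk ?_
    rw [← hkk, Fin.insertNth_apply_same]
  rw [← hh, h0, inner_zero_right]

/-- A wave with zero momentum in boson `j` does not depend on its position. Sector vectors therefore
carry only nonzero boson momenta, which is the source of the spectral gap. -/
lemma inner_planeWave_of_mem_sector {Φ : L2 (Config d n)} (hΦ : Φ ∈ sector d n)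
    {k : Fin (n + 1) → Fin d → ℤ} {j : Fin (n + 1)} (hj : j ≠ 0) (hk : k j = 0) :
    ⟪planeWave k, Φ⟫_ℂ = 0 := by
  have h : planeWave k = constIn j (planeWave fun i => k (j.succAbove i)) := by
    rw [constIn_planeWave]
    congr 1
    exact (Fin.insertNth_eq_iff.2 ⟨hk.symm, rfl⟩).symm
  rw [h]
  exact hΦ.2 j hj _

lemma inner_planeWave_perm {Φ : L2 (Config d n)} (hΦ : Φ ∈ sector d n)
    (k : Fin (n + 1) → Fin d → ℤ) {σ : Equiv.Perm (Fin (n + 1))} (hσ : σ 0 = 0) :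
    ⟪planeWave fun i => k (σ i), Φ⟫_ℂ = ⟪planeWave k, Φ⟫_ℂ := by
  rw [← (relabel (d := d) σ).inner_map_map, hΦ.1 σ hσ, relabel_planeWave]
  simp only [Equiv.apply_symm_apply]

/-! ### Fourier truncation -/

/-- The wave vectors with components bounded by `K`. -/
def box (d n K : ℕ) : Finset (Fin n → Fin d → ℤ) :=
  Fintype.piFinset fun _ => Fintype.piFinset fun _ => Finset.Icc (-(K : ℤ)) K

lemma mem_box {K : ℕ} {k : Fin n → Fin d → ℤ} :
    k ∈ box d n K ↔ ∀ i a, -(K : ℤ) ≤ k i a ∧ k i a ≤ K := by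
  simp [box]

lemma tendsto_box (d n : ℕ) : Filter.Tendsto (box d n) Filter.atTop Filter.atTop := by
  refine Filter.tendsto_atTop_finset_of_monotone (fun K L hKL k hk => ?_) fun k => ?_
  · rw [mem_box] at hk ⊢
    intro i a
    have := hk i a
    omega
  · refine ⟨∑ i, ∑ a, (k i a).natAbs, mem_box.2 fun i a => ?_⟩
    have h1 : (k i a).natAbs ≤ ∑ a, (k i a).natAbs :=
      Finset.single_le_sum (f := fun a => (k i a).natAbs) (fun _ _ => Nat.zero_le _)
        (Finset.mem_univ a)
    have h2 : ∑ a, (k i a).natAbs ≤ ∑ i, ∑ a, (k i a).natAbs :=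
      Finset.single_le_sum (f := fun i => ∑ a, (k i a).natAbs) (fun _ _ => Nat.zero_le _)
        (Finset.mem_univ i)
    omega

/-- The Fourier multiplier with symbol `r`, truncated to wave vectors bounded by `K`. -/
def trunc (r : (Fin n → Fin d → ℤ) → ℝ) (K : ℕ) (Φ : L2 (Fin n → Torus d)) :
    L2 (Fin n → Torus d) :=
  ∑ k ∈ box d n K, ((r k : ℂ) * ⟪planeWave k, Φ⟫_ℂ) • planeWave k

lemma inner_planeWave_trunc (r : (Fin n → Fin d → ℤ) → ℝ) (K : ℕ) (Φ : L2 (Fin n → Torus d))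
    (k : Fin n → Fin d → ℤ) :
    ⟪planeWave k, trunc r K Φ⟫_ℂ = if k ∈ box d n K then (r k : ℂ) * ⟪planeWave k, Φ⟫_ℂ else 0 := by
  classical
  rw [trunc, inner_sum]
  simp only [inner_smul_right, orthonormal_iff_ite.1 orthonormal_planeWave, mul_ite, mul_one,
    mul_zero, Finset.sum_ite_eq]

lemma tendsto_trunc (Φ : L2 (Fin n → Torus d)) :
    Filter.Tendsto (fun K => trunc (fun _ => 1) K Φ) Filter.atTop (nhds Φ) := by
  have h := ((planeWaveBasis d n).hasSum_repr Φ)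
  rw [HasSum, SummationFilter.unconditional_filter] at h
  refine (h.comp (tendsto_box d n)).congr fun K => ?_
  simp only [Function.comp_apply, trunc, HilbertBasis.repr_apply_apply, planeWaveBasis_apply,
    Complex.ofReal_one, one_mul]

lemma inner_trunc_im (r : (Fin n → Fin d → ℤ) → ℝ) (K : ℕ) (Φ : L2 (Fin n → Torus d)) :
    (⟪Φ, trunc r K Φ⟫_ℂ).im = 0 := by
  rw [trunc, inner_sum, Complex.im_sum]
  refine Finset.sum_eq_zero fun k _ => ?_
  rw [inner_smul_right, mul_assoc, ← inner_conj_symm Φ, Complex.mul_conj', ← Complex.ofReal_pow,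
    ← Complex.ofReal_mul, Complex.ofReal_im]

/-- The box and the symbol are invariant under boson permutations, and waves with a vanishing boson
momentum have coefficient zero. -/
lemma trunc_mem_sector {r : (Fin (n + 1) → Fin d → ℤ) → ℝ}
    (hr : ∀ k (σ : Equiv.Perm (Fin (n + 1))), σ 0 = 0 → r (fun i => k (σ i)) = r k) (K : ℕ)
    {Φ : L2 (Config d n)} (hΦ : Φ ∈ sector d n) : trunc r K Φ ∈ sector d n := by
  refine ⟨fun σ hσ => ?_, fun j hj g => ?_⟩
  · have hσ' : σ.symm 0 = 0 := by rw [Equiv.symm_apply_eq, hσ]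
    rw [trunc, map_sum]
    refine Finset.sum_equiv (Equiv.arrowCongr σ (Equiv.refl (Fin d → ℤ))) (fun k => ?_)
      fun k _ => ?_
    · simp only [mem_box]
      exact (Equiv.forall_congr_right (q := fun i => ∀ a, -(K : ℤ) ≤ k i a ∧ k i a ≤ K)
        σ.symm).symm
    · change _ = ((r fun i => k (σ.symm i) : ℂ) * ⟪planeWave fun i => k (σ.symm i), Φ⟫_ℂ) •
        planeWave fun i => k (σ.symm i)
      rw [map_smul, relabel_planeWave, hr k _ hσ', inner_planeWave_perm hΦ k hσ']
  · rw [trunc, inner_sum]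
    refine Finset.sum_eq_zero fun k _ => ?_
    rw [inner_smul_right]
    by_cases hk : k j = 0
    · rw [inner_planeWave_of_mem_sector hΦ hj hk, mul_zero, zero_mul]
    · rw [inner_constIn_planeWave hk, mul_zero]

end PlaneWaves

/-! ### The free Hamiltonian -/

section FreeHamiltonian

lemma exists_of_mem_graph_add {E F : Type*} [NormedAddCommGroup E] [NormedSpace ℂ E]
    [NormedAddCommGroup F] [NormedSpace ℂ F] {A B : E →ₗ.[ℂ] F} {x : E} {y : F}
    (h : (x, y) ∈ (A + B).graph) :
    ∃ y₁ y₂, (x, y₁) ∈ A.graph ∧ (x, y₂) ∈ B.graph ∧ y = y₁ + y₂ := by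
  obtain ⟨x, rfl, rfl⟩ := (LinearPMap.mem_graph_iff _).1 h
  exact ⟨A ⟨x, x.2.1⟩, B ⟨x, x.2.2⟩, LinearPMap.mem_graph A ⟨x, x.2.1⟩,
    LinearPMap.mem_graph B ⟨x, x.2.2⟩, rfl⟩

lemma exists_of_mem_graph_smul {E F : Type*} [NormedAddCommGroup E] [NormedSpace ℂ E]
    [NormedAddCommGroup F] [NormedSpace ℂ F] {A : E →ₗ.[ℂ] F} {c : ℂ} {x : E} {y : F}
    (h : (x, y) ∈ (c • A).graph) : ∃ y', (x, y') ∈ A.graph ∧ y = c • y' := by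
  obtain ⟨x, rfl, rfl⟩ := (LinearPMap.mem_graph_iff _).1 h
  exact ⟨A x, LinearPMap.mem_graph A x, rfl⟩

variable {d : ℕ}

/-- The symbol of the free Hamiltonian. -/
def freeSymbol (m : ℝ) (n : ℕ) (k : Fin (n + 1) → Fin d → ℤ) : ℝ :=
  1 / (2 * m) * laplaceSymbol (k 0) + ∑ j : Fin n, laplaceSymbol (k j.succ)

/-- The gap of `-Δ` above the constants; the crude value 1 suffices for the comparison with the
particle number. -/
lemma one_le_laplaceSymbol {k : Fin d → ℤ} (hk : k ≠ 0) : 1 ≤ laplaceSymbol k := by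
  obtain ⟨a, ha⟩ := Function.ne_iff.1 hk
  have h1 : (1 : ℝ) ≤ (k a : ℝ) ^ 2 := by
    have : (1 : ℤ) ≤ k a ^ 2 := Int.one_le_abs ha |>.trans (by
      rw [← sq_abs]; nlinarith [Int.one_le_abs ha])
    exact_mod_cast this
  have h2 : (k a : ℝ) ^ 2 ≤ ∑ a, (k a : ℝ) ^ 2 :=
    Finset.single_le_sum (f := fun a => (k a : ℝ) ^ 2) (fun _ _ => sq_nonneg _)
      (Finset.mem_univ a)
  have h3 : (1 : ℝ) ≤ 4 * Real.pi ^ 2 := by nlinarith [Real.pi_gt_three]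
  unfold laplaceSymbol
  nlinarith

lemma sum_laplaceSymbol_perm {n : ℕ} (k : Fin (n + 1) → Fin d → ℤ)
    {σ : Equiv.Perm (Fin (n + 1))} (hσ : σ 0 = 0) :
    ∑ j : Fin n, laplaceSymbol (k (σ j.succ)) = ∑ j : Fin n, laplaceSymbol (k j.succ) := by
  have h := Equiv.sum_comp σ fun i => laplaceSymbol (k i)
  rw [Fin.sum_univ_succ, Fin.sum_univ_succ, hσ] at h
  exact add_left_cancel h

lemma freeSymbol_perm (m : ℝ) (n : ℕ) (k : Fin (n + 1) → Fin d → ℤ)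
    (σ : Equiv.Perm (Fin (n + 1))) (hσ : σ 0 = 0) :
    freeSymbol m n (fun i => k (σ i)) = freeSymbol m n k := by
  rw [freeSymbol, freeSymbol, sum_laplaceSymbol_perm k hσ, hσ]

/-- The Fourier truncation on the `n`-excitation sector. -/
def truncSector {n : ℕ} (r : (Fin (n + 1) → Fin d → ℤ) → ℝ)
    (hr : ∀ k (σ : Equiv.Perm (Fin (n + 1))), σ 0 = 0 → r (fun i => k (σ i)) = r k) (K : ℕ)
    (Φ : sector d n) : sector d n :=
  ⟨trunc r K Φ, trunc_mem_sector hr K Φ.2⟩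

lemma mem_graph_multiplier_iff {e : ∀ n : ℕ, (Fin (n + 1) → Fin d → ℤ) → ℝ} {Φ Ψ : Hplus d} :
    (Φ, Ψ) ∈ (multiplier e).graph ↔ ∀ (n : ℕ) (k : Fin (n + 1) → Fin d → ℤ),
      ⟪planeWave k, (Ψ n : L2 (Config d n))⟫_ℂ =
        (e n k : ℂ) * ⟪planeWave k, (Φ n : L2 (Config d n))⟫_ℂ :=
  mem_graph_toLinearPMap_iff (multiplierGraph_functional e)

/-- The vector with a single nonzero component. -/
def inSector (n : ℕ) (x : sector d n) : Hplus d := lp.single 2 n x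

lemma inSector_self (n : ℕ) (x : sector d n) : inSector n x n = x := lp.single_apply_self ..

lemma inSector_of_ne {n n' : ℕ} (h : n' ≠ n) (x : sector d n) : inSector n x n' = 0 :=
  lp.single_apply_ne _ _ _ h

lemma mem_graph_multiplier_inSector {e : ∀ n : ℕ, (Fin (n + 1) → Fin d → ℤ) → ℝ} {n : ℕ}
    {x y : sector d n} (h : ∀ k, ⟪planeWave k, (y : L2 (Config d n))⟫_ℂ =
      (e n k : ℂ) * ⟪planeWave k, (x : L2 (Config d n))⟫_ℂ) :
    (inSector n x, inSector n y) ∈ (multiplier e).graph := by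
  refine mem_graph_multiplier_iff.2 fun n' k => ?_
  by_cases hn : n' = n
  · subst hn
    rw [inSector_self, inSector_self, h]
  · rw [inSector_of_ne hn, inSector_of_ne hn]
    simp

lemma mem_graph_freeHamiltonian {m : ℝ} {Φ Ψ : Hplus d}
    (h : (Φ, Ψ) ∈ (freeHamiltonian d m).graph) (n : ℕ) (k : Fin (n + 1) → Fin d → ℤ) :
    ⟪planeWave k, (Ψ n : L2 (Config d n))⟫_ℂ =
      (freeSymbol m n k : ℂ) * ⟪planeWave k, (Φ n : L2 (Config d n))⟫_ℂ := by
  obtain ⟨Ψ₁, Ψ₂, h1, h2, rfl⟩ := exists_of_mem_graph_add h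
  obtain ⟨Ψ₃, h3, rfl⟩ := exists_of_mem_graph_smul h1
  have e3 := mem_graph_multiplier_iff.1 h3 n k
  have e2 := mem_graph_multiplier_iff.1 h2 n k
  change ⟪planeWave k, ((1 / (2 * m) : ℝ) : ℂ) • (Ψ₃ n : L2 (Config d n)) +
    (Ψ₂ n : L2 (Config d n))⟫_ℂ = _
  rw [inner_add_right, inner_smul_right, e3, e2, freeSymbol]
  push_cast
  ring

/-- Each of the `n` bosons contributes at least 1 to the symbol of `dΓ(-Δ)`, so `n ‖Φ n‖` is bounded
by the norm of the `n`-th component of `dΓ(-Δ) Φ`. The domain of `H₀` is an intersection, so this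
summand alone is enough. -/
lemma hasMoment_of_mem_domain_freeHamiltonian {m : ℝ} {Φ : Hplus d}
    (h : Φ ∈ (freeHamiltonian d m).domain) : HasMoment 2 Φ := by
  obtain ⟨Ψ, hΨ⟩ := LinearPMap.mem_domain_iff.1 h
  obtain ⟨-, Ψ₂, -, h2, -⟩ := exists_of_mem_graph_add hΨ
  have hn : ∀ n : ℕ, (n : ℝ) ^ 2 * ‖Φ n‖ ^ 2 ≤ ‖Ψ₂ n‖ ^ 2 := by
    intro n
    have h3 : ‖((n : ℂ) • (Φ n : L2 (Config d n)))‖ ^ 2 ≤ ‖(Ψ₂ n : L2 (Config d n))‖ ^ 2 := by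
      refine norm_le_of_planeWave fun k => ?_
      rw [mem_graph_multiplier_iff.1 h2 n k, inner_smul_right, norm_mul, norm_mul,
        Complex.norm_natCast, Complex.norm_real]
      by_cases hk : ∃ j : Fin n, k j.succ = 0
      · obtain ⟨j, hj⟩ := hk
        rw [inner_planeWave_of_mem_sector (Φ n).2 (Fin.succ_ne_zero j) hj]
        simp
      · push Not at hk
        refine mul_le_mul_of_nonneg_right ?_ (norm_nonneg _)
        refine le_trans ?_ (le_abs_self _)
        calc (n : ℝ) = ∑ _j : Fin n, (1 : ℝ) := by simp
          _ ≤ _ := Finset.sum_le_sum fun j _ => one_le_laplaceSymbol (hk j)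
    rw [norm_smul, mul_pow, Complex.norm_natCast] at h3
    exact h3
  refine Summable.of_nonneg_of_le (fun n => by positivity) (fun n => ?_)
    (((lp_summable_sq Ψ₂).mul_left 2).add ((lp_summable_sq Φ).mul_left 2))
  have := hn n
  nlinarith [mul_nonneg (sq_nonneg ((n : ℝ) - 1)) (sq_nonneg ‖Φ n‖)]

lemma single_smul_add {G : ℕ → Type*} [∀ n, NormedAddCommGroup (G n)]
    [∀ n, NormedSpace ℂ (G n)] (n : ℕ) (c : ℂ) (x y : G n) :
    c • (lp.single 2 n x : lp G 2) + lp.single 2 n y = lp.single 2 n (c • x + y) := by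
  rw [lp.single_add, lp.single_smul]

lemma lp_inner_single_right {G : ℕ → Type*} [∀ n, NormedAddCommGroup (G n)]
    [∀ n, InnerProductSpace ℂ (G n)] (f : lp G 2) (n : ℕ) (x : G n) :
    inner ℂ f (lp.single 2 n x) = inner ℂ (f n) x :=
  lp.inner_single_right n x f

lemma laplaceSymbol_perm {n : ℕ} (k : Fin (n + 1) → Fin d → ℤ)
    (σ : Equiv.Perm (Fin (n + 1))) (hσ : σ 0 = 0) :
    laplaceSymbol (k (σ 0)) = laplaceSymbol (k 0) := by
  rw [hσ]

lemma truncSector_freeSymbol (m : ℝ) {n : ℕ} (K : ℕ) (x : sector d n) :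
    ((1 / (2 * m) : ℝ) : ℂ) •
        truncSector (fun k => laplaceSymbol (k 0)) laplaceSymbol_perm K x +
      truncSector (fun k => ∑ j : Fin n, laplaceSymbol (k j.succ))
        (fun k _ hσ => sum_laplaceSymbol_perm k hσ) K x =
      truncSector (freeSymbol m n) (freeSymbol_perm m n) K x := by
  refine Subtype.ext ?_
  change ((1 / (2 * m) : ℝ) : ℂ) • trunc _ K _ + trunc _ K _ = trunc _ K _
  simp only [trunc]
  rw [Finset.smul_sum, ← Finset.sum_add_distrib]
  refine Finset.sum_congr rfl fun k _ => ?_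
  rw [smul_smul, ← add_smul, freeSymbol]
  congr 1
  push_cast
  ring

lemma mem_graph_multiplier_truncSector {e : ∀ n : ℕ, (Fin (n + 1) → Fin d → ℤ) → ℝ} {n : ℕ}
    (he : ∀ k (σ : Equiv.Perm (Fin (n + 1))), σ 0 = 0 → e n (fun i => k (σ i)) = e n k) (K : ℕ)
    (x : sector d n) :
    (inSector n (truncSector (fun _ => 1) (fun _ _ _ => rfl) K x),
      inSector n (truncSector (e n) he K x)) ∈ (multiplier e).graph :=
  mem_graph_multiplier_inSector fun k => by
    change ⟪planeWave k, trunc _ K _⟫_ℂ = _ * ⟪planeWave k, trunc _ K _⟫_ℂ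
    rw [inner_planeWave_trunc, inner_planeWave_trunc]
    split_ifs <;> simp

/-- Supplies the test vectors: truncated components are trigonometric polynomials, and `H₀` acts on
them explicitly. -/
lemma mem_graph_freeHamiltonian_trunc (m : ℝ) {n : ℕ} (K : ℕ) (x : sector d n) :
    (inSector n (truncSector (fun _ => 1) (fun _ _ _ => rfl) K x),
      inSector n (truncSector (freeSymbol m n) (freeSymbol_perm m n) K x)) ∈
      (freeHamiltonian d m).graph := by
  have h3 := mem_graph_add (mem_graph_smul ((1 / (2 * m) : ℝ) : ℂ)
    (mem_graph_multiplier_truncSector (e := fun _ k => laplaceSymbol (k 0))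
      laplaceSymbol_perm K x))
    (mem_graph_multiplier_truncSector
      (e := fun n k => ∑ j : Fin n, laplaceSymbol (k j.succ))
      (fun k _ hσ => sum_laplaceSymbol_perm k hσ) K x)
  have h4 := single_smul_add (G := fun n => sector d n) n ((1 / (2 * m) : ℝ) : ℂ)
    (truncSector (fun k => laplaceSymbol (k 0)) laplaceSymbol_perm K x)
    (truncSector (fun k => ∑ j : Fin n, laplaceSymbol (k j.succ))
      (fun k _ hσ => sum_laplaceSymbol_perm k hσ) K x)
  have h5 := h4.trans (congrArg (inSector n) (truncSector_freeSymbol m K x))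
  exact (congrArg (fun y => (_, y)) h5) ▸ h3

lemma inner_inSector_right (Ψ : Hplus d) {n : ℕ} (x : sector d n) :
    ⟪Ψ, inSector n x⟫_ℂ = ⟪Ψ n, x⟫_ℂ :=
  lp_inner_single_right (G := fun n => sector d n) Ψ n x

lemma tendsto_truncSector {n : ℕ} (x : sector d n) :
    Filter.Tendsto (fun K => truncSector (fun _ => 1) (fun _ _ _ => rfl) K x) Filter.atTop
      (nhds x) :=
  tendsto_subtype_rng.2 (tendsto_trunc (x : L2 (Config d n)))

lemma dense_domain_freeHamiltonian (m : ℝ) :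
    Dense ((freeHamiltonian d m).domain : Set (Hplus d)) := by
  rw [Submodule.dense_iff_topologicalClosure_eq_top, Submodule.topologicalClosure_eq_top_iff,
    Submodule.eq_bot_iff]
  intro Ψ hΨ
  refine lp.ext (funext fun n => ?_)
  -- A vector orthogonal to the domain is tested against the truncations of its own component, which
  -- converge to that component.
  have h0 : ∀ K, ⟪Ψ n, truncSector (fun _ => 1) (fun _ _ _ => rfl) K (Ψ n)⟫_ℂ = 0 := fun K => by
    rw [← inner_inSector_right]
    exact (Submodule.mem_orthogonal' _ _).1 hΨ _
      (LinearPMap.mem_domain_of_mem_graph (mem_graph_freeHamiltonian_trunc m K (Ψ n)))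
  have h1 : Filter.Tendsto (fun K => ⟪Ψ n, truncSector (fun _ => 1) (fun _ _ _ => rfl) K (Ψ n)⟫_ℂ)
      Filter.atTop (nhds ⟪Ψ n, Ψ n⟫_ℂ) :=
    ((innerSL ℂ (Ψ n)).continuous.tendsto _).comp (tendsto_truncSector (Ψ n))
  simp_rw [h0] at h1
  have h2 := tendsto_nhds_unique tendsto_const_nhds h1
  exact inner_self_eq_zero.1 h2.symm

lemma inner_freeHamiltonian {m : ℝ} {Φ Φ' Ψ Ψ' : Hplus d}
    (h : (Φ, Ψ) ∈ (freeHamiltonian d m).graph) (h' : (Φ', Ψ') ∈ (freeHamiltonian d m).graph) :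
    ⟪Ψ, Φ'⟫_ℂ = ⟪Φ, Ψ'⟫_ℂ := by
  have h1 := lp.hasSum_inner (𝕜 := ℂ) Ψ Φ'
  have h2 := lp.hasSum_inner (𝕜 := ℂ) Φ Ψ'
  have h3 : (fun n => ⟪Ψ n, Φ' n⟫_ℂ) = fun n => ⟪Φ n, Ψ' n⟫_ℂ := funext fun n =>
    inner_eq_of_multiplier (mem_graph_freeHamiltonian h n) (mem_graph_freeHamiltonian h' n)
  exact (h3 ▸ h1).unique h2

end FreeHamiltonian

/-! ### Essential self-adjointness -/

section Sequences

variable {G : ℕ → Type*} [∀ n, NormedAddCommGroup (G n)] [∀ n, InnerProductSpace ℂ (G n)]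

lemma lp_inner_congr {R Φ' Φ R' : lp G 2}
    (h : ∀ n, inner ℂ (R n) (Φ' n) = inner ℂ (Φ n) (R' n)) : inner ℂ R Φ' = inner ℂ Φ R' := by
  have h1 := lp.hasSum_inner (𝕜 := ℂ) R Φ'
  simp only [h] at h1
  exact h1.unique (lp.hasSum_inner (𝕜 := ℂ) Φ R')

/-- Adjointness of a raising and a lowering operator follows block by block once the first `k`
components of the raised vector vanish. -/
lemma lp_inner_eq_of_shift (k : ℕ) {R Φ' Φ R' : lp G 2} (h0 : ∀ n < k, R n = 0)
    (h : ∀ n, inner ℂ (R (n + k)) (Φ' (n + k)) = inner ℂ (Φ n) (R' n)) :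
    inner ℂ R Φ' = inner ℂ Φ R' := by
  have h1 := (hasSum_nat_add_iff' k).2 (lp.hasSum_inner (𝕜 := ℂ) R Φ')
  rw [Finset.sum_eq_zero fun n hn => by rw [h0 n (Finset.mem_range.1 hn), inner_zero_left],
    sub_zero] at h1
  simp only [h] at h1
  exact h1.unique (lp.hasSum_inner (𝕜 := ℂ) Φ R')

lemma lp_inner_eq_of_shift_right (k : ℕ) {R Φ' Φ R' : lp G 2} (h0 : ∀ n < k, R' n = 0)
    (h : ∀ n, inner ℂ (R' (n + k)) (Φ (n + k)) = inner ℂ (Φ' n) (R n)) :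
    inner ℂ R Φ' = inner ℂ Φ R' := by
  rw [← inner_conj_symm, ← lp_inner_eq_of_shift k h0 h, inner_conj_symm]

lemma lp_inner_eq_of_eq_zero (k : ℕ) {Ψ R : lp G 2} (h : ∀ n, n ≠ k → R n = 0) :
    inner ℂ Ψ R = inner ℂ (Ψ k) (R k) :=
  (lp.hasSum_inner (𝕜 := ℂ) Ψ R).unique
    (hasSum_single k fun n hn => by rw [h n hn, inner_zero_right])

lemma inner_eq_of_eq {E F : Type*} [NormedAddCommGroup E] [InnerProductSpace ℂ E]
    [NormedAddCommGroup F] [InnerProductSpace ℂ F] {a u y : E} {x b v : F} (h1 : a = u)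
    (h : inner ℂ u y = inner ℂ x v) (h2 : b = v) : inner ℂ a y = inner ℂ x b := by
  rw [h1, h2, h]

/-- The hypotheses are crossed: creation of one or two excitations is adjoint to the matching
annihilation. -/
lemma inner_five_terms_left {E : Type*} [NormedAddCommGroup E] [InnerProductSpace ℂ E]
    {a b c d e a' b' c' d' e' x y : E} (h1 : inner ℂ a y = inner ℂ x a')
    (h2 : inner ℂ b y = inner ℂ x c') (h3 : inner ℂ c y = inner ℂ x b')
    (h4 : inner ℂ d y = inner ℂ x e') (h5 : inner ℂ e y = inner ℂ x d') :
    inner ℂ ((2 : ℂ) • a + b + c + d + e) y =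
      inner ℂ x ((2 : ℂ) • a' + b' + c' + d' + e') := by
  simp only [inner_add_left, inner_add_right, inner_smul_left, inner_smul_right, h1, h2, h3, h4,
    h5, map_ofNat]
  ring

lemma inner_five_terms_right {E : Type*} [NormedAddCommGroup E] [InnerProductSpace ℂ E]
    {a b c d e x : E} {a' b' c' d' e' : ℂ} (h1 : inner ℂ x a = a') (h2 : inner ℂ x b = b')
    (h3 : inner ℂ x c = c') (h4 : inner ℂ x d = d') (h5 : inner ℂ x e = e') :
    inner ℂ x ((2 : ℂ) • a + b + c + d + e) = 2 * a' + b' + c' + d' + e' := by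
  simp only [inner_add_right, inner_smul_right, h1, h2, h3, h4, h5]

end Sequences

/-! ### Symmetry of the interaction and its action on a single sector. -/

section SelfAdjointness

variable {d : ℕ}

set_option maxHeartbeats 1000000 in
lemma Blocks.IsImage.inner_eq {A : Blocks d} (hA : A.IsSymm) {Φ Ψ Φ' Ψ' : Hplus d}
    (h : A.IsImage Φ Ψ) (h' : A.IsImage Φ' Ψ') : ⟪Ψ, Φ'⟫_ℂ = ⟪Φ, Ψ'⟫_ℂ := by
  obtain ⟨S0, S2, S2', S1, S1', rfl, ⟨a0, a⟩, ⟨b0, b1, b⟩, c, ⟨f0, f⟩, e⟩ := h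
  obtain ⟨T0, T2, T2', T1, T1', rfl, ⟨a0', a'⟩, ⟨b0', b1', b'⟩, c', ⟨f0', f'⟩, e'⟩ := h'
  have b2 : ∀ n < 2, S2 n = 0 := fun n hn => by interval_cases n <;> assumption
  have b2' : ∀ n < 2, T2 n = 0 := fun n hn => by interval_cases n <;> assumption
  have d2 : ∀ n < 1, S1 n = 0 := fun n hn => by interval_cases n; assumption
  have d2' : ∀ n < 1, T1 n = 0 := fun n hn => by interval_cases n; assumption
  refine inner_five_terms_left (E := Hplus d) ?_ ?_ ?_ ?_ ?_
  · refine lp_inner_congr (G := fun n => sector d n) fun n => ?_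
    cases n with
    | zero =>
      exact inner_eq_of_eq a0 ((inner_zero_left _).trans (inner_zero_right _).symm) a0'
    | succ n => exact inner_eq_of_eq (a n) (hA.diag n _ _) (a' n)
  · exact lp_inner_eq_of_shift (G := fun n => sector d n) 2 b2 fun n =>
      inner_eq_of_eq (b n) (hA.raiseTwo n _ _) (c' n)
  · exact lp_inner_eq_of_shift_right (G := fun n => sector d n) 2 b2' fun n =>
      inner_eq_of_eq (b' n) (hA.raiseTwo n _ _) (c n)
  · exact lp_inner_eq_of_shift (G := fun n => sector d n) 1 d2 fun n =>
      inner_eq_of_eq (f n) (hA.raise n _ _) (e' n)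
  · exact lp_inner_eq_of_shift_right (G := fun n => sector d n) 1 d2' fun n =>
      inner_eq_of_eq (f' n) (hA.raise n _ _) (e n)

/-- The component of the diagonal blocks on the `n`-excitation sector. -/
def Blocks.diagPart (A : Blocks d) : ∀ n, sector d n →L[ℂ] sector d n
  | 0 => 0
  | n + 1 => A.diag n

/-- The part of the image of `Ψ` in the `n`-excitation sector that is due to the creation of two
excitations. -/
def Blocks.raiseTwoPart (A : Blocks d) (Ψ : Hplus d) : ∀ n, sector d n
  | 0 => 0
  | 1 => 0
  | n + 2 => A.raiseTwo n (Ψ n)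

/-- The part of the image of `Ψ` in the `n`-excitation sector that is due to the creation of one
excitation. -/
def Blocks.raisePart (A : Blocks d) (Ψ : Hplus d) : ∀ n, sector d n
  | 0 => 0
  | n + 1 => A.raise n (Ψ n)

set_option maxHeartbeats 1000000 in
-- For a vector in one sector only finitely many blocks contribute. By symmetry the lowering blocks
-- are moved onto `Ψ`, leaving only diagonal and raising ones.
lemma Blocks.IsImage.inner_inSector {A : Blocks d} (hA : A.IsSymm) (Ψ : Hplus d) {n : ℕ}
    {x : sector d n} {Θ : Hplus d} (h : A.IsImage (inSector n x) Θ) :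
    ⟪Ψ, Θ⟫_ℂ = 2 * ⟪Ψ n, A.diagPart n x⟫_ℂ + ⟪Ψ (n + 2), A.raiseTwo n x⟫_ℂ +
      ⟪A.raiseTwoPart Ψ n, x⟫_ℂ + ⟪Ψ (n + 1), A.raise n x⟫_ℂ + ⟪A.raisePart Ψ n, x⟫_ℂ := by
  obtain ⟨S0, S2, S2', S1, S1', rfl, ⟨a0, a⟩, ⟨b0, b1, b⟩, c, ⟨f0, f⟩, e⟩ := h
  have h0 : ⟪Ψ, S0⟫_ℂ = ⟪Ψ n, A.diagPart n x⟫_ℂ := by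
    refine (lp_inner_eq_of_eq_zero (G := fun n => sector _ n) n fun k hk => ?_).trans
      (congrArg (⟪Ψ n, ·⟫_ℂ) ?_)
    · cases k with
      | zero => exact a0
      | succ k => rw [a, inSector_of_ne hk, map_zero]
    · cases n with
      | zero => exact a0
      | succ n => rw [a, inSector_self]; rfl
  have h2 : ⟪Ψ, S2⟫_ℂ = ⟪Ψ (n + 2), A.raiseTwo n x⟫_ℂ := by
    refine (lp_inner_eq_of_eq_zero (G := fun n => sector _ n) (n + 2) fun k hk => ?_).trans
      (congrArg (⟪Ψ (n + 2), ·⟫_ℂ) ?_)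
    · match k with
      | 0 => exact b0
      | 1 => exact b1
      | k + 2 => rw [b, inSector_of_ne (by omega), map_zero]
    · rw [b, inSector_self]
  have h2' : ⟪Ψ, S2'⟫_ℂ = ⟪A.raiseTwoPart Ψ n, x⟫_ℂ := by
    have hz : ∀ k, k + 2 ≠ n → S2' k = 0 := fun k hk => by
      rw [c, inSector_of_ne hk, map_zero]
    have hz' : (∀ k, k + 2 ≠ n) → S2' = 0 := fun hk => lp.ext (funext fun k => hz k (hk k))
    match n with
    | 0 => rw [hz' fun k => by omega, inner_zero_right]; exact (inner_zero_left _).symm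
    | 1 => rw [hz' fun k => by omega, inner_zero_right]; exact (inner_zero_left _).symm
    | n + 2 =>
      refine (lp_inner_eq_of_eq_zero (G := fun n => sector _ n) n
        fun k hk => hz k (by omega)).trans ?_
      refine (congrArg (⟪Ψ n, ·⟫_ℂ) ?_).trans (hA.raiseTwo n _ _).symm
      rw [c, inSector_self]
  have h1 : ⟪Ψ, S1⟫_ℂ = ⟪Ψ (n + 1), A.raise n x⟫_ℂ := by
    refine (lp_inner_eq_of_eq_zero (G := fun n => sector _ n) (n + 1) fun k hk => ?_).trans
      (congrArg (⟪Ψ (n + 1), ·⟫_ℂ) ?_)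
    · match k with
      | 0 => exact f0
      | k + 1 => rw [f, inSector_of_ne (by omega), map_zero]
    · rw [f, inSector_self]
  have h1' : ⟪Ψ, S1'⟫_ℂ = ⟪A.raisePart Ψ n, x⟫_ℂ := by
    have hz : ∀ k, k + 1 ≠ n → S1' k = 0 := fun k hk => by
      rw [e, inSector_of_ne hk, map_zero]
    match n with
    | 0 =>
      rw [show S1' = 0 from lp.ext (funext fun k => hz k (by omega)), inner_zero_right]
      exact (inner_zero_left _).symm
    | n + 1 =>
      refine (lp_inner_eq_of_eq_zero (G := fun n => sector _ n) n
        fun k hk => hz k (by omega)).trans ?_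
      refine (congrArg (⟪Ψ n, ·⟫_ℂ) ?_).trans (hA.raise n _ _).symm
      rw [e, inSector_self]
  exact inner_five_terms_right (E := Hplus d) h0 h2 h2' h1 h1'

end SelfAdjointness

/-! ### Vanishing of the deficiency vectors. -/

section Deficiency

variable {d : ℕ}

lemma im_inner_eq_zero_of_symm {E : Type*} [NormedAddCommGroup E] [InnerProductSpace ℂ E]
    {x y : E} (h : inner ℂ y x = inner ℂ x y) : (inner ℂ x y).im = 0 :=
  Complex.conj_eq_iff_im.1 ((inner_conj_symm y x).trans h)

lemma Blocks.IsSymm.im_inner_diagPart {A : Blocks d} (hA : A.IsSymm) {n : ℕ} (x : sector d n) :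
    (⟪x, A.diagPart n x⟫_ℂ).im = 0 := by
  refine im_inner_eq_zero_of_symm ?_
  cases n with
  | zero => exact (inner_zero_left _).trans (inner_zero_right _).symm
  | succ n => exact hA.diag n x x

lemma continuous_inner_clm {E F : Type*} [NormedAddCommGroup E] [InnerProductSpace ℂ E]
    [NormedAddCommGroup F] [InnerProductSpace ℂ F] (x : F) (B : E →L[ℂ] F) :
    Continuous fun y => inner ℂ x (B y) :=
  continuous_const.inner B.continuous

/-- The form of `H₀` in the truncations of `Ψ n` may diverge as `K` grows, but it is real for each
`K`. All other terms are continuous in the test vector, so the limit is taken after passing to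
imaginary parts. -/
lemma im_deficiency {A : Blocks d} (hA : A.IsSymm) {m : ℝ} {z : ℂ} {Ψ : Hplus d} {n : ℕ}
    (h : ∀ K, ∃ Θ, A.IsImage (inSector n (truncSector (fun _ => 1) (fun _ _ _ => rfl) K (Ψ n))) Θ ∧
      ⟪Ψ, inSector n (truncSector (freeSymbol m n) (freeSymbol_perm m n) K (Ψ n)) + Θ⟫_ℂ =
        z * ⟪Ψ, inSector n (truncSector (fun _ => 1) (fun _ _ _ => rfl) K (Ψ n))⟫_ℂ) :
    z.im * ‖Ψ n‖ ^ 2 = (⟪Ψ (n + 2), A.raiseTwo n (Ψ n)⟫_ℂ).im +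
      (⟪A.raiseTwoPart Ψ n, Ψ n⟫_ℂ).im + (⟪Ψ (n + 1), A.raise n (Ψ n)⟫_ℂ).im +
      (⟪A.raisePart Ψ n, Ψ n⟫_ℂ).im := by
  let f : sector d n → ℂ := fun x =>
    2 * ⟪Ψ n, A.diagPart n x⟫_ℂ + ⟪Ψ (n + 2), A.raiseTwo n x⟫_ℂ +
      ⟪A.raiseTwoPart Ψ n, x⟫_ℂ + ⟪Ψ (n + 1), A.raise n x⟫_ℂ + ⟪A.raisePart Ψ n, x⟫_ℂ -
      z * ⟪Ψ n, x⟫_ℂ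
  have hid : ∀ y : sector d n, Continuous fun x : sector d n => ⟪y, x⟫_ℂ := fun y =>
    continuous_inner_clm y (ContinuousLinearMap.id ℂ (sector d n))
  have hf : Continuous f :=
    ((((((continuous_inner_clm (Ψ n) (A.diagPart n)).const_mul 2).add
      (continuous_inner_clm (Ψ (n + 2)) (A.raiseTwo n))).add (hid _)).add
      (continuous_inner_clm (Ψ (n + 1)) (A.raise n))).add (hid _)).sub ((hid _).const_mul z)
  have h0 : ∀ K, (f (truncSector (fun _ => 1) (fun _ _ _ => rfl) K (Ψ n))).im = 0 := fun K => by
    obtain ⟨Θ, hΘ, he⟩ := h K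
    have h1 := Blocks.IsImage.inner_inSector hA Ψ hΘ
    have h2 := inner_inSector_right Ψ (truncSector (freeSymbol m n) (freeSymbol_perm m n) K (Ψ n))
    have h3 := inner_inSector_right Ψ (truncSector (fun _ => 1) (fun _ _ _ => rfl) K (Ψ n))
    have h4 : (⟪Ψ n, truncSector (freeSymbol m n) (freeSymbol_perm m n) K (Ψ n)⟫_ℂ).im = 0 :=
      inner_trunc_im (freeSymbol m n) K (Ψ n : L2 (Config d n))
    have h5 := (inner_add_right Ψ
      (inSector n (truncSector (freeSymbol m n) (freeSymbol_perm m n) K (Ψ n))) Θ).symm.trans he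
    -- By the deficiency equation, `f` at a truncation is minus the term with `H₀`.
    have h6 : f (truncSector (fun _ => 1) (fun _ _ _ => rfl) K (Ψ n)) =
        -⟪Ψ n, truncSector (freeSymbol m n) (freeSymbol_perm m n) K (Ψ n)⟫_ℂ := by
      linear_combination h5 - h1 - h2 + z * h3
    rw [h6, Complex.neg_im, h4, neg_zero]
  have h7 : Filter.Tendsto (fun K => (f (truncSector (fun _ => 1) (fun _ _ _ => rfl) K (Ψ n))).im)
      Filter.atTop (nhds (f (Ψ n)).im) :=
    ((Complex.continuous_im.comp hf).tendsto _).comp (tendsto_truncSector (Ψ n))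
  simp only [h0] at h7
  have h8 := tendsto_nhds_unique h7 tendsto_const_nhds
  have h9 : (z * ⟪Ψ n, Ψ n⟫_ℂ).im = z.im * ‖Ψ n‖ ^ 2 := by
    rw [show ⟪Ψ n, Ψ n⟫_ℂ = ((‖Ψ n‖ ^ 2 : ℝ) : ℂ) from inner_self_eq_ofReal (Ψ n),
      Complex.im_mul_ofReal]
  have h10 : ((2 : ℂ) * ⟪Ψ n, A.diagPart n (Ψ n)⟫_ℂ).im = 0 := by
    rw [show (2 : ℂ) = ((2 : ℝ) : ℂ) by norm_num, Complex.im_ofReal_mul,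
      hA.im_inner_diagPart, mul_zero]
  simp only [f, Complex.sub_im, Complex.add_im, h9, h10] at h8
  linarith

/-- `b n` is the current from sector `n` to `n + 2` and `c n` that from `n` to `n + 1`. Only the
currents leaving the sectors `0, …, N + 1` are not cancelled. -/
lemma sum_range_telescoping {F b c : ℕ → ℝ} (h0 : F 0 = b 0 + c 0) (h1 : F 1 = b 1 + c 1 - c 0)
    (h : ∀ n, F (n + 2) = b (n + 2) + c (n + 2) - b n - c (n + 1)) (N : ℕ) :
    ∑ n ∈ Finset.range (N + 2), F n = b N + b (N + 1) + c (N + 1) := by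
  induction N with
  | zero => rw [Finset.sum_range_succ, Finset.sum_range_one, h0, h1]; ring
  | succ N ih => rw [Finset.sum_range_succ, ih, h]; ring

lemma im_inner_symm {E : Type*} [NormedAddCommGroup E] [InnerProductSpace ℂ E] (x y : E) :
    (inner ℂ x y).im = -(inner ℂ y x).im := by
  rw [← inner_conj_symm, Complex.conj_im]

lemma abs_im_inner_le {E F : Type*} [NormedAddCommGroup E] [InnerProductSpace ℂ E]
    [NormedAddCommGroup F] [InnerProductSpace ℂ F] {x : F} {y : E} {B : E →L[ℂ] F} {C : ℝ}
    (hB : ‖B y‖ ≤ C * ‖y‖) : |(inner ℂ x (B y)).im| ≤ C * (‖y‖ * ‖x‖) := by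
  refine (Complex.abs_im_le_norm _).trans ((norm_inner_le_norm _ _).trans ?_)
  have := mul_le_mul_of_nonneg_left hB (norm_nonneg x)
  linarith

set_option maxHeartbeats 1000000 in
lemma eq_zero_of_im_deficiency {A : Blocks d} {c : ℝ} (hc : 0 ≤ c)
    (h1 : ∀ n x, ‖A.raise n x‖ ≤ c * (n + 2) * ‖x‖)
    (h2 : ∀ n x, ‖A.raiseTwo n x‖ ≤ c * (n + 2) * ‖x‖) {s : ℝ} (hs : s = 1 ∨ s = -1)
    {Ψ : Hplus d} (h : ∀ n, s * ‖Ψ n‖ ^ 2 = (⟪Ψ (n + 2), A.raiseTwo n (Ψ n)⟫_ℂ).im +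
      (⟪A.raiseTwoPart Ψ n, Ψ n⟫_ℂ).im + (⟪Ψ (n + 1), A.raise n (Ψ n)⟫_ℂ).im +
      (⟪A.raisePart Ψ n, Ψ n⟫_ℂ).im) : Ψ = 0 := by
  -- Since `n + 2 ≤ 2 (n + 1)`, the telescoping criterion applies with constant `2 * c`.
  have hle : ∀ n : ℕ, c * ((n : ℝ) + 2) ≤ 2 * c * (n + 1) := fun n => by
    nlinarith [mul_nonneg hc n.cast_nonneg (α := ℝ)]
  have hz2 : ∀ {n} (x : sector d n), (⟪(0 : sector d n), x⟫_ℂ).im = 0 := fun x =>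
    (congrArg Complex.im (inner_zero_left x)).trans Complex.zero_im
  have hx := eq_zero_of_telescoping (x := fun n => ‖Ψ n‖)
    (β := fun n => (⟪Ψ (n + 2), A.raiseTwo n (Ψ n)⟫_ℂ).im)
    (γ := fun n => (⟪Ψ (n + 1), A.raise n (Ψ n)⟫_ℂ).im) (C := 2 * c) hs (lp_summable_sq Ψ)
    (fun n => (abs_im_inner_le (h2 n (Ψ n))).trans
      (mul_le_mul_of_nonneg_right (hle n) (by positivity)))
    (fun n => (abs_im_inner_le (h1 n (Ψ n))).trans
      (mul_le_mul_of_nonneg_right (hle n) (by positivity))) (by positivity) (fun N => by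
      rw [Finset.mul_sum]
      refine sum_range_telescoping (F := fun n => s * ‖Ψ n‖ ^ 2)
        (b := fun n => (⟪Ψ (n + 2), A.raiseTwo n (Ψ n)⟫_ℂ).im)
        (c := fun n => (⟪Ψ (n + 1), A.raise n (Ψ n)⟫_ℂ).im) ?_ ?_ (fun n => ?_) N
      · have e := h 0
        have e1 : (⟪A.raiseTwoPart Ψ 0, Ψ 0⟫_ℂ).im = 0 := hz2 (Ψ 0)
        have e2 : (⟪A.raisePart Ψ 0, Ψ 0⟫_ℂ).im = 0 := hz2 (Ψ 0)
        linarith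
      · have e := h 1
        have e1 : (⟪A.raiseTwoPart Ψ 1, Ψ 1⟫_ℂ).im = 0 := hz2 (Ψ 1)
        -- Exchanging the arguments conjugates the inner product, so a current into a sector is
        -- minus the current out of the lower one.
        have e2 : (⟪A.raisePart Ψ 1, Ψ 1⟫_ℂ).im = -(⟪Ψ 1, A.raise 0 (Ψ 0)⟫_ℂ).im :=
          im_inner_symm _ _
        linarith
      · have e := h (n + 2)
        have e1 : (⟪A.raiseTwoPart Ψ (n + 2), Ψ (n + 2)⟫_ℂ).im =
          -(⟪Ψ (n + 2), A.raiseTwo n (Ψ n)⟫_ℂ).im := im_inner_symm _ _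
        have e2 : (⟪A.raisePart Ψ (n + 2), Ψ (n + 2)⟫_ℂ).im =
          -(⟪Ψ (n + 2), A.raise (n + 1) (Ψ (n + 1))⟫_ℂ).im := im_inner_symm _ _
        linarith)
  exact lp.ext (funext fun n => norm_eq_zero.1 (hx n))

end Deficiency

lemma inner_add_eq_inner_add {E : Type*} [NormedAddCommGroup E] [InnerProductSpace ℂ E]
    {x y a b a' b' : E} (h1 : inner ℂ a y = inner ℂ x a') (h2 : inner ℂ b y = inner ℂ x b') :
    inner ℂ (a + b) y = inner ℂ x (a' + b') := by
  rw [inner_add_left, inner_add_right, h1, h2]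

/-! ### Essential self-adjointness of the Bogoliubov–Fröhlich Hamiltonian. -/

section Main

variable {d : ℕ}

set_option maxHeartbeats 1000000 in
theorem isEssentiallySelfAdjointOn_hamiltonianBF (m : ℝ) {φ : ℕ → L2 (Torus d)}
    (he : Orthonormal ℂ φ) (hφ : ⇑(φ 0) =ᵐ[volume] fun _ => (1 : ℂ)) {V : L2 (Torus d)}
    (W : L2 (Torus d)) (hV : ∀ᵐ y, conj (V y) = V y) (hV' : ∀ᵐ y, V (-y) = V y) :
    IsEssentiallySelfAdjointOn (hamiltonianBF m φ V W) (freeHamiltonian d m).domain := by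
  obtain ⟨A, c, hc, hr, hr2, hI, hs⟩ := exists_blocks he hφ V W
  have hA := hs hV hV'
  have key : ∀ {Φ Ψ : Hplus d}, (Φ, Ψ) ∈ (freeHamiltonian d m).graph →
      ∃ Θ, A.IsImage Φ Θ ∧ (Φ, Ψ + Θ) ∈ (hamiltonianBF m φ V W).graph := fun {Φ Ψ} h => by
    obtain ⟨Θ, hΘ, hi, -⟩ := hI Φ
      (hasMoment_of_mem_domain_freeHamiltonian (LinearPMap.mem_domain_of_mem_graph h))
    exact ⟨Θ, hi, mem_graph_add h hΘ⟩
  have hle : (freeHamiltonian d m).domain ≤ (hamiltonianBF m φ V W).domain := fun Φ h => by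
    obtain ⟨Ψ, hΨ⟩ := LinearPMap.mem_domain_iff.1 h
    obtain ⟨Θ, -, hΘ⟩ := key hΨ
    exact LinearPMap.mem_domain_of_mem_graph hΘ
  set T := (hamiltonianBF m φ V W).domRestrict (freeHamiltonian d m).domain with hT
  have hdom : T.domain = (freeHamiltonian d m).domain := inf_eq_left.2 hle
  have hTx : ∀ x : T.domain, ∃ Ψ Θ, ((x : Hplus d), Ψ) ∈ (freeHamiltonian d m).graph ∧
      A.IsImage x Θ ∧ T x = Ψ + Θ := fun x => by
    have hx : (x : Hplus d) ∈ (freeHamiltonian d m).domain := x.2.1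
    obtain ⟨Ψ, hΨ⟩ := LinearPMap.mem_domain_iff.1 hx
    obtain ⟨Θ, hi, hΘ⟩ := key hΨ
    refine ⟨Ψ, Θ, hΨ, hi, ?_⟩
    exact LinearPMap.mem_graph_snd_inj _ (LinearPMap.mem_graph _ ⟨(x : Hplus d), x.2.2⟩) hΘ rfl
  have hd : Dense (T.domain : Set (Hplus d)) := hdom ▸ dense_domain_freeHamiltonian m
  refine ⟨hle, dense_domain_freeHamiltonian m, isSelfAdjoint_closure_of_deficiency T hd ?_ ?_⟩
  · intro x y
    obtain ⟨Ψ, Θ, h1, h2, h3⟩ := hTx x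
    obtain ⟨Ψ', Θ', h1', h2', h3'⟩ := hTx y
    have h4 := inner_freeHamiltonian h1 h1'
    have h5 := Blocks.IsImage.inner_eq hA h2 h2'
    exact inner_eq_of_eq h3 (inner_add_eq_inner_add h4 h5) h3'
  · intro z hz Ψ hΨ
    -- The sign in the telescoping identity is `z.im`, which is `1` or `-1`; the test vectors are
    -- the truncations of `Ψ n`.
    refine eq_zero_of_im_deficiency hc hr hr2 (s := z.im) ?_ fun n => im_deficiency (m := m) hA
      fun K => ?_
    · rcases hz with rfl | rfl <;> simp
    · have h1 := mem_graph_freeHamiltonian_trunc m K (Ψ n)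
      obtain ⟨Θ, hi, hΘ⟩ := key h1
      have hx : inSector n (truncSector (fun _ => 1) (fun _ _ _ => rfl) K (Ψ n)) ∈ T.domain :=
        hdom ▸ LinearPMap.mem_domain_of_mem_graph h1
      have h2 := hΨ ⟨_, hx⟩
      refine ⟨Θ, hi, Eq.trans ?_ h2⟩
      congr 1
      exact LinearPMap.mem_graph_snd_inj _ hΘ (LinearPMap.mem_graph _ ⟨_, hx.2⟩) rfl

end Main

end BogFrohlich
end

theorem mainTheorem3 {d : ℕ} (hd : 0 < d) (m : ℝ) (hm : 0 < m)
    (φ : HilbertBasis ℕ ℂ (BogFrohlich.L2 (BogFrohlich.Torus d)))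
    (hφ : ⇑(φ 0) =ᵐ[volume] fun _ => (1 : ℂ))
    (V W : BogFrohlich.L2 (BogFrohlich.Torus d)) :
    BogFrohlich.IsRelativelyBounded (BogFrohlich.interaction φ V W) (BogFrohlich.numberOp d) ∧
    ((∀ᵐ y, conj (V y) = V y) → (∀ᵐ y, V (-y) = V y) →
      BogFrohlich.IsEssentiallySelfAdjointOn (BogFrohlich.hamiltonianBF m φ V W)
        (BogFrohlich.freeHamiltonian d m).domain) := by
  exact ⟨BogFrohlich.isRelativelyBounded_interaction φ.orthonormal hφ V W, fun hV hV' =>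
    BogFrohlich.isEssentiallySelfAdjointOn_hamiltonianBF m φ.orthonormal hφ W hV hV'⟩
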